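/- Let $(M,\mathbf g)$ be a smooth $n$-dimensional Riemannian manifold, $p\in M$, and let $0<t<\operatorname{inj}(p)$, where $\operatorname{inj}(p)$ is the injectivity radius at $p$, i.e. the supremum of the radii $R$ such that $\exp_p$ is defined on the open ball of radius $R$ in $T_pM$ and is a diffeomorphism from it onto its image. Let $r_p=\operatorname{dist}(p,\cdot)$, $B_t(p)=\{r_p<t\}$ and $S_t^{n-1}(p)=\partial B_t(p)$. Let $\lambda\in\mathbb R$ and let $u$ be a real function that is $C^2$ in $B_t(p)$, $C^1$ in a neighbourhood of $\overline{B_t(p)}$, and satisfies $$\Delta u+\lambda u=0\quad\text{in } B_t(p),$$ where $\Delta$ is the Laplace–Beltrami operator (the trace of the Hessian $\nabla^2$). Let $\varphi:(0,\infty)\to(0,\infty)$ be a function such that $\nabla r_p/\varphi(r_p)$ is (extends across $p$ to) a smooth vector field on a neighbourhood of $\overline{B_t(p)}$. Write $u_r=\langle\nabla u,\nabla r_p\rangle$ for the radial derivative, $u_n$ for the outward normal derivative of $u$ on $S_t^{n-1}(p)$ and $\nabla_{S_t^{n-1}(p)}u$ for the gradient of $u$ along $S_t^{n-1}(p)$,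 i.e. the tangential component of $\nabla u$. Then all the integrands below are integrable, and $$ \begin{aligned} \int_{S_t^{n-1}(p)}|\nabla_{S_t^{n-1}(p)}u|^2-u_n^2\,dS ={}&\varphi(t)\int_{B_t(p)}|\nabla u|^2\,\frac{\varphi(r_p)\,\Delta r_p-\varphi'(r_p)}{\varphi^2(r_p)}\,d\mathrm{vol}\\ &-2\varphi(t)\int_{B_t(p)}\frac{\bigl(\nabla^2r_p(\nabla u,\nabla u)-\lambda\,u_r\,u\bigr)\varphi(r_p)-\varphi'(r_p)\,u_r^2}{\varphi^2(r_p)}\,d\mathrm{vol}, \end{aligned} $$ where $d\mathrm{vol}$ is the Riemannian volume measure of $M$ and $dS$ the Riemannian surface measure of $S_t^{n-1}(p)$. -/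

import Mathlib

open MeasureTheory Bundle Manifold
open scoped ContDiff ENNReal

namespace RiemGeom

noncomputable section

/-- The model space of an `n`-dimensional manifold. -/
abbrev Eucl (n : ℕ) : Type := EuclideanSpace ℝ (Fin n)

/-- The partial derivative `∂ᵢ f` at `y` of a function on a coordinate domain. -/
def pderiv {k : ℕ} (i : Fin k) (f : Eucl k → ℝ) (y : Eucl k) : ℝ :=
  fderiv ℝ f y (EuclideanSpace.single i 1)

section Defs

variable (n : ℕ) {M : Type*} [EMetricSpace M] [ChartedSpace (Eucl n) M]

/-- The coordinates of the tangent vector `v` at `x` in the preferred chart at `x`. -/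
def coords {x : M} (v : TangentSpace (𝓡 n) x) : Eucl n :=
  mfderiv (𝓡 n) 𝓘(ℝ, Eucl n) (extChartAt (𝓡 n) x) x v

variable [RiemannianBundle (fun x : M ↦ TangentSpace (𝓡 n) x)]

/-- The Gram matrix `⟨∂ᵢF, ∂ⱼF⟩` at `y` of a map `F` from (a subset of) `ℝᵏ` to the Riemannian
manifold `M`, that is, the matrix of the pulled back metric `F^* g`. -/
def gram {k : ℕ} (F : Eucl k → M) (y : Eucl k) : Matrix (Fin k) (Fin k) ℝ :=
  Matrix.of fun i j ↦
    inner ℝ (mfderiv (𝓡 k) (𝓡 n) F y (EuclideanSpace.single i (1 : ℝ)))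
      (mfderiv (𝓡 k) (𝓡 n) F y (EuclideanSpace.single j (1 : ℝ)))

/-- The matrix `gᵢⱼ(y)` of the metric in the coordinates of the preferred chart at `x`. -/
def metricCoeff (x : M) (y : Eucl n) : Matrix (Fin n) (Fin n) ℝ :=
  gram n (extChartAt (𝓡 n) x).symm y

/-- The Christoffel symbol `Γᵏᵢⱼ = ½ ∑ₗ gᵏˡ (∂ᵢ gⱼₗ + ∂ⱼ gᵢₗ - ∂ₗ gᵢⱼ)` at `y`, in the coordinates
of the preferred chart at `x`. -/
def christoffel (x : M) (k i j : Fin n) (y : Eucl n) : ℝ :=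
  (1 / 2) * ∑ l, (metricCoeff n x y)⁻¹ k l *
    (pderiv i (fun z ↦ metricCoeff n x z j l) y + pderiv j (fun z ↦ metricCoeff n x z i l) y
      - pderiv l (fun z ↦ metricCoeff n x z i j) y)

/-- The components `(∇²f)ᵢⱼ = ∂ᵢ∂ⱼf - ∑ₖ Γᵏᵢⱼ ∂ₖf` at `x` of the Hessian of `f`, in the preferred
chart at `x`. -/
def hessCoeff (f : M → ℝ) (x : M) (i j : Fin n) : ℝ :=
  pderiv i (pderiv j (f ∘ (extChartAt (𝓡 n) x).symm)) (extChartAt (𝓡 n) x x)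
    - ∑ k, christoffel n x k i j (extChartAt (𝓡 n) x x) *
        pderiv k (f ∘ (extChartAt (𝓡 n) x).symm) (extChartAt (𝓡 n) x x)

/-- The Laplace-Beltrami operator: `Δf = ∑ᵢⱼ gⁱʲ (∇²f)ᵢⱼ`, the trace of the Hessian. -/
def laplacian (f : M → ℝ) (x : M) : ℝ :=
  ∑ i : Fin n, ∑ j : Fin n,
    (metricCoeff n x (extChartAt (𝓡 n) x x))⁻¹ i j * hessCoeff n f x i j

/-- The Hessian `∇²f(v, w)` at `x`. -/
def hessian (f : M → ℝ) (x : M) (v w : TangentSpace (𝓡 n) x) : ℝ :=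
  ∑ i, ∑ j, hessCoeff n f x i j * coords n v i * coords n w j

instance (x : M) : FiniteDimensional ℝ (TangentSpace (𝓡 n) x) :=
  inferInstanceAs (FiniteDimensional ℝ (Eucl n))

instance (x : M) : CompleteSpace (TangentSpace (𝓡 n) x) :=
  FiniteDimensional.complete ℝ _

/-- The Riemannian gradient: the tangent vector that represents `df`. -/
def grad (f : M → ℝ) (x : M) : TangentSpace (𝓡 n) x :=
  (InnerProductSpace.toDual ℝ (TangentSpace (𝓡 n) x)).symm (mfderiv (𝓡 n) 𝓘(ℝ) f x)

theorem inner_grad (f : M → ℝ) (x : M) (v : TangentSpace (𝓡 n) x) :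
    inner ℝ (grad n f x) v = (mfderiv (𝓡 n) 𝓘(ℝ) f x v : ℝ) :=
  InnerProductSpace.toDual_symm_apply

/-! ### Geodesics and the injectivity radius -/

/-- `γ` is a geodesic on the open set `J` of times: it is `C²` there and, in local coordinates,
`(γᵏ)'' + ∑ᵢⱼ Γᵏᵢⱼ (γⁱ)' (γʲ)' = 0`. -/
def IsGeodesicOn (γ : ℝ → M) (J : Set ℝ) : Prop :=
  ContMDiffOn 𝓘(ℝ) (𝓡 n) 2 γ J ∧
  ∀ s ∈ J, ∀ k : Fin n,
    letI c : ℝ → Eucl n := fun s' ↦ extChartAt (𝓡 n) (γ s) (γ s')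
    deriv (deriv c) s k
      + ∑ i, ∑ j, christoffel n (γ s) k i j (c s) * deriv c s i * deriv c s j = 0

/-- `e` is the exponential map at `p` on the open ball of radius `R` of `T_pM`: it maps every ray
`s ↦ s v` in that ball to the geodesic that starts at `p` with velocity `v`. -/
def IsExpMapOn (p : M) (R : ℝ≥0∞) (e : TangentSpace (𝓡 n) p → M) : Prop :=
  ∀ v : TangentSpace (𝓡 n) p,
    IsGeodesicOn n (fun s : ℝ ↦ e (s • v)) {s | ‖s • v‖ₑ < R} ∧
    e 0 = p ∧
    deriv (fun s : ℝ ↦ extChartAt (𝓡 n) p (e (s • v))) 0 = coords n v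

/-- The injectivity radius at `p`: the supremum of the radii `R` such that the exponential map at
`p` is defined on the open ball of radius `R` of `T_pM` and is there a diffeomorphism onto its
image (a smooth injective map whose differential is injective, hence bijective). -/
def injRadius (p : M) : ℝ≥0∞ :=
  sSup {R : ℝ≥0∞ | ∃ e : TangentSpace (𝓡 n) p → M, IsExpMapOn n p R e ∧
    ContMDiffOn 𝓘(ℝ, TangentSpace (𝓡 n) p) (𝓡 n) ∞ e {v | ‖v‖ₑ < R} ∧
    Set.InjOn e {v | ‖v‖ₑ < R} ∧
    ∀ v : TangentSpace (𝓡 n) p, ‖v‖ₑ < R →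
      Function.Injective (mfderiv 𝓘(ℝ, TangentSpace (𝓡 n) p) (𝓡 n) e v)}

/-! ### Balls, spheres, and the distance function -/

/-- The distance function `r_p` from `p`. -/
def distFrom (p x : M) : ℝ := (edist x p).toReal

/-- The open geodesic ball `B_t(p)`. -/
def geodBall (p : M) (t : ℝ) : Set M := {x | edist x p < ENNReal.ofReal t}

/-- The geodesic sphere `S_t(p) = ∂B_t(p)`. -/
def geodSphere (p : M) (t : ℝ) : Set M := frontier (geodBall p t)

/-- The unit normal, pointing away from `p`, of the level set of `r_p` through `x`. -/
def unitNormal (p x : M) : TangentSpace (𝓡 n) x :=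
  ‖grad n (distFrom p) x‖⁻¹ • grad n (distFrom p) x

/-- The outward normal derivative `u_n` on the spheres centred at `p`. -/
def normalDeriv (p : M) (u : M → ℝ) (x : M) : ℝ :=
  inner ℝ (grad n u x) (unitNormal n p x)

/-- The gradient of `u` on the sphere centred at `p` through `x`: the component of `∇u` that is
tangent to the sphere. -/
def tangentialGrad (p : M) (u : M → ℝ) (x : M) : TangentSpace (𝓡 n) x :=
  grad n u x - normalDeriv n p u x • unitNormal n p x

/-- The radial derivative `u_r = ⟨∇u, ∇r_p⟩`. -/
def radialDeriv (p : M) (u : M → ℝ) (x : M) : ℝ :=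
  inner ℝ (grad n u x) (grad n (distFrom p) x)

/-! ### Riemannian measures -/

/-- `F`, on the open set `U ⊆ ℝᵏ`, is a local parametrization of a `k`-dimensional piece of `S`:
an injective `C¹` immersion into `M` with values in `S`. -/
structure IsLocalParam {k : ℕ} (S : Set M) (U : Set (Eucl k)) (F : Eucl k → M) : Prop where
  isOpen : IsOpen U
  contMDiffOn : ContMDiffOn (𝓡 k) (𝓡 n) 1 F U
  injOn : Set.InjOn F U
  immersion : ∀ y ∈ U, Function.Injective (mfderiv (𝓡 k) (𝓡 n) F y)
  mapsTo : Set.MapsTo F U S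

variable [MeasurableSpace M]

/-- The measure `√(det F^* g) dy` on `U`, transported to `M` by the parametrization `F`. -/
def paramMeasure {k : ℕ} (U : Set (Eucl k)) (F : Eucl k → M) : Measure M :=
  (((volume : Measure (Eucl k)).restrict U).withDensity
    fun y ↦ ENNReal.ofReal (Real.sqrt (gram n F y).det)).map F

/-- The `k`-dimensional Riemannian measure of a `k`-dimensional embedded submanifold `S` of `M`,
as a measure on `M`: the smallest measure that dominates, hence on the image of each local
parametrization `F` of `S` coincides with, the measure `√(det F^* g) dy`. For `k = 0` it is the
counting measure of `S`. -/
def submanifoldMeasure (k : ℕ) (S : Set M) : Measure M :=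
  ⨆ (U : Set (Eucl k)) (F : Eucl k → M) (_ : IsLocalParam n S U F), paramMeasure n U F

variable (M) in
/-- The Riemannian volume measure of `M`. -/
def riemVol : Measure M := submanifoldMeasure n n Set.univ

/-- The surface measure of the geodesic sphere `S_t(p)`. -/
def sphereMeasure (p : M) (t : ℝ) : Measure M :=
  submanifoldMeasure n (n - 1) (geodSphere p t)

end Defs

end

end RiemGeom

open RiemGeom

/-!
The identity is the Rellich-Pohozaev identity for the radial vector field `X = ∇r / φ(r)`, and the
proof carries it out in geodesic normal coordinates at `p`.

For a solution of `Δu = -λu`, the field `W = |∇u|² X - 2 ⟨∇u, X⟩ ∇u` has divergence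
`|∇u|² div X - 2 ⟨∇_{∇u} X, ∇u⟩ + 2 λ u ⟨∇u, X⟩` (`divOf_pohozaev`). By the Leibniz rule
`div X` and `⟨∇_v X, v⟩` are expressed by `Δr`, `∇²r` and `φ'`
(`IsNormalChart.covDeriv_radial`); this gives the two integrands over the ball. The function `φ` is
not assumed to be differentiable: that is a consequence of the smoothness of `X`
(`differentiableAt_of_radial_field`). Along the sphere `⟨W, ∇r⟩ = φ(t)⁻¹ (|∇u|² - 2 u_r²)`, and
`|∇u|² - 2 u_r²` is the integrand on the left hand side (`norm_tangentialGrad_sq_sub`), so the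
identity is the divergence theorem for `W`, multiplied by `φ(t)`.

Three matters need an argument.

* *Normal coordinates.* Inside the injectivity radius the exponential map, read in an orthonormal
  basis of `T_pM`, is a parametrization `F` in which the rays through the origin are geodesics
  (`exists_isNormalChart`). The geodesic equation for the rays implies the Gauss lemma
  `(F^* g)_y(y, v) = ⟪y, v⟫` (`gauss_lemma`). From it follows that the distance to `p`, which is an
  infimum of lengths of paths in `M`, is the Euclidean norm in these coordinates
  (`IsNormalChart.edist_eq`): rays have the right length, and a truncation of the radius is a global
  function whose gradient has norm at most `1`. Hence geodesic balls and spheres are images of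
  Euclidean ones, and `∇r = y / |y|`. The Hessian and the Laplacian, which are defined through the
  preferred chart at each point, are transported to the coordinates `F` by the transformation law of
  the Christoffel symbols (`chrisL_pullback`, `hessian_eq`, `laplacian_eq`).

* *The divergence theorem.* Since `∂ᵢ (√(det g) Wⁱ) = √(det g) div W`
  (`trace_fderiv_density_smul`), the Euclidean divergence theorem for `√(det g) W` is enough. As `u`
  is only `C¹` at the boundary, `W` is merely continuous there; the theorem is proved by integration
  by parts against radial cutoffs, polar coordinates, and a passage to the limit
  (`integral_divergence_ball`).

* *The measures.* The Riemannian measures are suprema over all local parametrizations. The change of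
  variables formula identifies the volume with `√(det g) dy` (`IsRegularOn.riemVol_restrict`). For
  the geodesic sphere of radius `t` in dimension `k + 1`, the Gauss lemma splits off the radial
  direction from the Gram determinant (`IsNormalChart.det_gram_sphere`), and the areas of
  parametrized pieces of the Euclidean unit sphere are computed as volumes of cones
  (`toSphere_image`); so the surface measure is `√(det g)(tξ) tᵏ dξ`
  (`IsNormalChart.sphereMeasure_eq`).
-/

set_option linter.unusedSectionVars false

namespace RiemGeom

noncomputable section

/-- A shortcut for instance search on spaces of bilinear forms. -/
instance {E : Type*} [NormedAddCommGroup E] [NormedSpace ℝ E] :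
    NormedAddCommGroup (E →L[ℝ] E →L[ℝ] ℝ) :=
  ContinuousLinearMap.toNormedAddCommGroup

/-- A shortcut for instance search on spaces of bilinear forms. -/
instance {E : Type*} [NormedAddCommGroup E] [NormedSpace ℝ E] :
    NormedSpace ℝ (E →L[ℝ] E →L[ℝ] ℝ) :=
  ContinuousLinearMap.toNormedSpace

/-! ### The Levi-Civita connection of a metric on a coordinate domain -/

section Calculus

variable {E : Type*} [NormedAddCommGroup E] [NormedSpace ℝ E]

/-- The Christoffel symbols of the first kind
`½ (∂ᵥ b(w, z) + ∂_w b(v, z) - ∂_z b(w, v))` at `y` of a field `b` of symmetric bilinear forms,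
as a bilinear form in `v` and `z`. -/
def chrisL (b : E → E →L[ℝ] E →L[ℝ] ℝ) (y w : E) : E →L[ℝ] E →L[ℝ] ℝ :=
  (1 / 2 : ℝ) • ((fderiv ℝ b y).flip w + fderiv ℝ b y w - ((fderiv ℝ b y).flip w).flip)

theorem chrisL_apply (b : E → E →L[ℝ] E →L[ℝ] ℝ) (y v w z : E) :
    chrisL b y w v z =
      (1 / 2) * (fderiv ℝ b y v w z + fderiv ℝ b y w v z - fderiv ℝ b y z w v) := by
  simp [chrisL]

theorem hasFDerivAt_bilin {b : E → E →L[ℝ] E →L[ℝ] ℝ} {V W : E → E} {V' W' : E →L[ℝ] E} {y : E}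
    (hb : DifferentiableAt ℝ b y) (hV : HasFDerivAt V V' y) (hW : HasFDerivAt W W' y) :
    ∃ L : E →L[ℝ] ℝ, HasFDerivAt (fun z ↦ b z (V z) (W z)) L y ∧
      ∀ u, L u = fderiv ℝ b y u (V y) (W y) + b y (V' u) (W y) + b y (V y) (W' u) := by
  refine ⟨_, (hb.hasFDerivAt.clm_apply hV).clm_apply hW, fun u ↦ ?_⟩
  simp
  ring

/-- The product rule for `b(V, W)`. -/
theorem fderiv_bilin {b : E → E →L[ℝ] E →L[ℝ] ℝ} {V W : E → E} {V' W' : E →L[ℝ] E} {y : E}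
    (hb : DifferentiableAt ℝ b y) (hV : HasFDerivAt V V' y) (hW : HasFDerivAt W W' y) (u : E) :
    fderiv ℝ (fun z ↦ b z (V z) (W z)) y u =
      fderiv ℝ b y u (V y) (W y) + b y (V' u) (W y) + b y (V y) (W' u) := by
  obtain ⟨L, hL, h⟩ := hasFDerivAt_bilin hb hV hW
  rw [hL.fderiv, h]

theorem fderiv_bilin_symm {b : E → E →L[ℝ] E →L[ℝ] ℝ} {y : E} (hb : DifferentiableAt ℝ b y)
    (hs : ∀ᶠ z in nhds y, ∀ v w, b z v w = b z w v) (u v w : E) :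
    fderiv ℝ b y u v w = fderiv ℝ b y u w v := by
  have h1 := fderiv_bilin hb (hasFDerivAt_const v y) (hasFDerivAt_const w y) u
  have h2 := fderiv_bilin hb (hasFDerivAt_const w y) (hasFDerivAt_const v y) u
  have h3 : (fun z ↦ b z v w) =ᶠ[nhds y] fun z ↦ b z w v := hs.mono fun z hz ↦ hz v w
  rw [h3.fderiv_eq] at h1
  simp at h1 h2
  rw [← h1, ← h2]

/-- The transformation law of the Christoffel symbols of the first kind under a change of
coordinates `Φ`. -/
theorem chrisL_pullback {E' : Type*} [NormedAddCommGroup E'] [NormedSpace ℝ E']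
    {b : E' → E' →L[ℝ] E' →L[ℝ] ℝ} {c : E → E →L[ℝ] E →L[ℝ] ℝ} {Φ : E → E'} {y : E}
    (hb : DifferentiableAt ℝ b (Φ y)) (hs : ∀ᶠ z in nhds (Φ y), ∀ v w, b z v w = b z w v)
    (hc : DifferentiableAt ℝ c y) (hΦ : ContDiffAt ℝ 2 Φ y)
    (hcb : ∀ᶠ z in nhds y, ∀ v w, c z v w = b (Φ z) (fderiv ℝ Φ z v) (fderiv ℝ Φ z w))
    (v w z : E) :
    chrisL c y w v z = chrisL b (Φ y) (fderiv ℝ Φ y w) (fderiv ℝ Φ y v) (fderiv ℝ Φ y z) +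
      b (Φ y) (fderiv ℝ (fderiv ℝ Φ) y v w) (fderiv ℝ Φ y z) := by
  have hd : DifferentiableAt ℝ Φ y := hΦ.differentiableAt (by norm_num)
  have hdd : DifferentiableAt ℝ (fderiv ℝ Φ) y :=
    (hΦ.fderiv_right (m := 1) (by norm_num)).differentiableAt (by norm_num)
  have hsymm : ∀ v w, fderiv ℝ (fderiv ℝ Φ) y v w = fderiv ℝ (fderiv ℝ Φ) y w v := fun v w ↦
    (hΦ.isSymmSndFDerivAt (by simp)).eq v w
  have key : ∀ u v w, fderiv ℝ c y u v w =
      fderiv ℝ b (Φ y) (fderiv ℝ Φ y u) (fderiv ℝ Φ y v) (fderiv ℝ Φ y w)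
      + b (Φ y) (fderiv ℝ (fderiv ℝ Φ) y u v) (fderiv ℝ Φ y w)
      + b (Φ y) (fderiv ℝ Φ y v) (fderiv ℝ (fderiv ℝ Φ) y u w) := by
    intro u v w
    have h1 := fderiv_bilin hc (hasFDerivAt_const v y) (hasFDerivAt_const w y) u
    have h3 : (fun z ↦ c z v w) =ᶠ[nhds y]
        fun z ↦ b (Φ z) (fderiv ℝ Φ z v) (fderiv ℝ Φ z w) := hcb.mono fun z hz ↦ hz v w
    have h4 : HasFDerivAt (fun z ↦ b (Φ z) (fderiv ℝ Φ z v) (fderiv ℝ Φ z w)) _ y :=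
      ((hb.hasFDerivAt.comp y hd.hasFDerivAt).clm_apply
        (hdd.hasFDerivAt.clm_apply (hasFDerivAt_const v y))).clm_apply
        (hdd.hasFDerivAt.clm_apply (hasFDerivAt_const w y))
    rw [h3.fderiv_eq, h4.fderiv] at h1
    simp at h1
    rw [← h1]
    ring
  have hs0 := hs.self_of_nhds
  have hsD := fderiv_bilin_symm hb hs
  simp only [chrisL_apply, key]
  rw [hsymm w v, hsymm z w, hsymm z v, hs0 (fderiv ℝ (fderiv ℝ Φ) y w z)]
  ring

end Calculus

/-! ### The Gauss lemma -/

section Gauss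

variable {E : Type*} [NormedAddCommGroup E] [InnerProductSpace ℝ E]

theorem hasDerivAt_ray {b : E → E →L[ℝ] E →L[ℝ] ℝ} {y : E} (z : E) {s : ℝ}
    (hb : DifferentiableAt ℝ b (s • y)) :
    HasDerivAt (fun s : ℝ ↦ b (s • y) y z) (fderiv ℝ b (s • y) y y z) s := by
  have h1 : HasDerivAt (fun s : ℝ ↦ s • y) y s := by
    simpa using (hasDerivAt_id s).smul_const y
  have h2 : HasDerivAt (fun s : ℝ ↦ b (s • y)) (fderiv ℝ b (s • y) y) s :=
    hb.hasFDerivAt.comp_hasDerivAt s h1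
  have h3 := (h2.clm_apply (hasDerivAt_const s y)).clm_apply (hasDerivAt_const s z)
  simpa using h3

/-- The Gauss lemma in coordinates: if the rays through the origin are geodesics of the metric `b`
and `b` is the Euclidean inner product at the origin, then
`b y (y, z) = ⟪y, z⟫` for all `y` and `z`. -/
theorem gauss_lemma {b : E → E →L[ℝ] E →L[ℝ] ℝ} {R : ℝ}
    (hb : ∀ y ∈ Metric.ball (0 : E) R, DifferentiableAt ℝ b y)
    (hs : ∀ y ∈ Metric.ball (0 : E) R, ∀ v w, b y v w = b y w v)
    (h0 : ∀ v w, b 0 v w = inner ℝ v w)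
    (hK : ∀ (v : E) (s : ℝ), s • v ∈ Metric.ball (0 : E) R → ∀ z, chrisL b (s • v) v v z = 0)
    {y : E} (hy : y ∈ Metric.ball (0 : E) R) (z : E) :
    b y y z = inner ℝ y z := by
  have hmem : ∀ {y : E}, y ∈ Metric.ball (0 : E) R → ∀ s ∈ Set.Icc (0 : ℝ) 1,
      s • y ∈ Metric.ball (0 : E) R := by
    intro y hy s hs
    rw [mem_ball_zero_iff] at hy ⊢
    calc ‖s • y‖ = s * ‖y‖ := by rw [norm_smul, Real.norm_of_nonneg hs.1]
      _ ≤ 1 * ‖y‖ := by gcongr; exact hs.2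
      _ < R := by simpa using hy
  have hsymm : ∀ y ∈ Metric.ball (0 : E) R, ∀ u v w,
      fderiv ℝ b y u v w = fderiv ℝ b y u w v := fun y hy ↦
    fderiv_bilin_symm (hb y hy)
      (Filter.eventually_of_mem (Metric.isOpen_ball.mem_nhds hy) hs)
  -- the speed of the rays is constant
  have speed : ∀ y ∈ Metric.ball (0 : E) R, b y y y = inner ℝ y y := by
    intro y hy
    have hd : ∀ s ∈ Set.Icc (0 : ℝ) 1, HasDerivAt (fun s : ℝ ↦ b (s • y) y y) 0 s := by
      intro s hs
      have h1 := hasDerivAt_ray y (hb _ (hmem hy s hs))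
      have h2 := hK y s (hmem hy s hs) y
      rw [chrisL_apply] at h2
      exact h1.congr_deriv (by linarith)
    have := constant_of_has_deriv_right_zero
      (fun s hs ↦ (hd s hs).continuousAt.continuousWithinAt)
      (fun s hs ↦ (hd s ⟨hs.1, hs.2.le⟩).hasDerivWithinAt) 1 ⟨zero_le_one, le_rfl⟩
    simpa [h0] using this
  -- the derivative of `b y (y, y) = ⟪y, y⟫` in the direction `z`
  have dspeed : ∀ y ∈ Metric.ball (0 : E) R, ∀ z,
      fderiv ℝ b y z y y + 2 * b y y z = 2 * inner ℝ y z := by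
    intro y hy z
    have h1 := fderiv_bilin (hb y hy) (hasFDerivAt_id y) (hasFDerivAt_id y) z
    have h2 : (fun z ↦ b z (id z) (id z)) =ᶠ[nhds y] fun z ↦ inner ℝ z z :=
      Filter.eventually_of_mem (Metric.isOpen_ball.mem_nhds hy) speed
    have h3 := fderiv_inner_apply ℝ (differentiableAt_fun_id (x := y) (𝕜 := ℝ))
      differentiableAt_fun_id z
    rw [h2.fderiv_eq, h3] at h1
    simp only [fderiv_fun_id, ContinuousLinearMap.coe_id', id] at h1
    rw [hs y hy z y, real_inner_comm y z] at h1
    linarith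
  -- `⟨∂ᵣ, z⟩ - ⟪∂ᵣ, z⟫`, scaled by `s`, is constant along the ray; it vanishes at the origin
  have hd : ∀ s ∈ Set.Icc (0 : ℝ) 1,
      HasDerivAt (fun s : ℝ ↦ s * (b (s • y) y z - inner ℝ y z)) 0 s := by
    intro s hs1
    have hm := hmem hy s hs1
    have h1 := (hasDerivAt_id' s).fun_mul ((hasDerivAt_ray z (hb _ hm)).sub_const (inner ℝ y z))
    refine h1.congr_deriv ?_
    rcases eq_or_ne s 0 with rfl | hs0
    · simp [h0]
    have h2 := hK y s hm z
    have h3 := dspeed _ hm z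
    rw [chrisL_apply] at h2
    simp only [map_smul, smul_apply, smul_eq_mul, inner_smul_left,
      RCLike.conj_to_real] at h3
    have h4 : s * (s * fderiv ℝ b (s • y) z y y + 2 * (b (s • y) y z - inner ℝ y z)) = 0 := by
      linarith
    have h5 := (mul_eq_zero.1 h4).resolve_left hs0
    have h6 : fderiv ℝ b (s • y) y y z = 1 / 2 * fderiv ℝ b (s • y) z y y := by linarith
    rw [h6]
    linarith
  have := constant_of_has_deriv_right_zero
    (fun s hs ↦ (hd s hs).continuousAt.continuousWithinAt)
    (fun s hs ↦ (hd s ⟨hs.1, hs.2.le⟩).hasDerivWithinAt) 1 ⟨zero_le_one, le_rfl⟩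
  simpa [sub_eq_zero] using this

end Gauss

/-! ### Gradient, Hessian and divergence on a coordinate domain -/

section Connection

variable {E : Type*} [NormedAddCommGroup E] [NormedSpace ℝ E]

/-- The covariant derivative `v ↦ ∇ᵥ X = ∂ᵥ X + Γ(v, X)` at `y` of the vector field `X`, for the
Levi-Civita connection of the metric `b`. -/
def covDeriv (b : E → E →L[ℝ] E →L[ℝ] ℝ) (X : E → E) (y : E) : E →L[ℝ] E :=
  fderiv ℝ X y + (b y).inverse.comp (chrisL b y (X y))

/-- The gradient of `f` with respect to the metric `b`. -/
def gradOf (b : E → E →L[ℝ] E →L[ℝ] ℝ) (f : E → ℝ) (y : E) : E :=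
  (b y).inverse (fderiv ℝ f y)

/-- The Hessian `∂ᵥ∂_w f - ∂_{Γ(v, w)} f` at `y` of `f` with respect to the metric `b`. -/
def hessOf (b : E → E →L[ℝ] E →L[ℝ] ℝ) (f : E → ℝ) (y v w : E) : ℝ :=
  fderiv ℝ (fderiv ℝ f) y v w - fderiv ℝ f y ((b y).inverse (chrisL b y w v))

variable {b : E → E →L[ℝ] E →L[ℝ] ℝ} {y : E}

theorem bilin_inverse (hi : (b y).IsInvertible) (l : E →L[ℝ] ℝ) : b y ((b y).inverse l) = l :=
  hi.self_apply_inverse l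

theorem bilin_gradOf (hi : (b y).IsInvertible) (f : E → ℝ) : b y (gradOf b f y) = fderiv ℝ f y :=
  bilin_inverse hi _

theorem bilin_injective (hi : (b y).IsInvertible) : Function.Injective (b y) := hi.injective

theorem bilin_covDeriv (hi : (b y).IsInvertible) (X : E → E) (v w : E) :
    b y (covDeriv b X y v) w = b y (fderiv ℝ X y v) w + chrisL b y (X y) v w := by
  simp [covDeriv, bilin_inverse hi]

/-- Compatibility of the connection with the metric. -/
theorem fderiv_eq_chrisL (hb : DifferentiableAt ℝ b y)
    (hs : ∀ᶠ z in nhds y, ∀ v w, b z v w = b z w v) (u v w : E) :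
    fderiv ℝ b y u v w = chrisL b y v u w + chrisL b y w u v := by
  have h := fderiv_bilin_symm hb hs
  simp only [chrisL_apply]
  rw [h w v u, h v u w, h u w v]
  ring

theorem chrisL_symm (hb : DifferentiableAt ℝ b y)
    (hs : ∀ᶠ z in nhds y, ∀ v w, b z v w = b z w v) (v w z : E) :
    chrisL b y w v z = chrisL b y v w z := by
  have h := fderiv_bilin_symm hb hs
  simp only [chrisL_apply]
  rw [h z w v]
  ring

theorem hessOf_symm (hb : DifferentiableAt ℝ b y)
    (hs : ∀ᶠ z in nhds y, ∀ v w, b z v w = b z w v) {f : E → ℝ} (hf : ContDiffAt ℝ 2 f y)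
    (v w : E) : hessOf b f y v w = hessOf b f y w v := by
  have h1 : fderiv ℝ (fderiv ℝ f) y v w = fderiv ℝ (fderiv ℝ f) y w v :=
    (hf.isSymmSndFDerivAt (by simp)).eq v w
  have h2 : chrisL b y w v = chrisL b y v w := by
    ext z; exact chrisL_symm hb hs v w z
  rw [hessOf, hessOf, h1, h2]

/-- `⟨∇ᵥ ∇f, w⟩ = ∇²f(v, w)`. -/
theorem bilin_covDeriv_gradOf (hb : DifferentiableAt ℝ b y)
    (hs : ∀ᶠ z in nhds y, ∀ v w, b z v w = b z w v)
    (hi : ∀ᶠ z in nhds y, (b z).IsInvertible) {f : E → ℝ} (hf : ContDiffAt ℝ 2 f y)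
    (hg : DifferentiableAt ℝ (gradOf b f) y) (v w : E) :
    b y (covDeriv b (gradOf b f) y v) w = hessOf b f y v w := by
  have hi0 := hi.self_of_nhds
  have hs0 := hs.self_of_nhds
  have hdd : DifferentiableAt ℝ (fderiv ℝ f) y :=
    (hf.fderiv_right (m := 1) (by norm_num)).differentiableAt (by norm_num)
  have h1 := fderiv_bilin hb hg.hasFDerivAt (hasFDerivAt_const w y) v
  have h2 : (fun z ↦ b z (gradOf b f z) w) =ᶠ[nhds y] fun z ↦ fderiv ℝ f z w :=
    hi.mono fun z hz ↦ by simp only [bilin_gradOf hz]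
  have h3 : HasFDerivAt (fun z ↦ fderiv ℝ f z w) _ y :=
    hdd.hasFDerivAt.clm_apply (hasFDerivAt_const w y)
  rw [h2.fderiv_eq, h3.fderiv, fderiv_eq_chrisL hb hs] at h1
  simp at h1
  rw [bilin_covDeriv hi0, hessOf, h1, ← bilin_gradOf hi0, hs0 (gradOf b f y),
    bilin_inverse hi0]
  ring

theorem gradOf_contDiffAt [CompleteSpace E] {m : WithTop ℕ∞} (hb : ContDiffAt ℝ m b y)
    (hi : (b y).IsInvertible) {f : E → ℝ} (hf : ContDiffAt ℝ (m + 1) f y) :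
    ContDiffAt ℝ m (gradOf b f) y := by
  obtain ⟨e, he⟩ := hi
  have h1 : ContDiffAt ℝ m (fun z ↦ (b z).inverse) y := by
    have h2 : ContDiffAt ℝ m ContinuousLinearMap.inverse (b y) := by
      rw [← he]; exact contDiffAt_map_inverse e
    exact h2.comp y hb
  exact h1.clm_apply (hf.fderiv_right le_rfl)

theorem covDeriv_smul {a : E → ℝ} {X : E → E} (ha : DifferentiableAt ℝ a y)
    (hX : DifferentiableAt ℝ X y) (v : E) :
    covDeriv b (fun z ↦ a z • X z) y v = a y • covDeriv b X y v + fderiv ℝ a y v • X y := by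
  have h : chrisL b y (a y • X y) = a y • chrisL b y (X y) := by
    ext v z
    simp [chrisL_apply]
    ring
  simp only [covDeriv, add_apply, ContinuousLinearMap.comp_apply, h, smul_apply, map_smul,
    fderiv_fun_smul ha hX, ContinuousLinearMap.smulRight_apply, smul_add]
  abel

theorem covDeriv_sub {X Y : E → E} (hX : DifferentiableAt ℝ X y) (hY : DifferentiableAt ℝ Y y)
    (v : E) : covDeriv b (fun z ↦ X z - Y z) y v = covDeriv b X y v - covDeriv b Y y v := by
  have h : chrisL b y (X y - Y y) = chrisL b y (X y) - chrisL b y (Y y) := by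
    ext v z
    simp [chrisL_apply]
    ring
  simp only [covDeriv, add_apply, ContinuousLinearMap.comp_apply, h, sub_apply, map_sub,
    fderiv_fun_sub hX hY]
  abel

/-- The divergence of `X` with respect to the metric `b`: the trace of `∇X`. -/
def divOf (b : E → E →L[ℝ] E →L[ℝ] ℝ) (X : E → E) (y : E) : ℝ :=
  LinearMap.trace ℝ E (covDeriv b X y).toLinearMap

variable [FiniteDimensional ℝ E]

theorem trace_smulRight (l : E →L[ℝ] ℝ) (x : E) :
    LinearMap.trace ℝ E (l.smulRight x).toLinearMap = l x := by
  exact LinearMap.trace_smulRight (R := ℝ) (M := E) l.toLinearMap x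

theorem divOf_smul {a : E → ℝ} {X : E → E} (ha : DifferentiableAt ℝ a y)
    (hX : DifferentiableAt ℝ X y) :
    divOf b (fun z ↦ a z • X z) y = a y * divOf b X y + fderiv ℝ a y (X y) := by
  have h : (covDeriv b (fun z ↦ a z • X z) y).toLinearMap =
      a y • (covDeriv b X y).toLinearMap + ((fderiv ℝ a y).smulRight (X y)).toLinearMap := by
    ext v
    simp [covDeriv_smul ha hX]
  rw [divOf, h, map_add, map_smul, trace_smulRight, smul_eq_mul, divOf]

omit [FiniteDimensional ℝ E] in
theorem divOf_sub {X Y : E → E} (hX : DifferentiableAt ℝ X y) (hY : DifferentiableAt ℝ Y y) :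
    divOf b (fun z ↦ X z - Y z) y = divOf b X y - divOf b Y y := by
  have h : (covDeriv b (fun z ↦ X z - Y z) y).toLinearMap =
      (covDeriv b X y).toLinearMap - (covDeriv b Y y).toLinearMap := by
    ext v
    simp [covDeriv_sub hX hY]
  rw [divOf, h, map_sub, divOf, divOf]

/-- The Rellich-Pohozaev identity, pointwise:
`div(|∇f|² X - 2 ⟨X, ∇f⟩ ∇f) = |∇f|² div X - 2 ⟨X, ∇f⟩ Δf - 2 ⟨∇_{∇f} X, ∇f⟩`. -/
theorem divOf_pohozaev (hb : ContDiffAt ℝ 1 b y)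
    (hs : ∀ᶠ z in nhds y, ∀ v w, b z v w = b z w v)
    (hi : ∀ᶠ z in nhds y, (b z).IsInvertible) {f : E → ℝ} (hf : ContDiffAt ℝ 2 f y)
    {X : E → E} (hX : DifferentiableAt ℝ X y) :
    divOf b (fun z ↦ b z (gradOf b f z) (gradOf b f z) • X z
        - (2 * b z (gradOf b f z) (X z)) • gradOf b f z) y =
      b y (gradOf b f y) (gradOf b f y) * divOf b X y
        - 2 * b y (gradOf b f y) (X y) * divOf b (gradOf b f) y
        - 2 * b y (covDeriv b X y (gradOf b f y)) (gradOf b f y) := by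
  have hbd : DifferentiableAt ℝ b y := hb.differentiableAt (by norm_num)
  have hP : DifferentiableAt ℝ (gradOf b f) y :=
    (gradOf_contDiffAt hb hi.self_of_nhds (by simpa using! hf)).differentiableAt (by norm_num)
  obtain ⟨L, hL, hL'⟩ := hasFDerivAt_bilin hbd hP.hasFDerivAt hP.hasFDerivAt
  obtain ⟨Q, hQ, hQ'⟩ := hasFDerivAt_bilin hbd hP.hasFDerivAt hX.hasFDerivAt
  have h2Q : DifferentiableAt ℝ (fun z ↦ 2 * b z (gradOf b f z) (X z)) y :=
    hQ.differentiableAt.const_mul 2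
  rw [divOf_sub (hL.differentiableAt.fun_smul hX) (h2Q.fun_smul hP),
    divOf_smul hL.differentiableAt hX, divOf_smul h2Q hP, hL.fderiv, (hQ.const_mul 2).fderiv]
  simp only [smul_apply, smul_eq_mul, hL', hQ']
  have hs0 := hs.self_of_nhds
  have hi0 := hi.self_of_nhds
  -- the two Hessian terms, `∇²f(X, ∇f)` and `∇²f(∇f, X)`, cancel
  have hH := bilin_covDeriv_gradOf hbd hs hi hf hP
  have e1 := hH (X y) (gradOf b f y)
  have e2 := hH (gradOf b f y) (X y)
  rw [hessOf_symm hbd hs hf, ← e2, bilin_covDeriv hi0, bilin_covDeriv hi0] at e1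
  rw [bilin_covDeriv hi0, fderiv_eq_chrisL hbd hs, fderiv_eq_chrisL hbd hs,
    hs0 (gradOf b f y) (fderiv ℝ (gradOf b f) y (X y)),
    hs0 (gradOf b f y) (fderiv ℝ X y (gradOf b f y))]
  linarith

end Connection

/-! ### The Riemannian volume density -/

section Jacobi

open Matrix Polynomial in
theorem hasDerivAt_det_add_smul {k : ℕ} {A : Matrix (Fin k) (Fin k) ℝ} (hA : IsUnit A.det)
    (N : Matrix (Fin k) (Fin k) ℝ) :
    HasDerivAt (fun s : ℝ ↦ (A + s • N).det) (A.det * (A⁻¹ * N).trace) 0 := by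
  set p : ℝ[X] := (1 + (X : ℝ[X]) • (A⁻¹ * N).map C).det with hp
  have h1 : ∀ s : ℝ, (A + s • N).det = A.det * p.eval s := by
    intro s
    have h2 : p.eval s = (1 + s • (A⁻¹ * N)).det := by
      rw [hp, ← coe_evalRingHom, RingHom.map_det]
      congr 1
      ext i j
      by_cases hij : i = j <;> simp [hij, mul_comm s, -Matrix.map_mul]
    rw [h2, ← Matrix.det_mul, Matrix.mul_add, Matrix.mul_one, Matrix.mul_smul,
      Matrix.mul_nonsing_inv_cancel_left _ _ hA]
  have h3 := (p.hasDerivAt 0).const_mul A.det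
  rw [hp, derivative_det_one_add_X_smul, ← hp] at h3
  exact h3.congr_of_eventuallyEq (Filter.Eventually.of_forall h1)

theorem differentiable_det (k : ℕ) :
    Differentiable ℝ fun A : Fin k → Fin k → ℝ ↦ (Matrix.of A).det := by
  simp only [Matrix.det_apply, Matrix.of_apply]
  fun_prop

/-- Jacobi's formula. -/
theorem hasFDerivAt_det {k : ℕ} {E : Type*} [NormedAddCommGroup E] [NormedSpace ℝ E]
    {G : E → Matrix (Fin k) (Fin k) ℝ} {y : E}
    {G' : Fin k → Fin k → E →L[ℝ] ℝ}
    (hG : ∀ i j, HasFDerivAt (fun z ↦ G z i j) (G' i j) y) (hdet : IsUnit (G y).det) :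
    ∃ L : E →L[ℝ] ℝ, HasFDerivAt (fun z ↦ (G z).det) L y ∧
      ∀ u, L u = (G y).det * ∑ i, ∑ j, (G y)⁻¹ i j * G' j i u := by
  have h1 : HasFDerivAt (fun z ↦ (fun i j ↦ G z i j : Fin k → Fin k → ℝ))
      (ContinuousLinearMap.pi fun i ↦ ContinuousLinearMap.pi fun j ↦ G' i j) y :=
    hasFDerivAt_pi.2 fun i ↦ hasFDerivAt_pi.2 fun j ↦ hG i j
  have h2 := ((differentiable_det k) (fun i j ↦ G y i j)).hasFDerivAt
  refine ⟨_, HasFDerivAt.comp (f := fun z ↦ (fun i j ↦ G z i j : Fin k → Fin k → ℝ)) y h2 h1,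
    fun u ↦ ?_⟩
  have h3 : HasDerivAt (fun s : ℝ ↦ (fun i j ↦ G y i j + s * G' i j u : Fin k → Fin k → ℝ))
      (fun i j ↦ G' i j u) 0 := by
    refine hasDerivAt_pi.2 fun i ↦ hasDerivAt_pi.2 fun j ↦ ?_
    simpa using ((hasDerivAt_id (0 : ℝ)).mul_const (G' i j u)).const_add (G y i j)
  have h4 : HasDerivAt (fun s : ℝ ↦ (Matrix.of fun i j ↦ G y i j + s * G' i j u).det)
      (fderiv ℝ (fun A : Fin k → Fin k → ℝ ↦ (Matrix.of A).det) (fun i j ↦ G y i j)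
        (fun i j ↦ G' i j u)) 0 := by
    have h5 : (fun i j ↦ G y i j) = (fun i j ↦ G y i j + (0 : ℝ) * G' i j u) := by simp
    rw [h5] at h2
    exact h2.comp_hasDerivAt (0 : ℝ) h3 |>.congr_deriv (by simp)
  have h6 := hasDerivAt_det_add_smul hdet (Matrix.of fun i j ↦ G' i j u)
  have h7 := h4.unique h6
  change fderiv ℝ (fun A : Fin k → Fin k → ℝ ↦ (Matrix.of A).det) (fun i j ↦ G y i j)
        (fun i j ↦ G' i j u) = _
  rw [h7]
  simp [Matrix.trace, Matrix.mul_apply]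

end Jacobi

section Density

variable {n : ℕ} {b : Eucl n → Eucl n →L[ℝ] Eucl n →L[ℝ] ℝ} {y : Eucl n}

/-- The matrix of the metric `b` in the standard basis. -/
def matrixOf (b : Eucl n → Eucl n →L[ℝ] Eucl n →L[ℝ] ℝ) (y : Eucl n) :
    Matrix (Fin n) (Fin n) ℝ :=
  Matrix.of fun i j ↦ b y (EuclideanSpace.single i 1) (EuclideanSpace.single j 1)

theorem eucl_eq_sum (v : Eucl n) : v = ∑ i, v i • EuclideanSpace.single i (1 : ℝ) := by
  conv_lhs => rw [← (EuclideanSpace.basisFun (Fin n) ℝ).sum_repr v]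
  simp

theorem clm_apply_eq_sum (l : Eucl n →L[ℝ] ℝ) (v : Eucl n) :
    l v = ∑ i, v i * l (EuclideanSpace.single i 1) := by
  conv_lhs => rw [eucl_eq_sum v]
  simp

theorem isUnit_det_matrixOf (hi : (b y).IsInvertible) : IsUnit (matrixOf b y).det := by
  rw [isUnit_iff_ne_zero]
  intro h
  obtain ⟨v, hv0, hv⟩ := Matrix.exists_vecMul_eq_zero_iff.2 h
  apply hv0
  have h1 : b y (WithLp.toLp 2 v) = 0 := by
    ext w
    rw [clm_apply_eq_sum]
    refine Finset.sum_eq_zero fun j _ ↦ ?_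
    have h2 := congrFun hv j
    have h3 := clm_apply_eq_sum ((b y).flip (EuclideanSpace.single j 1)) (WithLp.toLp 2 v)
    simp only [ContinuousLinearMap.flip_apply] at h3
    rw [h3]
    simp only [Matrix.vecMul, dotProduct, matrixOf, Matrix.of_apply, Pi.zero_apply] at h2
    rw [h2, mul_zero]
  have h4 := bilin_injective hi (h1.trans (map_zero _).symm)
  ext i
  exact congrArg (fun v : Eucl n ↦ v i) h4

theorem isSymm_matrixOf (hs : ∀ v w, b y v w = b y w v) : (matrixOf b y).IsSymm := by
  ext i j
  exact hs _ _

theorem inv_matrixOf_symm (hs : ∀ v w, b y v w = b y w v) (i j : Fin n) :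
    (matrixOf b y)⁻¹ i j = (matrixOf b y)⁻¹ j i := by
  have h := (isSymm_matrixOf hs).inv
  exact h.apply j i

/-- The trace of an endomorphism `T`, by means of the bilinear form `b(T v, w)`:
`tr T = ∑ᵢⱼ bⁱʲ b(T eᵢ, eⱼ)`. -/
theorem trace_eq_sum_inv (hs : ∀ v w, b y v w = b y w v) (hi : (b y).IsInvertible)
    (T : Eucl n →L[ℝ] Eucl n) :
    LinearMap.trace ℝ (Eucl n) T.toLinearMap = ∑ i, ∑ j, (matrixOf b y)⁻¹ i j *
      b y (T (EuclideanSpace.single i 1)) (EuclideanSpace.single j 1) := by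
  rw [LinearMap.trace_eq_matrix_trace ℝ (EuclideanSpace.basisFun (Fin n) ℝ).toBasis]
  simp only [Matrix.trace, Matrix.diag, LinearMap.toMatrix_apply]
  refine Finset.sum_congr rfl fun i _ ↦ ?_
  have h1 : ∀ j, b y (T (EuclideanSpace.single i 1)) (EuclideanSpace.single j 1) =
      ∑ k, (T (EuclideanSpace.single i 1)) k * matrixOf b y k j := fun j ↦
    clm_apply_eq_sum ((b y).flip (EuclideanSpace.single j 1)) _
  simp only [h1, Finset.mul_sum]
  rw [Finset.sum_comm]
  have h2 : ∀ k, ∑ j, (matrixOf b y)⁻¹ i j * (T (EuclideanSpace.single i 1) k * matrixOf b y k j)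
      = T (EuclideanSpace.single i 1) k * (1 : Matrix (Fin n) (Fin n) ℝ) k i := by
    intro k
    rw [← Matrix.mul_nonsing_inv _ (isUnit_det_matrixOf hi), Matrix.mul_apply, Finset.mul_sum]
    refine Finset.sum_congr rfl fun j _ ↦ ?_
    rw [inv_matrixOf_symm hs]
    ring
  simp [h2, Matrix.one_apply]

/-- The volume density `√(det b)`. -/
def density (b : Eucl n → Eucl n →L[ℝ] Eucl n →L[ℝ] ℝ) (y : Eucl n) : ℝ :=
  Real.sqrt (matrixOf b y).det

/-- The logarithmic derivative of the volume density is the contracted Christoffel symbol: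
`∂ᵤ √(det b) = √(det b) tr Γ(u, ·)`. -/
theorem hasFDerivAt_density (hb : DifferentiableAt ℝ b y)
    (hs : ∀ᶠ z in nhds y, ∀ v w, b z v w = b z w v)
    (hi : (b y).IsInvertible) (hpos : 0 < (matrixOf b y).det) :
    ∃ L : Eucl n →L[ℝ] ℝ, HasFDerivAt (density b) L y ∧ ∀ u, L u = density b y *
      LinearMap.trace ℝ (Eucl n) ((b y).inverse.comp (chrisL b y u)).toLinearMap := by
  have hs0 := hs.self_of_nhds
  have hent : ∀ i j, HasFDerivAt (fun z ↦ matrixOf b z i j)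
      (fderiv ℝ (fun z ↦ b z (EuclideanSpace.single i 1) (EuclideanSpace.single j 1)) y) y :=
    fun i j ↦ ((hb.hasFDerivAt.clm_apply (hasFDerivAt_const
      (EuclideanSpace.single i (1 : ℝ)) y)).clm_apply
      (hasFDerivAt_const (EuclideanSpace.single j (1 : ℝ)) y)).differentiableAt.hasFDerivAt
  obtain ⟨L, hL, hL'⟩ := hasFDerivAt_det hent (isUnit_det_matrixOf hi)
  refine ⟨_, hL.sqrt hpos.ne', fun u ↦ ?_⟩
  have h1 : ∀ i j, fderiv ℝ (fun z ↦ b z (EuclideanSpace.single i (1 : ℝ))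
      (EuclideanSpace.single j (1 : ℝ))) y u =
      fderiv ℝ b y u (EuclideanSpace.single i 1) (EuclideanSpace.single j 1) := by
    intro i j
    simpa using fderiv_bilin hb (hasFDerivAt_const (EuclideanSpace.single i (1 : ℝ)) y)
      (hasFDerivAt_const (EuclideanSpace.single j (1 : ℝ)) y) u
  rw [trace_eq_sum_inv hs0 hi]
  -- the other two terms of the Christoffel symbol form an antisymmetric expression in `i` and `j`
  have h2 : ∑ i, ∑ j, (matrixOf b y)⁻¹ i j * b y (((b y).inverse.comp (chrisL b y u))
        (EuclideanSpace.single i 1)) (EuclideanSpace.single j 1) =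
      (1 / 2) * ∑ i, ∑ j, (matrixOf b y)⁻¹ i j *
        fderiv ℝ b y u (EuclideanSpace.single j 1) (EuclideanSpace.single i 1) := by
    have hsD := fderiv_bilin_symm hb hs
    have h3 : ∑ i, ∑ j, (matrixOf b y)⁻¹ i j *
        fderiv ℝ b y (EuclideanSpace.single j 1) u (EuclideanSpace.single i 1) =
        ∑ i, ∑ j, (matrixOf b y)⁻¹ i j *
        fderiv ℝ b y (EuclideanSpace.single i 1) u (EuclideanSpace.single j 1) := by
      rw [Finset.sum_comm]
      refine Finset.sum_congr rfl fun i _ ↦ Finset.sum_congr rfl fun j _ ↦ ?_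
      rw [inv_matrixOf_symm hs0]
    have h4 : ∀ i j, (matrixOf b y)⁻¹ i j * b y (((b y).inverse.comp (chrisL b y u))
        (EuclideanSpace.single i 1)) (EuclideanSpace.single j 1) =
        (1 / 2) * ((matrixOf b y)⁻¹ i j *
          fderiv ℝ b y u (EuclideanSpace.single j 1) (EuclideanSpace.single i 1)) +
        (1 / 2) * ((matrixOf b y)⁻¹ i j *
          fderiv ℝ b y (EuclideanSpace.single i 1) u (EuclideanSpace.single j 1)) -
        (1 / 2) * ((matrixOf b y)⁻¹ i j *
          fderiv ℝ b y (EuclideanSpace.single j 1) u (EuclideanSpace.single i 1)) := by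
      intro i j
      rw [ContinuousLinearMap.comp_apply, bilin_inverse hi, chrisL_apply,
        hsD u (EuclideanSpace.single j 1) (EuclideanSpace.single i 1)]
      ring
    simp only [h4, Finset.sum_add_distrib, Finset.sum_sub_distrib, ← Finset.mul_sum]
    rw [h3]
    ring
  rw [h2, smul_apply, hL', density]
  simp only [h1]
  have h5 := Real.mul_self_sqrt hpos.le
  have h6 := Real.sqrt_pos.2 hpos
  rw [smul_eq_mul]
  field_simp
  rw [Real.sq_sqrt hpos.le]

/-- The divergence theorem's integrand: `∂ᵢ(√(det b) Xⁱ) = √(det b) div X`. -/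
theorem trace_fderiv_density_smul (hb : DifferentiableAt ℝ b y)
    (hs : ∀ᶠ z in nhds y, ∀ v w, b z v w = b z w v)
    (hi : (b y).IsInvertible) (hpos : 0 < (matrixOf b y).det) {X : Eucl n → Eucl n}
    (hX : DifferentiableAt ℝ X y) :
    LinearMap.trace ℝ (Eucl n) (fderiv ℝ (fun z ↦ density b z • X z) y).toLinearMap =
      density b y * divOf b X y := by
  obtain ⟨L, hL, hL'⟩ := hasFDerivAt_density hb hs hi hpos
  have h : (fderiv ℝ (fun z ↦ density b z • X z) y).toLinearMap =
      density b y • (fderiv ℝ X y).toLinearMap + (L.smulRight (X y)).toLinearMap := by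
    rw [(hL.fun_smul hX.hasFDerivAt).fderiv]
    rfl
  rw [h, map_add, map_smul, trace_smulRight, hL', divOf, covDeriv, smul_eq_mul, ← mul_add,
    ← map_add]
  rfl

/-- The divergence of the gradient is the trace of the Hessian. -/
theorem divOf_gradOf_eq_sum (hb : ContDiffAt ℝ 1 b y)
    (hs : ∀ᶠ z in nhds y, ∀ v w, b z v w = b z w v)
    (hi : ∀ᶠ z in nhds y, (b z).IsInvertible) {f : Eucl n → ℝ} (hf : ContDiffAt ℝ 2 f y) :
    divOf b (gradOf b f) y = ∑ i, ∑ j, (matrixOf b y)⁻¹ i j *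
      hessOf b f y (EuclideanSpace.single i 1) (EuclideanSpace.single j 1) := by
  have hP : DifferentiableAt ℝ (gradOf b f) y :=
    (gradOf_contDiffAt hb hi.self_of_nhds (by simpa using! hf)).differentiableAt (by norm_num)
  rw [divOf, trace_eq_sum_inv hs.self_of_nhds hi.self_of_nhds]
  simp only [bilin_covDeriv_gradOf (hb.differentiableAt (by norm_num)) hs hi hf hP]

end Density

/-! ### Change of coordinates -/

section Pullback

variable {E : Type*} [NormedAddCommGroup E] [NormedSpace ℝ E]
  {b c : E → E →L[ℝ] E →L[ℝ] ℝ} {Φ : E → E} {y : E}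

/-- The Hessian is invariant under changes of coordinates. -/
theorem hessOf_pullback (hb : DifferentiableAt ℝ b (Φ y))
    (hs : ∀ᶠ z in nhds (Φ y), ∀ v w, b z v w = b z w v)
    (hib : (b (Φ y)).IsInvertible) (hic : (c y).IsInvertible)
    (hc : DifferentiableAt ℝ c y) (hΦ : ContDiffAt ℝ 2 Φ y)
    (hΦi : (fderiv ℝ Φ y).IsInvertible)
    (hcb : ∀ᶠ z in nhds y, ∀ v w, c z v w = b (Φ z) (fderiv ℝ Φ z v) (fderiv ℝ Φ z w))
    {f : E → ℝ} (hf : ContDiffAt ℝ 2 f (Φ y)) (v w : E) :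
    hessOf c (f ∘ Φ) y v w = hessOf b f (Φ y) (fderiv ℝ Φ y v) (fderiv ℝ Φ y w) := by
  have hd : DifferentiableAt ℝ Φ y := hΦ.differentiableAt (by norm_num)
  have hdd : DifferentiableAt ℝ (fderiv ℝ Φ) y :=
    (hΦ.fderiv_right (m := 1) (by norm_num)).differentiableAt (by norm_num)
  have hfd : DifferentiableAt ℝ f (Φ y) := hf.differentiableAt (by norm_num)
  have hfdd : DifferentiableAt ℝ (fderiv ℝ f) (Φ y) :=
    (hf.fderiv_right (m := 1) (by norm_num)).differentiableAt (by norm_num)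
  have h1 : fderiv ℝ (f ∘ Φ) =ᶠ[nhds y] fun z ↦ (fderiv ℝ f (Φ z)).comp (fderiv ℝ Φ z) := by
    have e1 := hΦ.eventually (by simp)
    have e2 := hΦ.continuousAt.eventually (hf.eventually (by simp))
    filter_upwards [e1, e2] with z hz1 hz2
    exact fderiv_comp _ (hz2.differentiableAt (by norm_num)) (hz1.differentiableAt (by norm_num))
  have h2 : fderiv ℝ (fderiv ℝ (f ∘ Φ)) y v w =
      fderiv ℝ (fderiv ℝ f) (Φ y) (fderiv ℝ Φ y v) (fderiv ℝ Φ y w) +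
        fderiv ℝ f (Φ y) (fderiv ℝ (fderiv ℝ Φ) y v w) := by
    have e3 : HasFDerivAt (fun z ↦ (fderiv ℝ f (Φ z)).comp (fderiv ℝ Φ z)) _ y :=
      (hfdd.hasFDerivAt.comp y hd.hasFDerivAt).clm_comp hdd.hasFDerivAt
    rw [h1.fderiv_eq, e3.fderiv]
    simp
    ring
  have h3 : fderiv ℝ Φ y ((c y).inverse (chrisL c y w v)) =
      (b (Φ y)).inverse (chrisL b (Φ y) (fderiv ℝ Φ y w) (fderiv ℝ Φ y v)) +
        fderiv ℝ (fderiv ℝ Φ) y v w := by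
    apply bilin_injective hib
    ext z
    obtain ⟨z, rfl⟩ := hΦi.surjective z
    rw [← hcb.self_of_nhds, bilin_inverse hic, map_add, bilin_inverse hib, add_apply]
    exact chrisL_pullback hb hs hc hΦ hcb v w z
  rw [hessOf, hessOf, h2, fderiv_comp _ hfd hd, ContinuousLinearMap.comp_apply, h3, map_add]
  ring

/-- The Laplacian is invariant under changes of coordinates. -/
theorem divOf_gradOf_pullback [CompleteSpace E] (hb : ContDiffAt ℝ 1 b (Φ y))
    (hs : ∀ᶠ z in nhds (Φ y), ∀ v w, b z v w = b z w v)
    (hib : ∀ᶠ z in nhds (Φ y), (b z).IsInvertible)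
    (hsc : ∀ᶠ z in nhds y, ∀ v w, c z v w = c z w v)
    (hic : ∀ᶠ z in nhds y, (c z).IsInvertible)
    (hc : ContDiffAt ℝ 1 c y) (hΦ : ContDiffAt ℝ 2 Φ y)
    (hΦi : (fderiv ℝ Φ y).IsInvertible)
    (hcb : ∀ᶠ z in nhds y, ∀ v w, c z v w = b (Φ z) (fderiv ℝ Φ z v) (fderiv ℝ Φ z w))
    {f : E → ℝ} (hf : ContDiffAt ℝ 2 f (Φ y)) :
    divOf c (gradOf c (f ∘ Φ)) y = divOf b (gradOf b f) (Φ y) := by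
  have hbd : DifferentiableAt ℝ b (Φ y) := hb.differentiableAt (by norm_num)
  have hcd : DifferentiableAt ℝ c y := hc.differentiableAt (by norm_num)
  have hf' : ContDiffAt ℝ 2 (f ∘ Φ) y := hf.comp y hΦ
  have hP : DifferentiableAt ℝ (gradOf b f) (Φ y) :=
    (gradOf_contDiffAt hb hib.self_of_nhds (by simpa using! hf)).differentiableAt (by norm_num)
  have hP' : DifferentiableAt ℝ (gradOf c (f ∘ Φ)) y :=
    (gradOf_contDiffAt hc hic.self_of_nhds (by simpa using! hf')).differentiableAt (by norm_num)
  obtain ⟨e, he⟩ := hΦi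
  -- the endomorphisms `∇∇f` in the two coordinate systems are conjugate by the differential of `Φ`
  have key : ∀ v, fderiv ℝ Φ y (covDeriv c (gradOf c (f ∘ Φ)) y v) =
      covDeriv b (gradOf b f) (Φ y) (fderiv ℝ Φ y v) := by
    intro v
    apply bilin_injective hib.self_of_nhds
    ext w
    obtain ⟨w, rfl⟩ := ContinuousLinearMap.IsInvertible.surjective ⟨e, he⟩ w
    rw [← hcb.self_of_nhds, bilin_covDeriv_gradOf hcd hsc hic hf' hP',
      bilin_covDeriv_gradOf hbd hs hib hf hP,
      hessOf_pullback hbd hs hib.self_of_nhds hic.self_of_nhds hcd hΦ ⟨e, he⟩ hcb hf]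
  rw [divOf, divOf, ← LinearMap.trace_conj' _ e.toLinearEquiv]
  congr 1
  ext v
  have := key (e.symm v)
  rw [← he] at this
  simpa [LinearEquiv.conj_apply] using this

end Pullback

/-! ### Pulled back metrics -/

section Pull

variable (n : ℕ) {M : Type*} [EMetricSpace M] [ChartedSpace (Eucl n) M]
  [RiemannianBundle (fun x : M ↦ TangentSpace (𝓡 n) x)]

/-- The pulled back metric `F^* g`. -/
def pullMetric {k : ℕ} (F : Eucl k → M) (y : Eucl k) : Eucl k →L[ℝ] Eucl k →L[ℝ] ℝ :=
  (innerSL ℝ (E := TangentSpace (𝓡 n) (F y))).bilinearComp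
    (mfderiv (𝓡 k) (𝓡 n) F y) (mfderiv (𝓡 k) (𝓡 n) F y)

theorem pullMetric_apply {k : ℕ} (F : Eucl k → M) (y v w : Eucl k) :
    pullMetric n F y v w =
      inner ℝ (mfderiv (𝓡 k) (𝓡 n) F y v) (mfderiv (𝓡 k) (𝓡 n) F y w) := rfl

theorem pullMetric_symm {k : ℕ} (F : Eucl k → M) (y v w : Eucl k) :
    pullMetric n F y v w = pullMetric n F y w v := by
  rw [pullMetric_apply, pullMetric_apply, real_inner_comm]

theorem pullMetric_pos {k : ℕ} {F : Eucl k → M} {y : Eucl k}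
    (h : Function.Injective (mfderiv (𝓡 k) (𝓡 n) F y)) {v : Eucl k} (hv : v ≠ 0) :
    0 < pullMetric n F y v v :=
  real_inner_self_pos.2 fun h0 ↦ hv (h (h0.trans (map_zero _).symm))

theorem isInvertible_of_pos {E : Type*} [NormedAddCommGroup E] [NormedSpace ℝ E]
    [FiniteDimensional ℝ E] {b : E →L[ℝ] E →L[ℝ] ℝ}
    (h : ∀ v, v ≠ 0 → 0 < b v v) : b.IsInvertible := by
  have hinj : Function.Injective b := by
    rw [injective_iff_map_eq_zero]
    intro v hv
    by_contra hv0
    have := h v hv0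
    simp [hv] at this
  have hdim : Module.finrank ℝ E = Module.finrank ℝ (E →L[ℝ] ℝ) := by
    rw [LinearMap.toContinuousLinearMap.symm.finrank_eq]
    exact (Subspace.dual_finrank_eq (K := ℝ) (V := E)).symm
  exact ⟨(LinearEquiv.ofInjectiveOfFinrankEq b.toLinearMap hinj hdim).toContinuousLinearEquiv,
    by ext; rfl⟩

theorem pullMetric_isInvertible {k : ℕ} {F : Eucl k → M} {y : Eucl k}
    (h : Function.Injective (mfderiv (𝓡 k) (𝓡 n) F y)) : (pullMetric n F y).IsInvertible :=
  isInvertible_of_pos fun _ hv ↦ pullMetric_pos n h hv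

theorem det_matrixOf_pos {b : Eucl n → Eucl n →L[ℝ] Eucl n →L[ℝ] ℝ} {y : Eucl n}
    (hs : ∀ v w, b y v w = b y w v) (h : ∀ v, v ≠ 0 → 0 < b y v v) :
    0 < (matrixOf b y).det := by
  have : (matrixOf b y).PosDef := by
    refine Matrix.PosDef.of_dotProduct_mulVec_pos ?_ ?_
    · ext i j
      exact hs _ _
    · intro v hv
      have h1 := h (WithLp.toLp 2 v) fun h0 ↦ hv (by
        ext i; exact congrArg (fun v : Eucl n ↦ v i) h0)
      rw [clm_apply_eq_sum] at h1
      have h3 : ∀ j, b y (WithLp.toLp 2 v) (EuclideanSpace.single j 1) =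
          ∑ i, v i * matrixOf b y i j := fun j ↦
        clm_apply_eq_sum ((b y).flip (EuclideanSpace.single j 1)) (WithLp.toLp 2 v)
      simp only [h3] at h1
      simp only [dotProduct, Matrix.mulVec, star_trivial]
      refine h1.trans_eq (Finset.sum_congr rfl fun i _ ↦ ?_)
      congr 1
      exact Finset.sum_congr rfl fun j _ ↦ by rw [mul_comm, (isSymm_matrixOf hs).apply]
  exact this.det_pos

variable [IsManifold (𝓡 n) ∞ M]
  [IsContMDiffRiemannianBundle (𝓡 n) ∞ (EuclideanSpace ℝ (Fin n))
      (fun x : M ↦ TangentSpace (𝓡 n) x)]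

theorem contDiffOn_pullMetric {k : ℕ} {F : Eucl k → M} {U : Set (Eucl k)} (hU : IsOpen U)
    (hF : ContMDiffOn (𝓡 k) (𝓡 n) ∞ F U) : ContDiffOn ℝ ∞ (pullMetric n F) U := by
  have hsec : ∀ v : Eucl k, ContMDiffOn (𝓡 k) (𝓡 n).tangent ∞
      (fun z ↦ (⟨F z, mfderiv (𝓡 k) (𝓡 n) F z v⟩ : TangentBundle (𝓡 n) M)) U := by
    intro v
    have h1 := hF.contMDiffOn_tangentMapWithin (m := ∞) (by simp) hU.uniqueMDiffOn
    have h2 : ContMDiff (𝓡 k) (𝓡 k).tangent ∞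
        (fun z : Eucl k ↦ (⟨z, v⟩ : TangentBundle (𝓡 k) (Eucl k))) :=
      contMDiff_vectorSpace_iff_contDiff.2 contDiff_const
    have h3 := h1.comp (h2.contMDiffOn (s := U)) (fun z hz ↦ hz)
    refine h3.congr fun z hz ↦ ?_
    simp [tangentMapWithin, mfderivWithin_of_isOpen hU hz]
  refine contDiffOn_clm_apply.2 fun v ↦ contDiffOn_clm_apply.2 fun w ↦ ?_
  rw [← contMDiffOn_iff_contDiffOn]
  exact (hsec v).inner_bundle (hsec w)

/-! ### Geometry in the preferred charts -/

variable {n}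

/-- The metric in the coordinates of the preferred chart at `x`. -/
def chartMetric (n : ℕ) {M : Type*} [EMetricSpace M] [ChartedSpace (Eucl n) M]
    [RiemannianBundle (fun x : M ↦ TangentSpace (𝓡 n) x)] (x : M) :
    Eucl n → Eucl n →L[ℝ] Eucl n →L[ℝ] ℝ :=
  pullMetric n (extChartAt (𝓡 n) x).symm

theorem isOpen_target (x : M) : IsOpen (extChartAt (𝓡 n) x).target :=
  isOpen_extChartAt_target x

theorem mfderiv_symm_injective (x : M) {y : Eucl n} (hy : y ∈ (extChartAt (𝓡 n) x).target) :
    Function.Injective (mfderiv (𝓡 n) (𝓡 n) (extChartAt (𝓡 n) x).symm y) := by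
  have h := isInvertible_mfderivWithin_extChartAt_symm (I := 𝓡 n) hy
  rw [ModelWithCorners.range_eq_univ, mfderivWithin_univ] at h
  exact h.injective

theorem contDiffOn_chartMetric (x : M) :
    ContDiffOn ℝ ∞ (chartMetric n x) (extChartAt (𝓡 n) x).target :=
  contDiffOn_pullMetric n (isOpen_target x) (contMDiffOn_extChartAt_symm x)

omit [IsManifold (𝓡 n) ∞ M] [IsContMDiffRiemannianBundle (𝓡 n) ∞ (EuclideanSpace ℝ (Fin n))
      (fun x : M ↦ TangentSpace (𝓡 n) x)] in
theorem metricCoeff_eq (x : M) : metricCoeff n x = matrixOf (chartMetric n x) := rfl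

/-- The Christoffel symbols of the second kind are obtained from those of the first kind by raising
an index. -/
theorem christoffel_eq (x : M) (k i j : Fin n) {y : Eucl n}
    (hy : y ∈ (extChartAt (𝓡 n) x).target) :
    christoffel n x k i j y = (chartMetric n x y).inverse (chrisL (chartMetric n x) y
      (EuclideanSpace.single j 1) (EuclideanSpace.single i 1)) k := by
  set b := chartMetric n x with hbdef
  have hb : DifferentiableAt ℝ b y :=
    ((contDiffOn_chartMetric x).contDiffAt ((isOpen_target x).mem_nhds hy)).differentiableAt
      (by simp)
  have hi : (b y).IsInvertible := pullMetric_isInvertible n (mfderiv_symm_injective x hy)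
  have hs : ∀ z v w, b z v w = b z w v := pullMetric_symm n _
  have hp : ∀ u i j, pderiv u (fun z ↦ metricCoeff n x z i j) y =
      fderiv ℝ b y (EuclideanSpace.single u 1) (EuclideanSpace.single i 1)
        (EuclideanSpace.single j 1) := by
    intro u i j
    have := fderiv_bilin hb (hasFDerivAt_const (EuclideanSpace.single i (1 : ℝ)) y)
      (hasFDerivAt_const (EuclideanSpace.single j (1 : ℝ)) y) (EuclideanSpace.single u 1)
    simp only [zero_apply, map_zero, add_zero] at this
    exact this
  have hsD := fderiv_bilin_symm hb (.of_forall hs)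
  set c := (b y).inverse (chrisL b y (EuclideanSpace.single j 1) (EuclideanSpace.single i 1))
    with hc
  have h1 : ∀ l, (1 / 2 : ℝ) * (pderiv i (fun z ↦ metricCoeff n x z j l) y +
      pderiv j (fun z ↦ metricCoeff n x z i l) y - pderiv l (fun z ↦ metricCoeff n x z i j) y) =
      b y c (EuclideanSpace.single l 1) := by
    intro l
    rw [hc, bilin_inverse hi, chrisL_apply, hp, hp, hp,
      hsD _ (EuclideanSpace.single j 1) (EuclideanSpace.single i 1)]
  have h2 : ∀ l, b y c (EuclideanSpace.single l 1) = ∑ m, c m * matrixOf b y m l := fun l ↦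
    clm_apply_eq_sum ((b y).flip (EuclideanSpace.single l 1)) c
  have h3 : ∀ m, ∑ l, (matrixOf b y)⁻¹ k l * (c m * matrixOf b y m l) =
      c m * (1 : Matrix (Fin n) (Fin n) ℝ) m k := by
    intro m
    rw [← Matrix.mul_nonsing_inv _ (isUnit_det_matrixOf hi), Matrix.mul_apply, Finset.mul_sum]
    refine Finset.sum_congr rfl fun l _ ↦ ?_
    rw [inv_matrixOf_symm (hs y)]
    ring
  calc christoffel n x k i j y
      = ∑ l, (matrixOf b y)⁻¹ k l * ((1 / 2 : ℝ) * (pderiv i (fun z ↦ metricCoeff n x z j l) y +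
      pderiv j (fun z ↦ metricCoeff n x z i l) y
        - pderiv l (fun z ↦ metricCoeff n x z i j) y)) := by
        rw [christoffel, Finset.mul_sum, metricCoeff_eq]
        exact Finset.sum_congr rfl fun l _ ↦ by ring
    _ = ∑ l, ∑ m, (matrixOf b y)⁻¹ k l * (c m * matrixOf b y m l) := by
        simp only [h1, h2, Finset.mul_sum]
    _ = c k := by
        rw [Finset.sum_comm]
        simp [h3, Matrix.one_apply]

theorem hessCoeff_eq {f : M → ℝ} {x : M} (hf : ContMDiffAt (𝓡 n) 𝓘(ℝ) 2 f x) (i j : Fin n) :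
    hessCoeff n f x i j = hessOf (chartMetric n x) (f ∘ (extChartAt (𝓡 n) x).symm)
      (extChartAt (𝓡 n) x x) (EuclideanSpace.single i 1) (EuclideanSpace.single j 1) := by
  have hf' : ContDiffAt ℝ 2 (f ∘ (extChartAt (𝓡 n) x).symm) (extChartAt (𝓡 n) x x) := by
    rw [← contMDiffAt_iff_contDiffAt]
    refine ContMDiffAt.comp_of_eq (I' := 𝓡 n) hf ?_ (extChartAt_to_inv x)
    exact ((contMDiffOn_extChartAt_symm (n := ∞) x).contMDiffAt
      ((isOpen_target x).mem_nhds (mem_extChartAt_target x))).of_le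
        (by exact WithTop.coe_le_coe.2 le_top)
  have hdd : DifferentiableAt ℝ (fderiv ℝ (f ∘ (extChartAt (𝓡 n) x).symm))
      (extChartAt (𝓡 n) x x) :=
    (hf'.fderiv_right (m := 1) (by norm_num)).differentiableAt (by norm_num)
  rw [hessCoeff, hessOf]
  congr 1
  · have h3 : HasFDerivAt (fun z ↦ fderiv ℝ (f ∘ (extChartAt (𝓡 n) x).symm) z
        (EuclideanSpace.single j (1 : ℝ))) _ (extChartAt (𝓡 n) x x) :=
      hdd.hasFDerivAt.clm_apply (hasFDerivAt_const (EuclideanSpace.single j (1 : ℝ)) _)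
    rw [pderiv]
    change fderiv ℝ (fun z ↦ fderiv ℝ (f ∘ (extChartAt (𝓡 n) x).symm) z
        (EuclideanSpace.single j (1 : ℝ))) _ _ = _
    rw [h3.fderiv]
    simp
  · simp only [christoffel_eq x _ i j (mem_extChartAt_target x)]
    exact (clm_apply_eq_sum _ _).symm

end Pull

/-! ### Gradient, Hessian and Laplacian in arbitrary coordinates -/

section Normal

variable {n : ℕ} {M : Type*} [EMetricSpace M] [ChartedSpace (Eucl n) M]
  [RiemannianBundle (fun x : M ↦ TangentSpace (𝓡 n) x)]

/-- `F`, on the Euclidean ball of radius `R`, is a parametrization of a neighbourhood of `p` by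
geodesic normal coordinates: an injective immersion for which the Gauss lemma holds. -/
structure IsNormalChart (p : M) (R : ℝ) (F : Eucl n → M) : Prop where
  map_zero : F 0 = p
  contMDiffOn : ContMDiffOn (𝓡 n) (𝓡 n) ∞ F (Metric.ball 0 R)
  injOn : Set.InjOn F (Metric.ball 0 R)
  immersion : ∀ y ∈ Metric.ball (0 : Eucl n) R, Function.Injective (mfderiv (𝓡 n) (𝓡 n) F y)
  gauss : ∀ y ∈ Metric.ball (0 : Eucl n) R, ∀ v, pullMetric n F y y v = inner ℝ y v

/-- The immersion `F` is an equidimensional parametrization on the open set `U`. -/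
structure IsRegularOn (F : Eucl n → M) (U : Set (Eucl n)) : Prop where
  isOpen : IsOpen U
  contMDiffOn : ContMDiffOn (𝓡 n) (𝓡 n) ∞ F U
  immersion : ∀ y ∈ U, Function.Injective (mfderiv (𝓡 n) (𝓡 n) F y)

variable [IsManifold (𝓡 n) ∞ M]
  [IsContMDiffRiemannianBundle (𝓡 n) ∞ (EuclideanSpace ℝ (Fin n))
      (fun x : M ↦ TangentSpace (𝓡 n) x)]

variable {F : Eucl n → M} {U : Set (Eucl n)} {y : Eucl n}

theorem IsRegularOn.contMDiffAt (h : IsRegularOn F U) (hy : y ∈ U) :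
    ContMDiffAt (𝓡 n) (𝓡 n) ∞ F y :=
  h.contMDiffOn.contMDiffAt (h.isOpen.mem_nhds hy)

theorem IsRegularOn.mdifferentiableAt (h : IsRegularOn F U) (hy : y ∈ U) :
    MDifferentiableAt (𝓡 n) (𝓡 n) F y :=
  (h.contMDiffAt hy).mdifferentiableAt (by simp)

theorem IsRegularOn.contDiffAt_metric (h : IsRegularOn F U) (hy : y ∈ U) :
    ContDiffAt ℝ ∞ (pullMetric n F) y :=
  (contDiffOn_pullMetric n h.isOpen h.contMDiffOn).contDiffAt (h.isOpen.mem_nhds hy)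

theorem IsRegularOn.isInvertible_metric (h : IsRegularOn F U) (hy : y ∈ U) :
    (pullMetric n F y).IsInvertible :=
  pullMetric_isInvertible n (h.immersion y hy)

theorem IsRegularOn.det_pos (h : IsRegularOn F U) (hy : y ∈ U) :
    0 < (matrixOf (pullMetric n F) y).det :=
  det_matrixOf_pos n (pullMetric_symm n F y) fun _ hv ↦ pullMetric_pos n (h.immersion y hy) hv

theorem contDiffAt_chart_comp (h : IsRegularOn F U) (hy : y ∈ U) {x : M}
    (hx : F y ∈ (extChartAt (𝓡 n) x).source) :
    ContDiffAt ℝ ∞ (extChartAt (𝓡 n) x ∘ F) y := by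
  rw [← contMDiffAt_iff_contDiffAt]
  exact (contMDiffAt_extChartAt' (by rwa [extChartAt_source] at hx)).comp y (h.contMDiffAt hy)

theorem mfderiv_eq_comp_fderiv (h : IsRegularOn F U) (hy : y ∈ U) {x : M}
    (hx : F y ∈ (extChartAt (𝓡 n) x).source) (v : Eucl n) :
    mfderiv (𝓡 n) (𝓡 n) F y v =
      mfderiv (𝓡 n) (𝓡 n) (extChartAt (𝓡 n) x).symm (extChartAt (𝓡 n) x (F y))
        (fderiv ℝ (extChartAt (𝓡 n) x ∘ F) y v) := by
  have h1 : F =ᶠ[nhds y] (extChartAt (𝓡 n) x).symm ∘ (extChartAt (𝓡 n) x ∘ F) := by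
    have := (h.contMDiffAt hy).continuousAt.preimage_mem_nhds
      ((isOpen_extChartAt_source (I := 𝓡 n) x).mem_nhds hx)
    filter_upwards [this] with z hz
    exact ((extChartAt (𝓡 n) x).left_inv hz).symm
  have h2 : MDifferentiableAt (𝓡 n) (𝓡 n) (extChartAt (𝓡 n) x ∘ F) y :=
    ((contDiffAt_chart_comp h hy hx).differentiableAt (by simp)).mdifferentiableAt
  have h3 : MDifferentiableAt (𝓡 n) (𝓡 n) (extChartAt (𝓡 n) x).symm
      ((extChartAt (𝓡 n) x ∘ F) y) :=
    ((contMDiffOn_extChartAt_symm (n := ∞) x).contMDiffAt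
      ((isOpen_target x).mem_nhds ((extChartAt (𝓡 n) x).map_source hx))).mdifferentiableAt
      (by simp)
  have h4 := mfderiv_comp y h3 h2
  rw [mfderiv_eq_fderiv] at h4
  have h5 : mfderiv (𝓡 n) (𝓡 n) F y = mfderiv (𝓡 n) (𝓡 n)
    ((extChartAt (𝓡 n) x).symm ∘ (extChartAt (𝓡 n) x ∘ F)) y := h1.mfderiv_eq
  have h6 := congrArg (fun L : Eucl n →L[ℝ] Eucl n ↦ L v) (h5.trans h4)
  exact h6

/-- All tangent spaces are, by definition, the same space `ℝⁿ`; their inner products at points `x`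
and `x'` agree when `x = x'`. This avoids rewriting in dependent types. -/
theorem inner_congr {x x' : M} (h : x = x') (a b : Eucl n) :
    @inner ℝ (TangentSpace (𝓡 n) x) _ a b = @inner ℝ (TangentSpace (𝓡 n) x') _ a b := by
  rw [h]

/-- The metric in the coordinates `F` is related to that in a preferred chart by the change of
coordinates. -/
theorem pullMetric_eq_chartMetric (h : IsRegularOn F U) (hy : y ∈ U) {x : M}
    (hx : F y ∈ (extChartAt (𝓡 n) x).source) (v w : Eucl n) :
    pullMetric n F y v w = chartMetric n x ((extChartAt (𝓡 n) x ∘ F) y)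
      (fderiv ℝ (extChartAt (𝓡 n) x ∘ F) y v) (fderiv ℝ (extChartAt (𝓡 n) x ∘ F) y w) := by
  have h1 : F y = (extChartAt (𝓡 n) x).symm (extChartAt (𝓡 n) x (F y)) :=
    ((extChartAt (𝓡 n) x).left_inv hx).symm
  rw [chartMetric, pullMetric_apply, pullMetric_apply, mfderiv_eq_comp_fderiv h hy hx,
    mfderiv_eq_comp_fderiv h hy hx]
  exact inner_congr (n := n) h1 _ _

theorem isInvertible_fderiv_chart (h : IsRegularOn F U) (hy : y ∈ U) {x : M}
    (hx : F y ∈ (extChartAt (𝓡 n) x).source) :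
    (fderiv ℝ (extChartAt (𝓡 n) x ∘ F) y).IsInvertible := by
  have hinj : Function.Injective (fderiv ℝ (extChartAt (𝓡 n) x ∘ F) y) := by
    intro v w hvw
    apply h.immersion y hy
    rw [mfderiv_eq_comp_fderiv h hy hx, mfderiv_eq_comp_fderiv h hy hx, hvw]
  exact ⟨(LinearEquiv.ofInjectiveEndo _ hinj).toContinuousLinearEquiv, by ext; rfl⟩

theorem mfderiv_surjective (h : IsRegularOn F U) (hy : y ∈ U) :
    Function.Surjective (mfderiv (𝓡 n) (𝓡 n) F y) :=
  let L : Eucl n →L[ℝ] Eucl n := mfderiv (𝓡 n) (𝓡 n) F y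
  LinearMap.surjective_of_injective (f := L.toLinearMap) (h.immersion y hy)

theorem fderiv_comp_eq_mfderiv (h : IsRegularOn F U) (hy : y ∈ U) {f : M → ℝ}
    (hf : MDifferentiableAt (𝓡 n) 𝓘(ℝ) f (F y)) (v : Eucl n) :
    fderiv ℝ (f ∘ F) y v = mfderiv (𝓡 n) 𝓘(ℝ) f (F y) (mfderiv (𝓡 n) (𝓡 n) F y v) := by
  have h1 := mfderiv_comp y hf (h.mdifferentiableAt hy)
  rw [mfderiv_eq_fderiv] at h1
  exact congrArg (fun L : Eucl n →L[ℝ] ℝ ↦ L v) h1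

/-- The gradient in the coordinates `F`. -/
theorem grad_eq (h : IsRegularOn F U) (hy : y ∈ U) {f : M → ℝ}
    (hf : MDifferentiableAt (𝓡 n) 𝓘(ℝ) f (F y)) :
    grad n f (F y) = mfderiv (𝓡 n) (𝓡 n) F y (gradOf (pullMetric n F) (f ∘ F) y) := by
  refine ext_inner_right ℝ fun w ↦ ?_
  obtain ⟨w, rfl⟩ := mfderiv_surjective h hy w
  refine (inner_grad n f (F y) _).trans ((fderiv_comp_eq_mfderiv h hy hf w).symm.trans ?_)
  change _ = pullMetric n F y (gradOf (pullMetric n F) (f ∘ F) y) w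
  rw [bilin_gradOf (h.isInvertible_metric hy)]

theorem contDiffAt_comp_symm {f : M → ℝ} {x : M} {m : WithTop ℕ∞} (hm : m ≤ (∞ : WithTop ℕ∞))
    (hf : ContMDiffAt (𝓡 n) 𝓘(ℝ) m f x) :
    ContDiffAt ℝ m (f ∘ (extChartAt (𝓡 n) x).symm) (extChartAt (𝓡 n) x x) := by
  rw [← contMDiffAt_iff_contDiffAt]
  refine ContMDiffAt.comp_of_eq (I' := 𝓡 n) hf ?_ (extChartAt_to_inv x)
  exact ((contMDiffOn_extChartAt_symm (n := ∞) x).contMDiffAt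
    ((isOpen_target x).mem_nhds (mem_extChartAt_target x))).of_le hm

theorem eventually_pullMetric_eq (h : IsRegularOn F U) (hy : y ∈ U) {x : M}
    (hx : F y ∈ (extChartAt (𝓡 n) x).source) :
    ∀ᶠ z in nhds y, ∀ v w, pullMetric n F z v w = chartMetric n x ((extChartAt (𝓡 n) x ∘ F) z)
      (fderiv ℝ (extChartAt (𝓡 n) x ∘ F) z v) (fderiv ℝ (extChartAt (𝓡 n) x ∘ F) z w) := by
  filter_upwards [h.isOpen.mem_nhds hy, (h.contMDiffAt hy).continuousAt.preimage_mem_nhds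
      ((isOpen_extChartAt_source (I := 𝓡 n) x).mem_nhds hx)] with z hz1 hz2 v w
  exact pullMetric_eq_chartMetric h hz1 hz2 v w

theorem comp_symm_comp_eventuallyEq (h : IsRegularOn F U) (hy : y ∈ U) (f : M → ℝ) :
    (f ∘ (extChartAt (𝓡 n) (F y)).symm) ∘ (extChartAt (𝓡 n) (F y) ∘ F) =ᶠ[nhds y] f ∘ F := by
  filter_upwards [(h.contMDiffAt hy).continuousAt.preimage_mem_nhds
      ((isOpen_extChartAt_source (I := 𝓡 n) (F y)).mem_nhds (mem_extChartAt_source (F y)))]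
    with z hz
  simp only [Function.comp_apply]
  rw [(extChartAt (𝓡 n) (F y)).left_inv hz]

theorem eventually_isInvertible_chartMetric (x : M) {y : Eucl n}
    (hy : y ∈ (extChartAt (𝓡 n) x).target) :
    ∀ᶠ z in nhds y, (chartMetric n x z).IsInvertible :=
  Filter.eventually_of_mem ((isOpen_target x).mem_nhds hy) fun _ hz ↦
    pullMetric_isInvertible n (mfderiv_symm_injective x hz)

theorem hessOf_congr {E : Type*} [NormedAddCommGroup E] [NormedSpace ℝ E]
    (b : E → E →L[ℝ] E →L[ℝ] ℝ) {f g : E → ℝ} {y : E} (h : f =ᶠ[nhds y] g) (v w : E) :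
    hessOf b f y v w = hessOf b g y v w := by
  rw [hessOf, hessOf, h.fderiv_eq, h.fderiv.fderiv_eq]

theorem gradOf_congr {E : Type*} [NormedAddCommGroup E] [NormedSpace ℝ E]
    (b : E → E →L[ℝ] E →L[ℝ] ℝ) {f g : E → ℝ} {y : E} (h : f =ᶠ[nhds y] g) :
    gradOf b f =ᶠ[nhds y] gradOf b g := by
  filter_upwards [h.fderiv (𝕜 := ℝ)] with z hz
  rw [gradOf, gradOf, hz]

theorem divOf_congr {E : Type*} [NormedAddCommGroup E] [NormedSpace ℝ E]
    (b : E → E →L[ℝ] E →L[ℝ] ℝ) {X Y : E → E} {y : E} (h : X =ᶠ[nhds y] Y) :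
    divOf b X y = divOf b Y y := by
  rw [divOf, divOf, covDeriv, covDeriv, h.fderiv_eq, h.self_of_nhds]

theorem hessOf_eq_sum {b : Eucl n → Eucl n →L[ℝ] Eucl n →L[ℝ] ℝ} {y : Eucl n}
    (hb : DifferentiableAt ℝ b y)
    (hs : ∀ᶠ z in nhds y, ∀ v w, b z v w = b z w v) {f : Eucl n → ℝ} (hf : ContDiffAt ℝ 2 f y)
    (v w : Eucl n) : hessOf b f y v w = ∑ i, ∑ j, v i * w j *
      hessOf b f y (EuclideanSpace.single i 1) (EuclideanSpace.single j 1) := by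
  have h1 : ∀ v w, hessOf b f y v w = ∑ i, v i * hessOf b f y (EuclideanSpace.single i 1) w :=
    fun v w ↦ clm_apply_eq_sum ((fderiv ℝ (fderiv ℝ f) y).flip w -
      (fderiv ℝ f y).comp ((b y).inverse.comp (chrisL b y w))) v
  rw [h1]
  refine Finset.sum_congr rfl fun i _ ↦ ?_
  rw [hessOf_symm hb hs hf, h1, Finset.mul_sum]
  refine Finset.sum_congr rfl fun j _ ↦ ?_
  rw [hessOf_symm hb hs hf]
  ring

/-- The Hessian in the coordinates `F`. -/
theorem hessian_eq (h : IsRegularOn F U) (hy : y ∈ U) {f : M → ℝ}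
    (hf : ContMDiffAt (𝓡 n) 𝓘(ℝ) 2 f (F y)) (v w : Eucl n) :
    hessian n f (F y) (mfderiv (𝓡 n) (𝓡 n) F y v) (mfderiv (𝓡 n) (𝓡 n) F y w) =
      hessOf (pullMetric n F) (f ∘ F) y v w := by
  have hsrc : F y ∈ (extChartAt (𝓡 n) (F y)).source := mem_extChartAt_source (F y)
  have htgt : extChartAt (𝓡 n) (F y) (F y) ∈ (extChartAt (𝓡 n) (F y)).target :=
    mem_extChartAt_target (F y)
  set Φ := extChartAt (𝓡 n) (F y) ∘ F with hΦ
  have hcoords : ∀ v : Eucl n, coords n (mfderiv (𝓡 n) (𝓡 n) F y v) = fderiv ℝ Φ y v := by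
    intro v
    have h1 : MDifferentiableAt (𝓡 n) 𝓘(ℝ, Eucl n) (extChartAt (𝓡 n) (F y)) (F y) :=
      (contMDiffAt_extChartAt (n := ∞)).mdifferentiableAt (by simp)
    have h2 := mfderiv_comp y h1 (h.mdifferentiableAt hy)
    rw [mfderiv_eq_fderiv] at h2
    exact (congrArg (fun L : Eucl n →L[ℝ] Eucl n ↦ L v) h2).symm
  have hb : DifferentiableAt ℝ (chartMetric n (F y)) (Φ y) :=
    ((contDiffOn_chartMetric (F y)).contDiffAt
      ((isOpen_target (F y)).mem_nhds htgt)).differentiableAt (by simp)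
  rw [← hessOf_congr _ (comp_symm_comp_eventuallyEq h hy f),
    hessOf_pullback hb (.of_forall (pullMetric_symm n _))
      (eventually_isInvertible_chartMetric (F y) htgt).self_of_nhds (h.isInvertible_metric hy)
      ((h.contDiffAt_metric hy).differentiableAt (by simp))
      ((contDiffAt_chart_comp h hy hsrc).of_le (WithTop.coe_le_coe.2 le_top))
      (isInvertible_fderiv_chart h hy hsrc) (eventually_pullMetric_eq h hy hsrc)
      (contDiffAt_comp_symm (WithTop.coe_le_coe.2 le_top) hf)]
  rw [hessian]
  simp only [hessCoeff_eq hf]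
  rw [hessOf_eq_sum hb (.of_forall (pullMetric_symm n _))
    (contDiffAt_comp_symm (WithTop.coe_le_coe.2 le_top) hf)]
  exact Finset.sum_congr rfl fun i _ ↦ Finset.sum_congr rfl fun j _ ↦ by
    have ev := congrArg (fun u : Eucl n ↦ u i) (hcoords v)
    have ew := congrArg (fun u : Eucl n ↦ u j) (hcoords w)
    simp only at ev ew
    rw [ev, ew]
    simp only [hΦ, Function.comp_apply]
    ring

/-- The Laplacian in the coordinates `F`. -/
theorem laplacian_eq (h : IsRegularOn F U) (hy : y ∈ U) {f : M → ℝ}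
    (hf : ContMDiffAt (𝓡 n) 𝓘(ℝ) 2 f (F y)) :
    laplacian n f (F y) = divOf (pullMetric n F) (gradOf (pullMetric n F) (f ∘ F)) y := by
  set x := F y with hx
  have hsrc : F y ∈ (extChartAt (𝓡 n) x).source := mem_extChartAt_source x
  have htgt : extChartAt (𝓡 n) x x ∈ (extChartAt (𝓡 n) x).target := mem_extChartAt_target x
  have hb : ContDiffAt ℝ 1 (chartMetric n x) ((extChartAt (𝓡 n) x ∘ F) y) :=
    ((contDiffOn_chartMetric x).contDiffAt ((isOpen_target x).mem_nhds htgt)).of_le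
      (WithTop.coe_le_coe.2 le_top)
  have hf' := contDiffAt_comp_symm (WithTop.coe_le_coe.2 le_top) hf
  rw [← divOf_congr _ (gradOf_congr _ (comp_symm_comp_eventuallyEq h hy f)),
    divOf_gradOf_pullback hb (.of_forall (pullMetric_symm n _))
      (eventually_isInvertible_chartMetric x htgt) (.of_forall (pullMetric_symm n _))
      (Filter.eventually_of_mem (h.isOpen.mem_nhds hy) fun z hz ↦ h.isInvertible_metric hz)
      ((h.contDiffAt_metric hy).of_le (WithTop.coe_le_coe.2 le_top))
      ((contDiffAt_chart_comp h hy hsrc).of_le (WithTop.coe_le_coe.2 le_top))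
      (isInvertible_fderiv_chart h hy hsrc) (eventually_pullMetric_eq h hy hsrc) hf',
    divOf_gradOf_eq_sum hb (.of_forall (pullMetric_symm n _))
      (eventually_isInvertible_chartMetric x htgt) hf', laplacian]
  simp only [hessCoeff_eq hf]
  rfl

end Normal

/-! ### Normal coordinates -/

section Existence

variable {n : ℕ} {M : Type*} [EMetricSpace M] [ChartedSpace (Eucl n) M]
  [RiemannianBundle (fun x : M ↦ TangentSpace (𝓡 n) x)]
  [IsManifold (𝓡 n) ∞ M]
  [IsContMDiffRiemannianBundle (𝓡 n) ∞ (EuclideanSpace ℝ (Fin n))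
      (fun x : M ↦ TangentSpace (𝓡 n) x)]

theorem IsNormalChart.isRegularOn {p : M} {R : ℝ} {F : Eucl n → M} (h : IsNormalChart p R F) :
    IsRegularOn F (Metric.ball 0 R) :=
  ⟨Metric.isOpen_ball, h.contMDiffOn, h.immersion⟩

theorem chrisL_eq_sum {b : Eucl n → Eucl n →L[ℝ] Eucl n →L[ℝ] ℝ} {y : Eucl n}
    (hb : DifferentiableAt ℝ b y)
    (hs : ∀ᶠ z in nhds y, ∀ v w, b z v w = b z w v) (v w : Eucl n) :
    chrisL b y w v = ∑ i, ∑ j, (v i * w j) •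
      chrisL b y (EuclideanSpace.single j 1) (EuclideanSpace.single i 1) := by
  ext z
  have h1 : ∀ v w, chrisL b y w v z =
      ∑ i, v i * chrisL b y w (EuclideanSpace.single i 1) z :=
    fun v w ↦ clm_apply_eq_sum ((chrisL b y w).flip z) v
  rw [h1]
  simp only [sum_apply, smul_apply, smul_eq_mul]
  refine Finset.sum_congr rfl fun i _ ↦ ?_
  rw [chrisL_symm hb hs, h1, Finset.mul_sum]
  refine Finset.sum_congr rfl fun j _ ↦ ?_
  rw [chrisL_symm hb hs]
  ring

/-- The geodesic equation in the coordinates `F` for a ray `s ↦ s v`: as the ray has no second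
derivative, it reads `Γ(v, v) = 0`. -/
theorem chrisL_eq_zero_of_isGeodesicOn {F : Eucl n → M} {U : Set (Eucl n)}
    (h : IsRegularOn F U) {v : Eucl n} {J : Set ℝ}
    (hγ : IsGeodesicOn n (fun s : ℝ ↦ F (s • v)) J) {s : ℝ} (hsJ : s ∈ J)
    (hsU : s • v ∈ U) (z : Eucl n) : chrisL (pullMetric n F) (s • v) v v z = 0 := by
  have hsrc : F (s • v) ∈ (extChartAt (𝓡 n) (F (s • v))).source := mem_extChartAt_source _
  have htgt : extChartAt (𝓡 n) (F (s • v)) (F (s • v)) ∈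
      (extChartAt (𝓡 n) (F (s • v))).target := mem_extChartAt_target _
  set Φ := extChartAt (𝓡 n) (F (s • v)) ∘ F with hΦ
  set b := chartMetric n (F (s • v)) with hb
  have hbd : DifferentiableAt ℝ b (Φ (s • v)) :=
    ((contDiffOn_chartMetric _).contDiffAt ((isOpen_target _).mem_nhds htgt)).differentiableAt
      (by simp)
  have hΦ2 : ContDiffAt ℝ 2 Φ (s • v) :=
    (contDiffAt_chart_comp h hsU hsrc).of_le (WithTop.coe_le_coe.2 le_top)
  have hbi : (b (Φ (s • v))).IsInvertible :=
    (eventually_isInvertible_chartMetric _ htgt).self_of_nhds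
  have hray : ∀ s : ℝ, HasDerivAt (fun s : ℝ ↦ s • v) v s := fun s ↦ by
    simpa using (hasDerivAt_id s).smul_const v
  have hd1 : (deriv fun s' : ℝ ↦ Φ (s' • v)) =ᶠ[nhds s] fun s' ↦ fderiv ℝ Φ (s' • v) v := by
    have h1 := (hray s).continuousAt.eventually (hΦ2.eventually (by simp))
    filter_upwards [h1] with s' hs'
    exact ((hs'.differentiableAt (by norm_num)).hasFDerivAt.comp_hasDerivAt s' (hray s')).deriv
  have hd2 : deriv (deriv fun s' : ℝ ↦ Φ (s' • v)) s = fderiv ℝ (fderiv ℝ Φ) (s • v) v v := by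
    have hdd : DifferentiableAt ℝ (fderiv ℝ Φ) (s • v) :=
      (hΦ2.fderiv_right (m := 1) (by norm_num)).differentiableAt (by norm_num)
    have h1 : HasDerivAt (fun s' : ℝ ↦ fderiv ℝ Φ (s' • v)) (fderiv ℝ (fderiv ℝ Φ) (s • v) v) s :=
      hdd.hasFDerivAt.comp_hasDerivAt s (hray s)
    have h2 := h1.clm_apply (hasDerivAt_const s v)
    rw [hd1.deriv_eq, h2.deriv]
    simp
  have hgeo := hγ.2 s hsJ
  have hgeo' : fderiv ℝ (fderiv ℝ Φ) (s • v) v v +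
      (b (Φ (s • v))).inverse (chrisL b (Φ (s • v)) (fderiv ℝ Φ (s • v) v)
        (fderiv ℝ Φ (s • v) v)) = 0 := by
    ext k
    have h1 := hgeo k
    simp only at h1
    rw [chrisL_eq_sum hbd (.of_forall (pullMetric_symm n _))]
    have h2 : deriv (fun s' : ℝ ↦ extChartAt (𝓡 n) (F (s • v)) (F (s' • v))) s =
        fderiv ℝ Φ (s • v) v := hd1.self_of_nhds
    have h3 : deriv (deriv fun s' : ℝ ↦ extChartAt (𝓡 n) (F (s • v)) (F (s' • v))) s =
        fderiv ℝ (fderiv ℝ Φ) (s • v) v v := hd2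
    rw [h2, h3] at h1
    simp only [christoffel_eq _ _ _ _ htgt] at h1
    simp only [map_sum, map_smul, PiLp.add_apply, PiLp.zero_apply]
    rw [← h1]
    congr 1
    have h4 : ∀ (s : Finset (Fin n)) (f : Fin n → Eucl n),
        (∑ i ∈ s, f i : Eucl n) k = ∑ i ∈ s, f i k := by
      intro s f; simp
    simp only [h4, PiLp.smul_apply, smul_eq_mul]
    refine Finset.sum_congr rfl fun i _ ↦ Finset.sum_congr rfl fun j _ ↦ ?_
    simp only [hΦ, hb, Function.comp_apply]
    ring
  rw [chrisL_pullback hbd (.of_forall (pullMetric_symm n _))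
    ((h.contDiffAt_metric hsU).differentiableAt (by simp)) hΦ2
    (eventually_pullMetric_eq h hsU hsrc)]
  have h5 := congrArg (fun u ↦ b (Φ (s • v)) u (fderiv ℝ Φ (s • v) z)) hgeo'
  simp only [map_add, bilin_inverse hbi, add_apply, map_zero, zero_apply] at h5
  linarith

/-- Inside the injectivity radius there are geodesic normal coordinates. -/
theorem exists_isNormalChart {p : M} {t : ℝ} (ht : 0 < t)
    (htinj : ENNReal.ofReal t < injRadius n p) :
    ∃ R, t < R ∧ ∃ F : Eucl n → M, IsNormalChart p R F := by
  obtain ⟨R₀, ⟨e, he, hes, hei, hed⟩, hR₀⟩ := lt_sSup_iff.1 htinj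
  obtain ⟨R, hR1, hR2⟩ := ENNReal.lt_iff_exists_nnreal_btwn.1 hR₀
  have htR : t < R := by
    have := (ENNReal.ofReal_lt_iff_lt_toReal ht.le (by simp)).1 hR1
    simpa using this
  refine ⟨R, htR, ?_⟩
  have hdim : Module.finrank ℝ (TangentSpace (𝓡 n) p) = n :=
    finrank_euclideanSpace_fin (𝕜 := ℝ) (n := n)
  let L : Eucl n ≃ₗᵢ[ℝ] TangentSpace (𝓡 n) p :=
    ((stdOrthonormalBasis ℝ (TangentSpace (𝓡 n) p)).reindex (finCongr hdim)).repr.symm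
  have hL : ∀ y ∈ Metric.ball (0 : Eucl n) R, ‖L y‖ₑ < R₀ := by
    intro y hy
    rw [mem_ball_zero_iff] at hy
    rw [← ofReal_norm, L.norm_map]
    refine lt_of_le_of_lt ?_ hR2
    rw [← ENNReal.ofReal_coe_nnreal]
    exact ENNReal.ofReal_le_ofReal hy.le
  have hopen : IsOpen {v : TangentSpace (𝓡 n) p | ‖v‖ₑ < R₀} :=
    isOpen_lt continuous_enorm continuous_const
  have hLd : ContMDiff (𝓡 n) 𝓘(ℝ, TangentSpace (𝓡 n) p) ∞ L :=
    L.toContinuousLinearEquiv.contDiff.contMDiff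
  have hmL : ∀ y v : Eucl n, mfderiv (𝓡 n) 𝓘(ℝ, TangentSpace (𝓡 n) p) L y v = L v := by
    intro y v
    rw [mfderiv_eq_fderiv]
    exact congrArg (fun T : Eucl n →L[ℝ] TangentSpace (𝓡 n) p ↦ T v)
      L.toContinuousLinearEquiv.fderiv
  have hreg : IsRegularOn (e ∘ L) (Metric.ball 0 R) := by
    refine ⟨Metric.isOpen_ball, hes.comp hLd.contMDiffOn hL, fun y hy ↦ ?_⟩
    have h1 : MDifferentiableAt 𝓘(ℝ, TangentSpace (𝓡 n) p) (𝓡 n) e (L y) :=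
      (hes.contMDiffAt (hopen.mem_nhds (hL y hy))).mdifferentiableAt (by simp)
    have h2 : MDifferentiableAt (𝓡 n) 𝓘(ℝ, TangentSpace (𝓡 n) p) L y :=
      hLd.mdifferentiableAt (by simp)
    rw [mfderiv_comp y h1 h2]
    intro v w hvw
    have h4 := hed _ (hL y hy) hvw
    exact L.injective ((hmL y v).symm.trans (h4.trans (hmL y w)))
  have hball0 : (0 : Eucl n) ∈ Metric.ball (0 : Eucl n) R :=
    Metric.mem_ball_self (ht.trans htR)
  have he0 : (e ∘ L) 0 = p := by simpa using (he 0).2.1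
  have hK : ∀ (v : Eucl n) (s : ℝ), s • v ∈ Metric.ball (0 : Eucl n) R →
      ∀ z, chrisL (pullMetric n (e ∘ L)) (s • v) v v z = 0 := by
    intro v s hs z
    have h1 := (he (L v)).1
    have h2 : (fun s : ℝ ↦ e (s • L v)) = fun s : ℝ ↦ (e ∘ L) (s • v) := by
      ext s; simp
    rw [h2] at h1
    refine chrisL_eq_zero_of_isGeodesicOn hreg h1 ?_ hs z
    have := hL _ hs
    rwa [map_smul] at this
  -- the differential of the exponential map at the origin is the identity
  have hm0 : ∀ v : Eucl n, mfderiv (𝓡 n) (𝓡 n) (e ∘ L) 0 v = (L v : Eucl n) := by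
    intro v
    have hsrc : (e ∘ L) 0 ∈ (extChartAt (𝓡 n) p).source := by
      rw [he0]; exact mem_extChartAt_source p
    have h1 := (he (L v)).2.2
    have h2 : HasDerivAt (fun s : ℝ ↦ (extChartAt (𝓡 n) p ∘ (e ∘ L)) (s • v))
        (fderiv ℝ (extChartAt (𝓡 n) p ∘ (e ∘ L)) 0 v) 0 := by
      have h3 : HasDerivAt (fun s : ℝ ↦ s • v) v 0 := by
        simpa using (hasDerivAt_id (0 : ℝ)).smul_const v
      have h4 : HasFDerivAt (extChartAt (𝓡 n) p ∘ (e ∘ L))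
          (fderiv ℝ (extChartAt (𝓡 n) p ∘ (e ∘ L)) 0) ((0 : ℝ) • v) := by
        rw [zero_smul]
        exact ((contDiffAt_chart_comp hreg hball0 hsrc).differentiableAt (by simp)).hasFDerivAt
      exact h4.comp_hasDerivAt (0 : ℝ) h3
    have h5 : (fun s : ℝ ↦ extChartAt (𝓡 n) p (e (s • L v))) =
        fun s : ℝ ↦ (extChartAt (𝓡 n) p ∘ (e ∘ L)) (s • v) := by
      ext s; simp
    rw [h5, h2.deriv] at h1
    have h6 := mfderiv_eq_comp_fderiv hreg hball0 hsrc v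
    rw [h1] at h6
    have h7 := mfderivWithin_extChartAt_symm_comp_mfderiv_extChartAt' (I := 𝓡 n)
      (mem_extChartAt_source (I := 𝓡 n) p)
    rw [ModelWithCorners.range_eq_univ, mfderivWithin_univ] at h7
    have h8 := congrArg (fun q : M ↦ (mfderiv (𝓡 n) (𝓡 n) (extChartAt (𝓡 n) p).symm
      (extChartAt (𝓡 n) p q) : Eucl n →L[ℝ] Eucl n) (coords n (L v))) he0
    exact h6.trans (h8.trans (congrArg (fun T : Eucl n →L[ℝ] Eucl n ↦ T (L v)) h7))
  have h0 : ∀ v w, pullMetric n (e ∘ L) 0 v w = inner ℝ v w := by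
    intro v w
    rw [pullMetric_apply, hm0, hm0]
    refine (inner_congr (n := n) he0 _ _).trans ?_
    exact L.inner_map_map v w
  refine ⟨e ∘ L, he0, hreg.contMDiffOn, ?_, hreg.immersion, fun y hy v ↦ ?_⟩
  · exact hei.comp L.injective.injOn hL
  · exact gauss_lemma (fun y hy ↦ (hreg.contDiffAt_metric hy).differentiableAt (by simp))
      (fun y _ ↦ pullMetric_symm n _ y) h0 hK hy v

end Existence

/-! ### Geodesic balls in normal coordinates -/

section Inverse

variable {n : ℕ} {M : Type*} [EMetricSpace M] [ChartedSpace (Eucl n) M]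
  [RiemannianBundle (fun x : M ↦ TangentSpace (𝓡 n) x)]
  [IsManifold (𝓡 n) ∞ M]
  [IsContMDiffRiemannianBundle (𝓡 n) ∞ (EuclideanSpace ℝ (Fin n))
      (fun x : M ↦ TangentSpace (𝓡 n) x)]

variable {F : Eucl n → M} {U : Set (Eucl n)} {y : Eucl n}

/-- The inverse function theorem for the parametrization `F`. -/
theorem IsRegularOn.exists_localInverse (h : IsRegularOn F U) (hy : y ∈ U) :
    ∃ G : M → Eucl n, ContMDiffAt (𝓡 n) (𝓡 n) ∞ G (F y) ∧ G (F y) = y ∧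
      ∀ᶠ x in nhds (F y), F (G x) = x := by
  have hsrc : F y ∈ (extChartAt (𝓡 n) (F y)).source := mem_extChartAt_source _
  set Φ := extChartAt (𝓡 n) (F y) ∘ F with hΦ
  have hΦd : ContDiffAt ℝ ∞ Φ y := contDiffAt_chart_comp h hy hsrc
  obtain ⟨Φ', hΦ'⟩ := isInvertible_fderiv_chart h hy hsrc
  have hd : HasFDerivAt Φ (Φ' : Eucl n →L[ℝ] Eucl n) y := by
    rw [hΦ']; exact (hΦd.differentiableAt (by simp)).hasFDerivAt
  have hn : (∞ : WithTop ℕ∞) ≠ 0 := by simp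
  set ι := hΦd.localInverse hd hn with hι
  have hι1 : ι (Φ y) = y := hΦd.localInverse_apply_image hd hn
  have hι2 : ContDiffAt ℝ ∞ ι (Φ y) := hΦd.to_localInverse hd hn
  have hι3 : ∀ᶠ z in nhds (Φ y), Φ (ι z) = z :=
    (hΦd.hasStrictFDerivAt' hd hn).eventually_right_inverse
  have hc : ContMDiffAt (𝓡 n) (𝓡 n) ∞ (ι ∘ extChartAt (𝓡 n) (F y)) (F y) :=
    hι2.contMDiffAt.comp (F y) contMDiffAt_extChartAt
  refine ⟨ι ∘ extChartAt (𝓡 n) (F y), hc, hι1, ?_⟩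
  have hG : ContinuousAt (F ∘ (ι ∘ extChartAt (𝓡 n) (F y))) (F y) := by
    refine ContinuousAt.comp ?_ hc.continuousAt
    have : (ι ∘ extChartAt (𝓡 n) (F y)) (F y) = y := hι1
    rw [this]
    exact (h.contMDiffAt hy).continuousAt
  have hs := (isOpen_extChartAt_source (I := 𝓡 n) (F y)).mem_nhds hsrc
  have hG' : ∀ᶠ x in nhds (F y), (F ∘ (ι ∘ extChartAt (𝓡 n) (F y))) x ∈
      (extChartAt (𝓡 n) (F y)).source := by
    apply hG.eventually_mem
    have : (F ∘ (ι ∘ extChartAt (𝓡 n) (F y))) (F y) = F y := congrArg F hι1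
    rw [this]
    exact hs
  filter_upwards [hs, hG', (continuousAt_extChartAt (I := 𝓡 n) (F y)).eventually hι3]
    with x hx1 hx2 hx3
  exact (extChartAt (𝓡 n) (F y)).injOn hx2 hx1 hx3

theorem IsRegularOn.image_mem_nhds (h : IsRegularOn F U) (hy : y ∈ U) {V : Set (Eucl n)}
    (hV : V ∈ nhds y) : F '' V ∈ nhds (F y) := by
  obtain ⟨G, hG1, hG2, hG3⟩ := h.exists_localInverse hy
  filter_upwards [hG3, hG1.continuousAt.preimage_mem_nhds (hG2.symm ▸ hV)] with x hx1 hx2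
  exact ⟨G x, hx2, hx1⟩

theorem IsRegularOn.isOpen_image (h : IsRegularOn F U) {V : Set (Eucl n)} (hV : IsOpen V)
    (hVU : V ⊆ U) : IsOpen (F '' V) := by
  rw [isOpen_iff_mem_nhds]
  rintro _ ⟨y, hy, rfl⟩
  exact h.image_mem_nhds (hVU hy) (hV.mem_nhds hy)

/-- The inverse of an injective parametrization. -/
theorem IsRegularOn.contMDiffAt_invFunOn (h : IsRegularOn F U) (hi : Set.InjOn F U)
    (hy : y ∈ U) : ContMDiffAt (𝓡 n) (𝓡 n) ∞ (Function.invFunOn F U) (F y) := by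
  obtain ⟨G, hG1, hG2, hG3⟩ := h.exists_localInverse hy
  refine hG1.congr_of_eventuallyEq ?_
  filter_upwards [hG3, hG1.continuousAt.preimage_mem_nhds (hG2.symm ▸ h.isOpen.mem_nhds hy)]
    with x hx1 hx2
  conv_lhs => rw [← hx1]
  exact hi.leftInvOn_invFunOn hx2

end Inverse

section Dist

variable {n : ℕ} {M : Type*} [EMetricSpace M] [ChartedSpace (Eucl n) M]
  [RiemannianBundle (fun x : M ↦ TangentSpace (𝓡 n) x)]
  [IsManifold (𝓡 n) ∞ M]
  [IsContMDiffRiemannianBundle (𝓡 n) ∞ (EuclideanSpace ℝ (Fin n))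
      (fun x : M ↦ TangentSpace (𝓡 n) x)]
  [IsRiemannianManifold (𝓡 n) M]

/-- A `C¹` function whose differential has norm at most `1` is `1`-Lipschitz. -/
theorem ofReal_sub_le_edist {f : M → ℝ} (hf : ContMDiff (𝓡 n) 𝓘(ℝ) 1 f)
    (hb : ∀ x, ‖grad n f x‖ ≤ 1) (x y : M) :
    ENNReal.ofReal (f y - f x) ≤ edist x y := by
  rw [IsRiemannianManifold.out (I := 𝓡 n) x y]
  refine le_of_forall_gt fun r hr ↦ ?_
  obtain ⟨γ, h0, h1, hγ, hlen, -⟩ :=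
    exists_lt_locally_constant_of_riemannianEDist_lt hr zero_lt_one
  have hfγ : ContDiff ℝ 1 (f ∘ γ) := contMDiff_iff_contDiff.1 (hf.comp hγ)
  have hint : ∫ s in (0 : ℝ)..1, deriv (f ∘ γ) s = f y - f x := by
    rw [intervalIntegral.integral_deriv_eq_sub]
    · simp [h0, h1]
    · exact fun s _ ↦ hfγ.differentiable (by simp) s
    · exact (hfγ.continuous_deriv le_rfl).intervalIntegrable _ _
  refine lt_of_le_of_lt ?_ hlen
  calc ENNReal.ofReal (f y - f x) ≤ ‖f y - f x‖ₑ := by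
        rw [Real.enorm_eq_ofReal_abs]; exact ENNReal.ofReal_le_ofReal (le_abs_self _)
    _ ≤ ∫⁻ s in Set.Ioc (0 : ℝ) 1, ‖deriv (f ∘ γ) s‖ₑ := by
        rw [← hint, intervalIntegral.integral_of_le zero_le_one]
        exact enorm_integral_le_lintegral_enorm _
    _ ≤ ∫⁻ s in Set.Icc (0 : ℝ) 1, ‖deriv (f ∘ γ) s‖ₑ :=
        lintegral_mono_set Set.Ioc_subset_Icc_self
    _ ≤ pathELength (𝓡 n) γ 0 1 := by
        rw [pathELength]
        refine lintegral_mono fun s ↦ ?_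
        have h2 := mfderiv_comp s (hf.mdifferentiable (by simp) (γ s))
          (hγ.mdifferentiable (by simp) s)
        rw [mfderiv_eq_fderiv] at h2
        have h3 : deriv (f ∘ γ) s = inner ℝ (grad n f (γ s)) (mfderiv 𝓘(ℝ) (𝓡 n) γ s 1) := by
          rw [← fderiv_apply_one_eq_deriv]
          exact (congrArg (fun L : ℝ →L[ℝ] ℝ ↦ L 1) h2).trans (inner_grad n f (γ s) _).symm
        rw [h3, Real.enorm_eq_ofReal_abs, ← ofReal_norm]
        refine ENNReal.ofReal_le_ofReal ((abs_real_inner_le_norm _ _).trans ?_)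
        exact mul_le_of_le_one_left (norm_nonneg _) (hb _)

variable {p : M} {R : ℝ} {F : Eucl n → M}

/-- By the Gauss lemma, the ray from `p` to `F y` has length `‖y‖`. -/
theorem IsNormalChart.edist_le (h : IsNormalChart p R F) {y : Eucl n}
    (hy : y ∈ Metric.ball (0 : Eucl n) R) : edist (F y) p ≤ ENNReal.ofReal ‖y‖ := by
  have hmem : ∀ s ∈ Set.Icc (0 : ℝ) 1, s • y ∈ Metric.ball (0 : Eucl n) R := by
    intro s hs
    rw [mem_ball_zero_iff] at hy ⊢
    calc ‖s • y‖ = s * ‖y‖ := by rw [norm_smul, Real.norm_of_nonneg hs.1]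
      _ ≤ 1 * ‖y‖ := by gcongr; exact hs.2
      _ < R := by simpa using hy
  have hray : ContDiff ℝ 1 (fun s : ℝ ↦ s • y) := by fun_prop
  rw [edist_comm, IsRiemannianManifold.out (I := 𝓡 n)]
  have hF1 : ContMDiffOn (𝓡 n) (𝓡 n) 1 F (Metric.ball 0 R) :=
    h.contMDiffOn.of_le (WithTop.coe_le_coe.2 le_top)
  have hγ : ContMDiffOn 𝓘(ℝ) (𝓡 n) 1 (fun s : ℝ ↦ F (s • y)) (Set.Icc 0 1) :=
    hF1.comp hray.contMDiff.contMDiffOn hmem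
  refine (riemannianEDist_le_pathELength hγ (by simp [h.map_zero]) (by simp)
    zero_le_one).trans ?_
  rw [pathELength_eq_lintegral_mfderiv_Ioo]
  calc ∫⁻ s in Set.Ioo (0 : ℝ) 1, ‖mfderiv 𝓘(ℝ) (𝓡 n) (fun s : ℝ ↦ F (s • y)) s 1‖ₑ
      = ∫⁻ s in Set.Ioo (0 : ℝ) 1, ENNReal.ofReal ‖y‖ := by
        refine setLIntegral_congr_fun measurableSet_Ioo fun s hs ↦ ?_
        have hsy := hmem s ⟨hs.1.le, hs.2.le⟩
        have h1 := mfderiv_comp (f := fun s : ℝ ↦ s • y) s (h.isRegularOn.mdifferentiableAt hsy)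
          (hray.contMDiff.mdifferentiable (by simp) s)
        have h2 : mfderiv 𝓘(ℝ) (𝓡 n) (fun s : ℝ ↦ F (s • y)) s 1 =
            mfderiv (𝓡 n) (𝓡 n) F (s • y) y := by
          have h3 : fderiv ℝ (fun s : ℝ ↦ s • y) s 1 = y := by
            have : HasDerivAt (fun s : ℝ ↦ s • y) y s := by
              simpa using (hasDerivAt_id s).smul_const y
            rw [fderiv_apply_one_eq_deriv, this.deriv]
          refine (congrArg (fun L : ℝ →L[ℝ] Eucl n ↦ L 1) h1).trans ?_
          rw [mfderiv_eq_fderiv]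
          exact congrArg (fun w : Eucl n ↦ (mfderiv (𝓡 n) (𝓡 n) F (s • y) :
            Eucl n →L[ℝ] Eucl n) w) h3
        have h4 : ‖mfderiv (𝓡 n) (𝓡 n) F (s • y) y‖ = ‖y‖ := by
          have h5 := h.gauss _ hsy y
          rw [map_smul, smul_apply, inner_smul_left, smul_eq_mul] at h5
          have h6 := mul_left_cancel₀ hs.1.ne' h5
          rw [pullMetric_apply, real_inner_self_eq_norm_sq, real_inner_self_eq_norm_sq] at h6
          exact (sq_eq_sq₀ (norm_nonneg _) (norm_nonneg _)).1 h6
        rw [h2, ← ofReal_norm, h4]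
    _ ≤ ENNReal.ofReal ‖y‖ := by simp

/-- By the Gauss lemma, the gradient of a radial function in normal coordinates is its Euclidean
gradient, with the same norm. -/
theorem grad_eq_of_radial (h : IsNormalChart p R F) {y : Eucl n}
    (hy : y ∈ Metric.ball (0 : Eucl n) R) {f : M → ℝ}
    (hf : MDifferentiableAt (𝓡 n) 𝓘(ℝ) f (F y)) {κ : ℝ}
    (hκ : ∀ w, fderiv ℝ (f ∘ F) y w = κ * inner ℝ y w) :
    gradOf (pullMetric n F) (f ∘ F) y = κ • y ∧ ‖grad n f (F y)‖ = |κ| * ‖y‖ := by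
  have h1 : gradOf (pullMetric n F) (f ∘ F) y = κ • y := by
    apply bilin_injective (h.isRegularOn.isInvertible_metric hy)
    ext w
    rw [bilin_gradOf (h.isRegularOn.isInvertible_metric hy), hκ, map_smul, smul_apply,
      h.gauss y hy, smul_eq_mul]
  refine ⟨h1, ?_⟩
  have h5 := congrArg (fun w : Eucl n ↦ (mfderiv (𝓡 n) (𝓡 n) F y : Eucl n →L[ℝ] Eucl n) w) h1
  have h6 : grad n f (F y) = mfderiv (𝓡 n) (𝓡 n) F y (κ • y) :=
    (grad_eq h.isRegularOn hy hf).trans h5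
  rw [h6]
  have h2 := h.gauss y hy y
  rw [pullMetric_apply, real_inner_self_eq_norm_sq, real_inner_self_eq_norm_sq] at h2
  have h3 := (sq_eq_sq₀ (norm_nonneg _) (norm_nonneg _)).1 h2
  have h4 : mfderiv (𝓡 n) (𝓡 n) F y (κ • y) = κ • mfderiv (𝓡 n) (𝓡 n) F y y := map_smul _ _ _
  rw [h4, norm_smul, h3, Real.norm_eq_abs]

/-- Lower bounds for the distance from `p`. They come from the function `θ(√(ε² + |y|²))`, where the
radius is smoothed at the origin by `ε` and truncated by `θ` between `a` and `b`, so that it extends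
by a constant to all of `M`; its gradient has norm at most `1`. -/
theorem IsNormalChart.sub_le_edist (h : IsNormalChart p R F) {ε a b : ℝ} (hε : 0 < ε)
    (hεa : ε ≤ a) (hab : a < b) (hbR : b < R) :
    (∀ y ∈ Metric.ball (0 : Eucl n) R, Real.sqrt (ε ^ 2 + ‖y‖ ^ 2) ≤ a →
      ENNReal.ofReal (Real.sqrt (ε ^ 2 + ‖y‖ ^ 2) - ε) ≤ edist (F y) p) ∧
    ∀ x ∉ F '' Metric.ball (0 : Eucl n) R, ENNReal.ofReal (a - ε) ≤ edist x p := by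
  classical
  have hR : 0 < R := by linarith
  have h0 : (0 : Eucl n) ∈ Metric.ball (0 : Eucl n) R := Metric.mem_ball_self hR
  -- a `C¹` function `θ` with `0 ≤ θ' ≤ 1` that is the identity on `[0, a]` and constant beyond `b`
  set k : ℝ → ℝ := fun τ ↦ max 0 (min 1 ((b - τ) / (b - a))) with hk
  have hkc : Continuous k := by fun_prop
  have hk0 : ∀ τ, 0 ≤ k τ := fun τ ↦ le_max_left _ _
  have hk1 : ∀ τ, k τ ≤ 1 := fun τ ↦ max_le zero_le_one (min_le_left _ _)
  have hka : ∀ τ ≤ a, k τ = 1 := by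
    intro τ hτ
    have : 1 ≤ (b - τ) / (b - a) := by rw [one_le_div (by linarith)]; linarith
    simp [hk, this]
  have hkb : ∀ τ, b ≤ τ → k τ = 0 := by
    intro τ hτ
    have : (b - τ) / (b - a) ≤ 0 := div_nonpos_of_nonpos_of_nonneg (by linarith) (by linarith)
    simp [hk, this]
  set θ : ℝ → ℝ := fun s ↦ ∫ τ in (0 : ℝ)..s, k τ with hθ
  have hθd : ∀ s, HasDerivAt θ (k s) s := fun s ↦ hkc.integral_hasStrictDerivAt 0 s |>.hasDerivAt
  have hθC : ContDiff ℝ 1 θ := by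
    rw [contDiff_one_iff_deriv]
    refine ⟨fun s ↦ (hθd s).differentiableAt, ?_⟩
    have : deriv θ = k := funext fun s ↦ (hθd s).deriv
    rwa [this]
  have hθa : ∀ s, 0 ≤ s → s ≤ a → θ s = s := by
    intro s hs0 hsa
    have : θ s = ∫ τ in (0 : ℝ)..s, (1 : ℝ) := by
      refine intervalIntegral.integral_congr fun τ hτ ↦ ?_
      rw [Set.uIcc_of_le hs0] at hτ
      exact hka τ (hτ.2.trans hsa)
    simp [this]
  have hθm : Monotone θ :=
    monotone_of_deriv_nonneg (fun s ↦ (hθd s).differentiableAt) fun s ↦ by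
      rw [(hθd s).deriv]; exact hk0 s
  have hθb : ∀ s, b ≤ s → θ s = θ b := by
    intro s hs
    have h1 : θ s = θ b + ∫ τ in b..s, k τ :=
      (intervalIntegral.integral_add_adjacent_intervals (hkc.intervalIntegrable _ _)
        (hkc.intervalIntegrable _ _)).symm
    have h2 : ∫ τ in b..s, k τ = 0 := by
      have : ∫ τ in b..s, k τ = ∫ τ in b..s, (0 : ℝ) := by
        refine intervalIntegral.integral_congr fun τ hτ ↦ ?_
        rw [Set.uIcc_of_le hs] at hτ
        exact hkb τ hτ.1
      simp [this]
    rw [h1, h2, add_zero]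
  set ρ : Eucl n → ℝ := fun y ↦ Real.sqrt (ε ^ 2 + ‖y‖ ^ 2) with hρ
  have hρpos : ∀ y : Eucl n, 0 < ε ^ 2 + ‖y‖ ^ 2 := fun y ↦ by positivity
  have hρd : ContDiff ℝ 1 ρ :=
    (contDiff_const.add (contDiff_id.norm_sq ℝ)).sqrt fun y ↦ (hρpos y).ne'
  have hρf : ∀ y w, fderiv ℝ ρ y w = (ρ y)⁻¹ * inner ℝ y w := by
    intro y w
    have h1 : HasFDerivAt (fun y : Eucl n ↦ ε ^ 2 + ‖y‖ ^ 2) (2 • innerSL ℝ y) y :=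
      ((hasStrictFDerivAt_norm_sq y).hasFDerivAt).const_add _
    rw [(h1.sqrt (hρpos y).ne').fderiv]
    simp [hρ]
    ring
  have hρn : ∀ y : Eucl n, ‖y‖ ≤ ρ y := fun y ↦ Real.le_sqrt_of_sq_le (by linarith [sq_nonneg ε])
  set inv := Function.invFunOn F (Metric.ball 0 R) with hinv
  have hinvF : ∀ y ∈ Metric.ball (0 : Eucl n) R, inv (F y) = y := fun y hy ↦
    h.injOn.leftInvOn_invFunOn hy
  set f : M → ℝ := fun x ↦ if x ∈ F '' Metric.ball (0 : Eucl n) R then θ (ρ (inv x)) else θ b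
    with hf
  have hfF : ∀ y ∈ Metric.ball (0 : Eucl n) R, f (F y) = θ (ρ y) := by
    intro y hy
    rw [hf]
    simp only
    rw [if_pos (Set.mem_image_of_mem F hy), hinvF y hy]
  have hopen : IsOpen (F '' Metric.ball (0 : Eucl n) R) :=
    h.isRegularOn.isOpen_image Metric.isOpen_ball subset_rfl
  have hsub : Metric.closedBall (0 : Eucl n) b ⊆ Metric.ball 0 R :=
    Metric.closedBall_subset_ball hbR
  have hcl : IsClosed (F '' Metric.closedBall (0 : Eucl n) b) :=
    ((isCompact_closedBall _ _).image_of_continuousOn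
      (h.contMDiffOn.continuousOn.mono hsub)).isClosed
  have hconst : ∀ x ∉ F '' Metric.closedBall (0 : Eucl n) b, f x = θ b := by
    intro x hx
    by_cases hx' : x ∈ F '' Metric.ball (0 : Eucl n) R
    · obtain ⟨y, hy, rfl⟩ := hx'
      rw [hfF y hy]
      have : ¬ ‖y‖ ≤ b := fun hyb ↦ hx ⟨y, by simpa using hyb, rfl⟩
      exact hθb _ (by linarith [hρn y])
    · simp only [hf]
      rw [if_neg hx']
  have hfin : ∀ y ∈ Metric.ball (0 : Eucl n) R, ContMDiffAt (𝓡 n) 𝓘(ℝ) 1 f (F y) := by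
    intro y hy
    have h1 : ContMDiffAt (𝓡 n) 𝓘(ℝ) 1 ((θ ∘ ρ) ∘ inv) (F y) :=
      ((hθC.comp hρd).contMDiff.contMDiffAt).comp (F y)
        ((h.isRegularOn.contMDiffAt_invFunOn h.injOn hy).of_le (WithTop.coe_le_coe.2 le_top))
    refine h1.congr_of_eventuallyEq ?_
    filter_upwards [hopen.mem_nhds (Set.mem_image_of_mem F hy)] with x hx
    simp only [hf]
    rw [if_pos hx]
    rfl
  have hout : ∀ x ∉ F '' Metric.ball (0 : Eucl n) R, f =ᶠ[nhds x] fun _ ↦ θ b := by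
    intro x hx
    filter_upwards [hcl.isOpen_compl.mem_nhds fun hx' ↦ hx (Set.image_mono hsub hx')] with z hz
    exact hconst z hz
  have hfC : ContMDiff (𝓡 n) 𝓘(ℝ) 1 f := by
    intro x
    by_cases hx : x ∈ F '' Metric.ball (0 : Eucl n) R
    · obtain ⟨y, hy, rfl⟩ := hx
      exact hfin y hy
    · exact contMDiffAt_const.congr_of_eventuallyEq (hout x hx)
  have hgrad : ∀ x, ‖grad n f x‖ ≤ 1 := by
    intro x
    by_cases hx : x ∈ F '' Metric.ball (0 : Eucl n) R
    · obtain ⟨y, hy, rfl⟩ := hx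
      have h1 : f ∘ F =ᶠ[nhds y] θ ∘ ρ := by
        filter_upwards [Metric.isOpen_ball.mem_nhds hy] with z hz
        exact hfF z hz
      have h2 : ∀ w, fderiv ℝ (f ∘ F) y w = (k (ρ y) * (ρ y)⁻¹) * inner ℝ y w := by
        intro w
        have h3 : HasFDerivAt (θ ∘ ρ) _ y := (hθd (ρ y)).comp_hasFDerivAt y
          (hρd.differentiable (by simp) y).hasFDerivAt
        rw [h1.fderiv_eq, h3.fderiv, smul_apply, hρf, smul_eq_mul]
        ring
      have hρy : 0 < ρ y := Real.sqrt_pos.2 (hρpos y)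
      rw [(grad_eq_of_radial h hy ((hfin y hy).mdifferentiableAt (by simp)) h2).2,
        abs_of_nonneg (mul_nonneg (hk0 _) (inv_nonneg.2 hρy.le)), mul_assoc]
      refine mul_le_one₀ (hk1 _) (by positivity) ?_
      rw [inv_mul_le_one₀ hρy]
      exact hρn y
    · have h1 : grad n f x = 0 := by
        refine ext_inner_right ℝ fun v ↦ ?_
        rw [inner_grad, (hout x hx).mfderiv_eq, mfderiv_const, inner_zero_left]
        rfl
      rw [h1, norm_zero]
      exact zero_le_one
  have hfp : f p = ε := by
    rw [← h.map_zero, hfF 0 h0]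
    have : ρ 0 = ε := by simp [hρ, Real.sqrt_sq hε.le]
    rw [this, hθa ε hε.le hεa]
  refine ⟨fun y hy hya ↦ ?_, fun x hx ↦ ?_⟩
  · have := ofReal_sub_le_edist hfC hgrad p (F y)
    rw [hfp, hfF y hy, hθa _ (Real.sqrt_nonneg _) hya] at this
    rwa [edist_comm]
  · have h1 := ofReal_sub_le_edist hfC hgrad p x
    rw [hfp, (hout x hx).self_of_nhds] at h1
    rw [edist_comm]
    refine le_trans (ENNReal.ofReal_le_ofReal ?_) h1
    have := hθm hab.le
    rw [hθa a (by linarith) le_rfl] at this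
    linarith

theorem IsNormalChart.edist_eq (h : IsNormalChart p R F) {y : Eucl n}
    (hy : y ∈ Metric.ball (0 : Eucl n) R) : edist (F y) p = ENNReal.ofReal ‖y‖ := by
  refine le_antisymm (h.edist_le hy) ?_
  rw [mem_ball_zero_iff] at hy
  refine ENNReal.le_of_forall_pos_le_add fun ε hε _ ↦ ?_
  -- `δ` is the smoothing parameter; the last condition leaves room for the truncation
  obtain ⟨δ, hδ0, hδ1, hδ2⟩ : ∃ δ : ℝ, 0 < δ ∧ δ ≤ ε ∧ δ + ‖y‖ < (‖y‖ + R) / 2 := by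
    refine ⟨min ε ((R - ‖y‖) / 4), lt_min (by exact_mod_cast hε) (by linarith),
      min_le_left _ _, ?_⟩
    linarith [min_le_right (ε : ℝ) ((R - ‖y‖) / 4)]
  have h1 : Real.sqrt (δ ^ 2 + ‖y‖ ^ 2) ≤ δ + ‖y‖ :=
    Real.sqrt_le_iff.2 ⟨by positivity, by nlinarith [norm_nonneg y]⟩
  have h2 : ‖y‖ ≤ Real.sqrt (δ ^ 2 + ‖y‖ ^ 2) := Real.le_sqrt_of_sq_le (by nlinarith)
  have h3 := (h.sub_le_edist (a := δ + ‖y‖) (b := (‖y‖ + R) / 2) hδ0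
    (by linarith [norm_nonneg y]) hδ2 (by linarith)).1 y (by simpa using hy) h1
  calc ENNReal.ofReal ‖y‖ ≤ ENNReal.ofReal (Real.sqrt (δ ^ 2 + ‖y‖ ^ 2) - δ + ε) :=
        ENNReal.ofReal_le_ofReal (by linarith)
    _ ≤ ENNReal.ofReal (Real.sqrt (δ ^ 2 + ‖y‖ ^ 2) - δ) + ENNReal.ofReal ε :=
        ENNReal.ofReal_add_le
    _ ≤ edist (F y) p + ε := by
        rw [ENNReal.ofReal_coe_nnreal]
        gcongr

/-- Points outside the range of the normal coordinates are further away from `p` than any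
`t < R`. -/
theorem IsNormalChart.lt_edist (h : IsNormalChart p R F) {t : ℝ} (ht : 0 < t) (htR : t < R)
    {x : M} (hx : x ∉ F '' Metric.ball (0 : Eucl n) R) : ENNReal.ofReal t < edist x p := by
  have h1 := (h.sub_le_edist (ε := (R - t) / 8) (a := t + (R - t) / 4) (b := (t + R) / 2)
    (by linarith) (by linarith) (by linarith) (by linarith)).2 x hx
  refine lt_of_lt_of_le ?_ h1
  rw [ENNReal.ofReal_lt_ofReal_iff (by linarith)]
  linarith

theorem IsNormalChart.distFrom_eq (h : IsNormalChart p R F) {y : Eucl n}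
    (hy : y ∈ Metric.ball (0 : Eucl n) R) : distFrom p (F y) = ‖y‖ := by
  rw [distFrom, h.edist_eq hy, ENNReal.toReal_ofReal (norm_nonneg _)]

theorem IsNormalChart.geodBall_eq (h : IsNormalChart p R F) {t : ℝ} (ht : 0 < t) (htR : t < R) :
    geodBall p t = F '' Metric.ball 0 t := by
  ext x
  constructor
  · intro hx
    by_contra hx'
    by_cases hxR : x ∈ F '' Metric.ball (0 : Eucl n) R
    · obtain ⟨y, hy, rfl⟩ := hxR
      rw [geodBall, Set.mem_ofPred_eq, h.edist_eq hy, ENNReal.ofReal_lt_ofReal_iff ht] at hx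
      exact hx' ⟨y, by simpa using hx, rfl⟩
    · exact lt_asymm hx (h.lt_edist ht htR hxR)
  · rintro ⟨y, hy, rfl⟩
    have hyt : ‖y‖ < t := by simpa using hy
    rw [geodBall, Set.mem_ofPred_eq, h.edist_eq (Metric.ball_subset_ball htR.le hy),
      ENNReal.ofReal_lt_ofReal_iff ht]
    exact hyt

theorem IsNormalChart.closedBall_eq (h : IsNormalChart p R F) {t : ℝ} (ht : 0 < t)
    (htR : t < R) :
    {x : M | edist x p ≤ ENNReal.ofReal t} = F '' Metric.closedBall 0 t := by
  ext x
  constructor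
  · intro hx
    by_contra hx'
    by_cases hxR : x ∈ F '' Metric.ball (0 : Eucl n) R
    · obtain ⟨y, hy, rfl⟩ := hxR
      rw [Set.mem_ofPred_eq, h.edist_eq hy, ENNReal.ofReal_le_ofReal_iff ht.le] at hx
      exact hx' ⟨y, by simpa using hx, rfl⟩
    · exact not_lt_of_ge hx (h.lt_edist ht htR hxR)
  · rintro ⟨y, hy, rfl⟩
    have hyt : ‖y‖ ≤ t := by simpa using hy
    rw [Set.mem_ofPred_eq, h.edist_eq (Metric.closedBall_subset_ball htR hy)]
    exact ENNReal.ofReal_le_ofReal hyt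

theorem IsNormalChart.geodSphere_eq (h : IsNormalChart p R F) {t : ℝ} (ht : 0 < t)
    (htR : t < R) : geodSphere p t = F '' Metric.sphere 0 t := by
  have hsub : Metric.closedBall (0 : Eucl n) t ⊆ Metric.ball 0 R :=
    Metric.closedBall_subset_ball htR
  have hcont : ContinuousOn F (Metric.closedBall 0 t) := h.contMDiffOn.continuousOn.mono hsub
  have hopen : IsOpen (geodBall p t) := by
    rw [h.geodBall_eq ht htR]
    exact h.isRegularOn.isOpen_image Metric.isOpen_ball (Metric.ball_subset_ball htR.le)
  have hcl : closure (F '' Metric.ball (0 : Eucl n) t) = F '' Metric.closedBall 0 t := by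
    apply subset_antisymm
    · exact closure_minimal (Set.image_mono Metric.ball_subset_closedBall)
        ((isCompact_closedBall _ _).image_of_continuousOn hcont).isClosed
    · rw [← closure_ball (0 : Eucl n) ht.ne']
      refine ContinuousOn.image_closure ?_
      rwa [closure_ball (0 : Eucl n) ht.ne']
  rw [geodSphere, frontier, hopen.interior_eq, h.geodBall_eq ht htR, hcl,
    ← Metric.closedBall_sdiff_ball]
  exact ((h.injOn.mono hsub).image_sdiff_subset Metric.ball_subset_closedBall).symm

end Dist

/-! ### The divergence theorem on a Euclidean ball -/

section Polar

variable {E : Type*} [NormedAddCommGroup E] [InnerProductSpace ℝ E] [FiniteDimensional ℝ E]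
  [MeasurableSpace E] [BorelSpace E] [Nontrivial E]

/-- Integration in polar coordinates. -/
theorem integral_polar {f : E → ℝ} (hf : Integrable f) :
    ∫ x, f x = ∫ s in Set.Ioi (0 : ℝ), s ^ (Module.finrank ℝ E - 1) *
      ∫ ξ : Metric.sphere (0 : E) 1, f (s • (ξ : E)) ∂(volume : Measure E).toSphere := by
  have hmp := (volume : Measure E).measurePreserving_homeomorphUnitSphereProd
  have hcomp : (fun q : Metric.sphere (0 : E) 1 × Set.Ioi (0 : ℝ) ↦ f (q.2.1 • (q.1 : E))) ∘
      homeomorphUnitSphereProd E = fun x : ({0}ᶜ : Set E) ↦ f x := by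
    ext x
    have hx : ‖(x : E)‖ ≠ 0 := norm_ne_zero_iff.2 x.2
    simp [smul_smul, mul_inv_cancel₀ hx]
  have hint : Integrable (fun q : Metric.sphere (0 : E) 1 × Set.Ioi (0 : ℝ) ↦
      f (q.2.1 • (q.1 : E))) ((volume : Measure E).toSphere.prod
        (Measure.volumeIoiPow (Module.finrank ℝ E - 1))) := by
    rw [← hmp.integrable_comp_emb (Homeomorph.measurableEmbedding _), hcomp]
    exact (integrableOn_iff_comap_subtypeVal (measurableSet_singleton _).compl).1
      (hf.integrableOn (s := {0}ᶜ))
  calc ∫ x, f x = ∫ x : ({0}ᶜ : Set E), f x ∂((volume : Measure E).comap (↑)) := by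
        rw [integral_subtype_comap (measurableSet_singleton _).compl f,
          restrict_compl_singleton]
    _ = ∫ q, f (q.2.1 • (q.1 : E)) ∂((volume : Measure E).toSphere.prod
          (Measure.volumeIoiPow (Module.finrank ℝ E - 1))) := by
        rw [← hmp.integral_comp (Homeomorph.measurableEmbedding _)]
        exact integral_congr_ae (.of_forall fun x ↦ (congrFun hcomp x).symm)
    _ = ∫ s : Set.Ioi (0 : ℝ), (∫ ξ : Metric.sphere (0 : E) 1, f (s.1 • (ξ : E))
          ∂(volume : Measure E).toSphere)
          ∂(Measure.volumeIoiPow (Module.finrank ℝ E - 1)) := integral_prod_symm _ hint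
    _ = _ := by
        simp only [Measure.volumeIoiPow, ENNReal.ofReal]
        rw [integral_withDensity_eq_integral_smul,
          integral_subtype_comap measurableSet_Ioi fun a ↦
            Real.toNNReal (a ^ (Module.finrank ℝ E - 1)) •
            ∫ ξ : Metric.sphere (0 : E) 1, f (a • (ξ : E)) ∂(volume : Measure E).toSphere,
          setIntegral_congr_fun measurableSet_Ioi fun x hx ↦ ?_]
        · rw [NNReal.smul_def, Real.coe_toNNReal _ (pow_nonneg hx.out.le _), smul_eq_mul]
        · exact (measurable_subtype_coe.pow_const _).real_toNNReal

omit [Nontrivial E] in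
theorem continuousOn_integral_sphere {f : E → ℝ} {t : ℝ}
    (hf : ContinuousOn f (Metric.closedBall 0 t)) :
    ContinuousOn (fun s : ℝ ↦ ∫ ξ : Metric.sphere (0 : E) 1, f (s • (ξ : E))
      ∂(volume : Measure E).toSphere) (Set.Icc 0 t) := by
  obtain ⟨C, hC⟩ := (isCompact_closedBall (0 : E) t).exists_bound_of_continuousOn hf
  have hmem : ∀ s ∈ Set.Icc 0 t, ∀ ξ : Metric.sphere (0 : E) 1,
      s • (ξ : E) ∈ Metric.closedBall (0 : E) t := by
    intro s hs ξ
    have h1 : ‖(ξ : E)‖ = 1 := by simp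
    simp [norm_smul, h1, abs_of_nonneg hs.1, hs.2]
  refine continuousOn_of_dominated (bound := fun _ ↦ C) ?_ ?_ (integrable_const _) ?_
  · intro s hs
    refine (ContinuousOn.comp_continuous hf (by fun_prop) (hmem s hs)).aestronglyMeasurable
  · intro s hs
    exact .of_forall fun ξ ↦ hC _ (hmem s hs ξ)
  · refine .of_forall fun ξ ↦ ?_
    exact hf.comp (by fun_prop) fun s hs ↦ hmem s hs ξ

end Polar

section Divergence

variable {n : ℕ}

theorem trace_fderiv_eq_sum {Y : Eucl n → Eucl n} {y : Eucl n} (hY : DifferentiableAt ℝ Y y) :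
    LinearMap.trace ℝ (Eucl n) (fderiv ℝ Y y).toLinearMap =
      ∑ i, fderiv ℝ (fun z ↦ Y z i) y (EuclideanSpace.single i 1) := by
  rw [LinearMap.trace_eq_matrix_trace ℝ (EuclideanSpace.basisFun (Fin n) ℝ).toBasis]
  simp only [Matrix.trace, Matrix.diag, LinearMap.toMatrix_apply]
  refine Finset.sum_congr rfl fun i _ ↦ ?_
  have h1 : HasFDerivAt (fun z ↦ Y z i)
      ((EuclideanSpace.proj i : Eucl n →L[ℝ] ℝ).comp (fderiv ℝ Y y)) y :=
    (EuclideanSpace.proj i : Eucl n →L[ℝ] ℝ).hasFDerivAt.comp y hY.hasFDerivAt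
  rw [h1.fderiv]
  simp

/-- Integration by parts against a compactly supported function. -/
theorem integral_mul_trace_fderiv {U : Set (Eucl n)} (hU : IsOpen U) {Y : Eucl n → Eucl n}
    (hY : ContDiffOn ℝ 1 Y U) {χ : Eucl n → ℝ} (hχ : ContDiff ℝ 1 χ)
    (hc : HasCompactSupport χ) (hsub : tsupport χ ⊆ U) :
    Integrable (fun y ↦ fderiv ℝ χ y (Y y)) ∧
    ∫ y, χ y * LinearMap.trace ℝ (Eucl n) (fderiv ℝ Y y).toLinearMap =
      - ∫ y, fderiv ℝ χ y (Y y) := by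
  have hYd : ∀ y ∈ tsupport χ, DifferentiableAt ℝ Y y := fun y hy ↦
    ((hY.contDiffAt (hU.mem_nhds (hsub hy))).differentiableAt (by norm_num))
  have hYid : ∀ i, ∀ y ∈ tsupport χ, DifferentiableAt ℝ (fun z ↦ Y z i) y := fun i y hy ↦
    ((EuclideanSpace.proj i : Eucl n →L[ℝ] ℝ).differentiableAt.comp y (hYd y hy))
  have hYi : ∀ i, ContDiffOn ℝ 1 (fun z ↦ Y z i) U := fun i ↦
    (EuclideanSpace.proj i : Eucl n →L[ℝ] ℝ).contDiff.comp_contDiffOn hY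
  have hi1 : ∀ i, Integrable fun y ↦ χ y * fderiv ℝ (fun z ↦ Y z i) y
      (EuclideanSpace.single i 1) := by
    intro i
    refine Continuous.integrable_of_hasCompactSupport ?_ hc.mul_right
    refine continuous_of_tsupport fun y hy ↦ ?_
    have hy' := hsub (tsupport_mul_subset_left hy)
    refine hχ.continuous.continuousAt.mul ?_
    have := ((hYi i).continuousOn_fderiv_of_isOpen hU (by norm_num)).continuousAt
      (hU.mem_nhds hy')
    exact this.clm_apply continuousAt_const
  have htf : ∀ i, tsupport (fun y ↦ fderiv ℝ χ y (EuclideanSpace.single i (1 : ℝ))) ⊆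
      tsupport χ := by
    intro i
    refine closure_minimal (fun y hy ↦ ?_) (isClosed_tsupport χ)
    by_contra hy'
    apply hy
    have : χ =ᶠ[nhds y] 0 := notMem_tsupport_iff_eventuallyEq.1 hy'
    simp [this.fderiv_eq]
  have hi2 : ∀ i, Integrable fun y ↦ fderiv ℝ χ y (EuclideanSpace.single i 1) * Y y i := by
    intro i
    refine Continuous.integrable_of_hasCompactSupport ?_ (hc.fderiv_apply ℝ _).mul_right
    refine continuous_of_tsupport fun y hy ↦ ?_
    exact ((hχ.continuous_fderiv (by norm_num)).clm_apply continuous_const).continuousAt.mul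
      (hYid i y (htf i (tsupport_mul_subset_left hy))).continuousAt
  have hi3 : ∀ i, Integrable fun y ↦ χ y * Y y i := by
    intro i
    refine Continuous.integrable_of_hasCompactSupport ?_ hc.mul_right
    refine continuous_of_tsupport fun y hy ↦ ?_
    exact hχ.continuous.continuousAt.mul
      (hYid i y (tsupport_mul_subset_left hy)).continuousAt
  have hparts : ∀ i, ∫ y, χ y * fderiv ℝ (fun z ↦ Y z i) y (EuclideanSpace.single i 1) =
      - ∫ y, fderiv ℝ χ y (EuclideanSpace.single i 1) * Y y i := fun i ↦
    integral_mul_fderiv_eq_neg_fderiv_mul_of_integrable (hi2 i) (hi1 i) (hi3 i)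
      (fun y _ ↦ hχ.differentiable (by norm_num) y) (hYid i)
  have e1 : ∀ y, χ y * LinearMap.trace ℝ (Eucl n) (fderiv ℝ Y y).toLinearMap =
      ∑ i, χ y * fderiv ℝ (fun z ↦ Y z i) y (EuclideanSpace.single i 1) := by
    intro y
    by_cases hy : y ∈ tsupport χ
    · rw [trace_fderiv_eq_sum (hYd y hy), Finset.mul_sum]
    · simp [image_eq_zero_of_notMem_tsupport hy]
  have e2 : ∀ y, fderiv ℝ χ y (Y y) =
      ∑ i, fderiv ℝ χ y (EuclideanSpace.single i 1) * Y y i := by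
    intro y
    rw [clm_apply_eq_sum]
    exact Finset.sum_congr rfl fun i _ ↦ mul_comm _ _
  simp only [e1, e2]
  refine ⟨integrable_finsetSum _ fun i _ ↦ hi2 i, ?_⟩
  rw [integral_finsetSum _ fun i _ ↦ hi1 i, integral_finsetSum _ fun i _ ↦ hi2 i,
    ← Finset.sum_neg_distrib]
  exact Finset.sum_congr rfl fun i _ ↦ hparts i

theorem deriv_smoothTransition_eq_zero {x : ℝ} (hx : x ≤ 0 ∨ 1 ≤ x) :
    deriv Real.smoothTransition x = 0 := by
  rcases hx with hx | hx
  · refine IsLocalMin.deriv_eq_zero (.of_forall fun z ↦ ?_)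
    rw [Real.smoothTransition.zero_of_nonpos hx]
    exact Real.smoothTransition.nonneg z
  · refine IsLocalMax.deriv_eq_zero (.of_forall fun z ↦ ?_)
    rw [Real.smoothTransition.one_of_one_le hx]
    exact Real.smoothTransition.le_one z

/-- The derivative, up to sign and a factor `s`, of the radial cutoff that is `1` up to radius `b`
and `0` beyond radius `a`. -/
def cutoffKernel (a b s : ℝ) : ℝ :=
  deriv Real.smoothTransition ((a ^ 2 - s ^ 2) / (a ^ 2 - b ^ 2)) * (2 / (a ^ 2 - b ^ 2))

theorem continuous_cutoffKernel (a b : ℝ) : Continuous (cutoffKernel a b) := by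
  have h := (Real.smoothTransition.contDiff (n := 1)).continuous_deriv le_rfl
  unfold cutoffKernel
  exact (h.comp (by fun_prop)).mul continuous_const

theorem cutoffKernel_nonneg {a b : ℝ} (hb : 0 < b) (hab : b < a) (s : ℝ) :
    0 ≤ cutoffKernel a b s := by
  have h : 0 < a ^ 2 - b ^ 2 := by nlinarith
  exact mul_nonneg Real.smoothTransition.monotone.deriv_nonneg (by positivity)

theorem cutoffKernel_eq_zero {a b : ℝ} (hb : 0 < b) (hab : b < a) {s : ℝ} (hs0 : 0 ≤ s)
    (hs : s ∉ Set.Ioc b a) : cutoffKernel a b s = 0 := by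
  have h : 0 < a ^ 2 - b ^ 2 := by nlinarith
  rw [cutoffKernel, deriv_smoothTransition_eq_zero, zero_mul]
  rcases le_or_gt s b with h1 | h1
  · right
    rw [one_le_div h]
    nlinarith
  · left
    have h2 : a < s := not_le.1 fun h2 ↦ hs ⟨h1, h2⟩
    exact div_nonpos_of_nonpos_of_nonneg (by nlinarith) h.le

theorem integral_cutoffKernel {a b : ℝ} (hb : 0 < b) (hab : b < a) :
    ∫ s in b..a, cutoffKernel a b s * s = 1 := by
  have h : a ^ 2 - b ^ 2 ≠ 0 := by nlinarith
  have hd : ∀ s ∈ Set.uIcc b a, HasDerivAt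
      (fun s ↦ - Real.smoothTransition ((a ^ 2 - s ^ 2) / (a ^ 2 - b ^ 2)))
      (cutoffKernel a b s * s) s := by
    intro s _
    have h1 : HasDerivAt (fun s : ℝ ↦ (a ^ 2 - s ^ 2) / (a ^ 2 - b ^ 2))
        (-(2 * s) / (a ^ 2 - b ^ 2)) s := by
      simpa using ((hasDerivAt_pow 2 s).const_sub (a ^ 2)).div_const (a ^ 2 - b ^ 2)
    have h2 := ((Real.smoothTransition.contDiff (n := 1)).differentiable (by norm_num)
      ((a ^ 2 - s ^ 2) / (a ^ 2 - b ^ 2))).hasDerivAt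
    refine (h2.comp s h1).neg.congr_deriv ?_
    rw [cutoffKernel]
    ring
  rw [intervalIntegral.integral_eq_sub_of_hasDerivAt hd
    (((continuous_cutoffKernel a b).mul continuous_id).intervalIntegrable _ _)]
  simp [div_self h]

/-- The divergence theorem on a ball, for vector fields that are `C¹` inside the ball and
continuous up to the boundary. -/
theorem integral_divergence_ball (hn : n ≠ 0) {t : ℝ} (ht : 0 < t) {Y : Eucl n → Eucl n}
    (hYc : ContinuousOn Y (Metric.closedBall 0 t)) (hY : ContDiffOn ℝ 1 Y (Metric.ball 0 t))
    (hint : IntegrableOn (fun y ↦ LinearMap.trace ℝ (Eucl n) (fderiv ℝ Y y).toLinearMap)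
      (Metric.ball 0 t)) :
    ∫ y in Metric.ball 0 t, LinearMap.trace ℝ (Eucl n) (fderiv ℝ Y y).toLinearMap =
      t ^ (n - 1) * ∫ ξ : Metric.sphere (0 : Eucl n) 1, inner ℝ (ξ : Eucl n) (Y (t • (ξ : Eucl n)))
        ∂(volume : Measure (Eucl n)).toSphere := by
  have : Nontrivial (Eucl n) := by
    have : Nonempty (Fin n) := ⟨⟨0, Nat.pos_of_ne_zero hn⟩⟩
    infer_instance
  set σ := (volume : Measure (Eucl n)).toSphere with hσ
  set D : Eucl n → ℝ := fun y ↦ LinearMap.trace ℝ (Eucl n) (fderiv ℝ Y y).toLinearMap with hD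
  set q : Eucl n → ℝ := fun y ↦ inner ℝ y (Y y) with hq
  have hqc : ContinuousOn q (Metric.closedBall 0 t) := continuousOn_id.inner hYc
  -- `H s / s` is the flux of `Y` through the sphere of radius `s`
  set H : ℝ → ℝ := fun s ↦ s ^ (n - 1) * ∫ ξ : Metric.sphere (0 : Eucl n) 1,
    q (s • (ξ : Eucl n)) ∂σ with hH
  have hHc : ContinuousOn H (Set.Icc 0 t) :=
    (continuousOn_pow _).mul (continuousOn_integral_sphere hqc)
  -- the cutoff `χ b` is `1` up to radius `b` and `0` beyond radius `(b + t) / 2 < t`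
  set χ : ℝ → Eucl n → ℝ := fun b y ↦ Real.smoothTransition
    ((((b + t) / 2) ^ 2 - ‖y‖ ^ 2) / (((b + t) / 2) ^ 2 - b ^ 2)) with hχ
  have hχ1 : ∀ b, 0 < b → b < t → ∀ y, ‖y‖ ≤ b → χ b y = 1 := by
    intro b hb hbt y hy
    apply Real.smoothTransition.one_of_one_le
    rw [one_le_div (by nlinarith)]
    nlinarith [norm_nonneg y]
  have hχ0 : ∀ b, 0 < b → b < t → ∀ y, (b + t) / 2 ≤ ‖y‖ → χ b y = 0 := by
    intro b hb hbt y hy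
    apply Real.smoothTransition.zero_of_nonpos
    exact div_nonpos_of_nonpos_of_nonneg (by nlinarith) (by nlinarith)
  have hχC : ∀ b, ContDiff ℝ 1 (χ b) := fun b ↦
    (Real.smoothTransition.contDiff (n := 1)).comp
      ((contDiff_const.sub (contDiff_id.norm_sq ℝ)).div_const _)
  have hχd : ∀ b y w, fderiv ℝ (χ b) y w =
      - (cutoffKernel ((b + t) / 2) b ‖y‖ * inner ℝ y w) := by
    intro b y w
    have h1 : HasFDerivAt (fun y : Eucl n ↦ (((b + t) / 2) ^ 2 - ‖y‖ ^ 2) /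
        (((b + t) / 2) ^ 2 - b ^ 2)) _ y :=
      (((hasStrictFDerivAt_norm_sq y).hasFDerivAt).const_sub (((b + t) / 2) ^ 2)).mul_const
        (((b + t) / 2) ^ 2 - b ^ 2)⁻¹
    have h2 := ((Real.smoothTransition.contDiff (n := 1)).differentiable (by norm_num)
      ((((b + t) / 2) ^ 2 - ‖y‖ ^ 2) / (((b + t) / 2) ^ 2 - b ^ 2))).hasDerivAt
    have h3 := HasDerivAt.comp_hasFDerivAt y h2 h1
    change HasFDerivAt (χ b) _ y at h3
    rw [h3.fderiv, cutoffKernel]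
    simp
    ring
  have hsupp : ∀ b, 0 < b → b < t → tsupport (χ b) ⊆ Metric.closedBall 0 ((b + t) / 2) := by
    intro b hb hbt
    refine closure_minimal (fun y hy ↦ ?_) Metric.isClosed_closedBall
    by_contra hy'
    refine hy (hχ0 b hb hbt y ?_)
    have : ¬ ‖y‖ ≤ (b + t) / 2 := by simpa using hy'
    linarith
  have hdim : Module.finrank ℝ (Eucl n) = n := finrank_euclideanSpace_fin
  -- integrating by parts against the cutoffs expresses the integral by spherical means
  have hident : ∀ b, 0 < b → b < t → ∫ y in Metric.ball 0 t, χ b y * D y =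
      ∫ s in b..((b + t) / 2), cutoffKernel ((b + t) / 2) b s * H s := by
    intro b hb hbt
    have hba : b < (b + t) / 2 := by linarith
    have hsub : Metric.closedBall (0 : Eucl n) ((b + t) / 2) ⊆ Metric.ball 0 t :=
      Metric.closedBall_subset_ball (by linarith)
    obtain ⟨hI1, hI2⟩ := integral_mul_trace_fderiv Metric.isOpen_ball hY (hχC b)
      (HasCompactSupport.of_support_subset_isCompact (isCompact_closedBall _ _)
        ((subset_tsupport _).trans (hsupp b hb hbt))) ((hsupp b hb hbt).trans hsub)
    have h1 : ∀ y, fderiv ℝ (χ b) y (Y y) = - (cutoffKernel ((b + t) / 2) b ‖y‖ * q y) :=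
      fun y ↦ hχd b y _
    simp only [h1] at hI1 hI2
    rw [integral_neg, neg_neg] at hI2
    have hI3 : Integrable fun y ↦ cutoffKernel ((b + t) / 2) b ‖y‖ * q y := by
      simpa using hI1.neg
    rw [setIntegral_eq_integral_of_forall_compl_eq_zero, hI2, integral_polar hI3, hdim,
      intervalIntegral.integral_of_le hba.le]
    · have h2 : ∀ s ∈ Set.Ioi (0 : ℝ), s ^ (n - 1) * ∫ ξ : Metric.sphere (0 : Eucl n) 1,
          cutoffKernel ((b + t) / 2) b ‖s • (ξ : Eucl n)‖ * q (s • (ξ : Eucl n)) ∂σ =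
          cutoffKernel ((b + t) / 2) b s * H s := by
        intro s hs
        have h3 : ∀ ξ : Metric.sphere (0 : Eucl n) 1, ‖s • (ξ : Eucl n)‖ = s := by
          intro ξ
          have : ‖(ξ : Eucl n)‖ = 1 := by simp
          rw [norm_smul, this, mul_one, Real.norm_of_nonneg (le_of_lt hs)]
        simp only [h3]
        rw [integral_const_mul, hH]
        ring
      rw [setIntegral_congr_fun measurableSet_Ioi h2]
      refine setIntegral_eq_of_subset_of_forall_sdiff_eq_zero measurableSet_Ioi
        (fun s hs ↦ hb.trans hs.1) fun s hs ↦ ?_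
      rw [cutoffKernel_eq_zero hb hba (le_of_lt hs.1) hs.2, zero_mul]
    · intro y hy
      rw [hχ0 b hb hbt y, zero_mul]
      have : ¬ ‖y‖ < t := by simpa using hy
      linarith
  -- as `b → t`, the cutoffs tend to `1` in the open ball
  have hlim1 : Filter.Tendsto (fun b ↦ ∫ y in Metric.ball 0 t, χ b y * D y)
      (nhdsWithin t (Set.Iio t)) (nhds (∫ y in Metric.ball 0 t, D y)) := by
    refine tendsto_integral_filter_of_dominated_convergence (fun y ↦ ‖D y‖) ?_ ?_ hint.norm ?_
    · exact .of_forall fun b ↦ (hχC b).continuous.aestronglyMeasurable.mul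
        hint.aestronglyMeasurable
    · refine .of_forall fun b ↦ .of_forall fun y ↦ ?_
      rw [norm_mul]
      refine mul_le_of_le_one_left (norm_nonneg _) ?_
      rw [Real.norm_of_nonneg (Real.smoothTransition.nonneg _)]
      exact Real.smoothTransition.le_one _
    · refine (ae_restrict_iff' measurableSet_ball).2 (.of_forall fun y hy ↦ ?_)
      have hy' : ‖y‖ < t := by simpa using hy
      refine tendsto_const_nhds.congr' ?_
      have hmem : Set.Ioo (max ‖y‖ 0) t ∈ nhdsWithin t (Set.Iio t) :=
        Ioo_mem_nhdsLT (max_lt hy' ht)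
      filter_upwards [hmem] with b hb
      rw [hχ1 b ((le_max_right _ _).trans_lt hb.1) hb.2 y ((le_max_left _ _).trans hb.1.le),
        one_mul]
  -- as `b → t`, the probability densities `cutoffKernel _ b s * s` concentrate at `s = t`
  have hlim2 : Filter.Tendsto (fun b ↦ ∫ y in Metric.ball 0 t, χ b y * D y)
      (nhdsWithin t (Set.Iio t)) (nhds (H t / t)) := by
    have hHt : ContinuousWithinAt (fun s ↦ H s / s) (Set.Icc (t / 2) t) t :=
      ((hHc.mono (Set.Icc_subset_Icc_left (by linarith))).div continuousOn_id
        fun s hs ↦ by have := hs.1; simp; linarith) t ⟨by linarith, le_rfl⟩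
    rw [Metric.tendsto_nhds]
    intro ε hε
    obtain ⟨δ, hδ, hδ'⟩ := Metric.continuousWithinAt_iff.1 hHt (ε / 2) (by linarith)
    have hmem : Set.Ioo (max (t - δ) (t / 2)) t ∈ nhdsWithin t (Set.Iio t) :=
      Ioo_mem_nhdsLT (max_lt (by linarith) (by linarith))
    filter_upwards [hmem] with b hb
    have hb1 : t - δ < b := (le_max_left _ _).trans_lt hb.1
    have hb2 : t / 2 < b := (le_max_right _ _).trans_lt hb.1
    have hb0 : 0 < b := by linarith
    have hba : b < (b + t) / 2 := by linarith [hb.2]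
    rw [hident b hb0 hb.2, Real.dist_eq]
    set κ := cutoffKernel ((b + t) / 2) b with hκ
    have hκc : Continuous κ := continuous_cutoffKernel _ _
    have hκi : IntervalIntegrable (fun s ↦ κ s * s) volume b ((b + t) / 2) :=
      (hκc.mul continuous_id).intervalIntegrable _ _
    have hsub : Set.uIcc b ((b + t) / 2) ⊆ Set.Icc 0 t := by
      rw [Set.uIcc_of_le hba.le]
      exact Set.Icc_subset_Icc hb0.le (by linarith [hb.2])
    have hHi : IntervalIntegrable (fun s ↦ κ s * H s) volume b ((b + t) / 2) :=
      (hκc.continuousOn.mul (hHc.mono hsub)).intervalIntegrable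
    have h1 : H t / t = ∫ s in b..((b + t) / 2), κ s * s * (H t / t) := by
      rw [intervalIntegral.integral_mul_const, integral_cutoffKernel hb0 hba, one_mul]
    rw [h1, ← intervalIntegral.integral_sub hHi (hκi.mul_const _), ← Real.norm_eq_abs]
    have h2 : ‖∫ s in b..((b + t) / 2), (κ s * H s - κ s * s * (H t / t))‖ ≤
        ∫ s in b..((b + t) / 2), κ s * s * (ε / 2) := by
      refine intervalIntegral.norm_integral_le_of_norm_le hba.le ?_ (hκi.mul_const _)
      refine .of_forall fun s hs ↦ ?_
      have hs0 : 0 < s := hb0.trans hs.1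
      have h3 : κ s * H s - κ s * s * (H t / t) = κ s * s * (H s / s - H t / t) := by
        field_simp
      have h4 : dist (H s / s) (H t / t) < ε / 2 := by
        refine hδ' ⟨by linarith [hs.1], by linarith [hs.2, hb.2]⟩ ?_
        rw [Real.dist_eq, abs_lt]
        constructor <;> linarith [hs.1, hs.2, hb.2]
      rw [h3, norm_mul, Real.norm_of_nonneg
        (mul_nonneg (cutoffKernel_nonneg hb0 hba s) hs0.le)]
      exact mul_le_mul_of_nonneg_left h4.le
        (mul_nonneg (cutoffKernel_nonneg hb0 hba s) hs0.le)
    rw [intervalIntegral.integral_mul_const, integral_cutoffKernel hb0 hba, one_mul] at h2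
    linarith
  rw [tendsto_nhds_unique hlim1 hlim2, hH]
  simp only [hq, inner_smul_left, RCLike.conj_to_real]
  rw [integral_const_mul]
  field_simp

end Divergence

/-! ### The area of parametrized pieces of the unit sphere -/

section Cone

variable {k : ℕ}

/-- The splitting of `ℝᵏ⁺¹` into the first coordinate and the remaining ones. -/
def splitFirst (k : ℕ) : Eucl (k + 1) ≃L[ℝ] ℝ × Eucl k :=
  LinearEquiv.toContinuousLinearEquiv
    { toFun := fun z ↦ (z 0, WithLp.toLp 2 fun i ↦ z i.succ)
      invFun := fun q ↦ WithLp.toLp 2 (Fin.cons q.1 q.2)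
      map_add' := fun _ _ ↦ rfl
      map_smul' := fun _ _ ↦ rfl
      left_inv := fun z ↦ by
        ext i
        refine Fin.cases ?_ (fun j ↦ ?_) i <;> simp
      right_inv := fun q ↦ by
        ext <;> simp }

theorem splitFirst_apply (z : Eucl (k + 1)) :
    splitFirst k z = (z 0, WithLp.toLp 2 fun i ↦ z i.succ) := rfl

theorem splitFirst_single_zero :
    splitFirst k (EuclideanSpace.single 0 1) = (1, 0) := by
  rw [splitFirst_apply]
  ext <;> simp

theorem splitFirst_single_succ (i : Fin k) :
    splitFirst k (EuclideanSpace.single i.succ 1) = (0, EuclideanSpace.single i 1) := by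
  rw [splitFirst_apply]
  ext j
  · simp
  · simp

theorem measurePreserving_splitFirst (k : ℕ) : MeasurePreserving (splitFirst k) := by
  have h1 := PiLp.volume_preserving_ofLp (Fin (k + 1))
  have h2 := volume_preserving_piFinSuccAbove (fun _ : Fin (k + 1) ↦ ℝ) 0
  have h3 : MeasurePreserving (Prod.map id (WithLp.toLp 2) : ℝ × (Fin k → ℝ) → ℝ × Eucl k) :=
    (MeasurePreserving.id volume).prod (PiLp.volume_preserving_toLp (Fin k))
  exact (h3.comp h2).comp h1

/-- The differential at `(1, y)` of the cone `(s, y) ↦ s • T y`, where `T y = v` and `T' = L`. -/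
def coneDeriv (v : Eucl (k + 1)) (L : Eucl k →L[ℝ] Eucl (k + 1)) :
    Eucl (k + 1) →L[ℝ] Eucl (k + 1) :=
  ((ContinuousLinearMap.fst ℝ ℝ (Eucl k)).smulRight v +
    L.comp (ContinuousLinearMap.snd ℝ ℝ (Eucl k))).comp
      (splitFirst k : Eucl (k + 1) →L[ℝ] ℝ × Eucl k)

theorem coneDeriv_apply (v : Eucl (k + 1)) (L : Eucl k →L[ℝ] Eucl (k + 1)) (z : Eucl (k + 1)) :
    coneDeriv v L z = (splitFirst k z).1 • v + L (splitFirst k z).2 := rfl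

theorem det_coneDeriv_smul (v : Eucl (k + 1)) (L : Eucl k →L[ℝ] Eucl (k + 1)) (s : ℝ) :
    (coneDeriv v (s • L)).det = s ^ k * (coneDeriv v L).det := by
  set D : ℝ × Eucl k →ₗ[ℝ] ℝ × Eucl k := LinearMap.prodMap LinearMap.id (s • LinearMap.id) with hD
  have h1 : (coneDeriv v (s • L)).toLinearMap = (coneDeriv v L).toLinearMap ∘ₗ
      ((splitFirst k).symm.toLinearEquiv.toLinearMap ∘ₗ D ∘ₗ
        (splitFirst k).symm.toLinearEquiv.symm.toLinearMap) := by
    ext1 z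
    change coneDeriv v (s • L) z = coneDeriv v L ((splitFirst k).symm (D (splitFirst k z)))
    rw [coneDeriv_apply, coneDeriv_apply, ContinuousLinearEquiv.apply_symm_apply]
    simp [hD]
  rw [ContinuousLinearMap.det, h1, LinearMap.det_comp, LinearMap.det_conj, hD,
    LinearMap.det_prodMap, LinearMap.det_id, LinearMap.det_smul, LinearMap.det_id]
  simp [ContinuousLinearMap.det, mul_comm]

open scoped Pointwise in
/-- The area of a piece of the unit sphere is `k + 1` times the volume of the cone over it. -/
theorem toSphere_image {T : Eucl k → Eucl (k + 1)} {T' : Eucl k → Eucl k →L[ℝ] Eucl (k + 1)}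
    {V : Set (Eucl k)} (hV : MeasurableSet V) (hT : ∀ y ∈ V, HasFDerivAt T (T' y) y)
    (hT1 : ∀ y ∈ V, ‖T y‖ = 1) (hinj : Set.InjOn T V)
    (hJ : AEMeasurable (fun y ↦ ENNReal.ofReal |(coneDeriv (T y) (T' y)).det|)
      (volume.restrict V)) :
    (volume : Measure (Eucl (k + 1))).toSphere (Subtype.val ⁻¹' (T '' V)) =
      ∫⁻ y in V, ENNReal.ofReal |(coneDeriv (T y) (T' y)).det| := by
  have hTm : MeasurableSet (T '' V) := hV.image_of_continuousOn_injOn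
    (fun y hy ↦ (hT y hy).continuousAt.continuousWithinAt) hinj
  -- the cone over `T '' V` is parametrized by `C (s, y) = s • T y` with `0 < s < 1`
  set C : Eucl (k + 1) → Eucl (k + 1) := fun z ↦ (splitFirst k z).1 • T (splitFirst k z).2 with hC
  set W : Set (Eucl (k + 1)) := splitFirst k ⁻¹' (Set.Ioo 0 1 ×ˢ V) with hW
  have hWm : MeasurableSet W :=
    (splitFirst k).continuous.measurable (measurableSet_Ioo.prod hV)
  have himg : Set.Ioo (0 : ℝ) 1 • (Subtype.val '' (Subtype.val ⁻¹' (T '' V) :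
      Set (Metric.sphere (0 : Eucl (k + 1)) 1))) = C '' W := by
    have hsub : T '' V ⊆ Metric.sphere 0 1 := by
      rintro _ ⟨y, hy, rfl⟩
      simpa using hT1 y hy
    rw [Subtype.image_preimage_coe, Set.inter_eq_right.2 hsub]
    ext x
    constructor
    · rintro ⟨s, hs, _, ⟨y, hy, rfl⟩, rfl⟩
      refine ⟨(splitFirst k).symm (s, y), ?_, ?_⟩
      · simp only [hW, Set.mem_preimage, ContinuousLinearEquiv.apply_symm_apply]
        exact ⟨hs, hy⟩
      · simp [hC]
    · rintro ⟨z, hz, rfl⟩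
      exact ⟨_, hz.1, _, ⟨_, hz.2, rfl⟩, rfl⟩
  have hCinj : Set.InjOn C W := by
    intro z hz z' hz' h
    have hn := congrArg norm h
    simp only [hC, norm_smul, hT1 _ hz.2, hT1 _ hz'.2, mul_one, Real.norm_eq_abs,
      abs_of_pos hz.1.1, abs_of_pos hz'.1.1] at hn
    simp only [hC, ← hn] at h
    exact (splitFirst k).injective
      (Prod.ext hn (hinj hz.2 hz'.2 (smul_right_injective _ hz.1.1.ne' h)))
  have hCd : ∀ z ∈ W, HasFDerivWithinAt C (coneDeriv (T (splitFirst k z).2)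
      ((splitFirst k z).1 • T' (splitFirst k z).2)) W z := by
    intro z hz
    have h1 : HasFDerivAt (fun q : ℝ × Eucl k ↦ q.1 • T q.2) _ (splitFirst k z) :=
      hasFDerivAt_fst.fun_smul ((hT _ hz.2).comp _ hasFDerivAt_snd)
    refine ((h1.comp z (splitFirst k).hasFDerivAt).congr_fderiv ?_).hasFDerivWithinAt
    ext1 w
    exact add_comm _ _
  have hvol : volume (C '' W) = ∫⁻ z in W, ENNReal.ofReal ((splitFirst k z).1 ^ k) *
      ENNReal.ofReal |(coneDeriv (T (splitFirst k z).2) (T' (splitFirst k z).2)).det| := by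
    have := lintegral_image_eq_lintegral_abs_det_fderiv_mul volume hWm hCd hCinj fun _ ↦ 1
    rw [setLIntegral_one] at this
    rw [this]
    refine setLIntegral_congr_fun hWm fun z hz ↦ ?_
    rw [mul_one, det_coneDeriv_smul, abs_mul, ENNReal.ofReal_mul (abs_nonneg _), abs_pow,
      abs_of_pos hz.1.1]
  have hpow : ∫⁻ s in Set.Ioo (0 : ℝ) 1, ENNReal.ofReal (s ^ k) =
      ENNReal.ofReal (1 / (k + 1)) := by
    rw [← ofReal_integral_eq_lintegral_ofReal]
    · rw [← integral_Ioc_eq_integral_Ioo, ← intervalIntegral.integral_of_le zero_le_one,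
        integral_pow]
      simp
    · exact (continuous_pow k).continuousOn.integrableOn_Icc.mono_set Set.Ioo_subset_Icc_self
    · filter_upwards [ae_restrict_mem measurableSet_Ioo] with s hs
      exact pow_nonneg hs.1.le _
  have hprod : ∫⁻ z in W, ENNReal.ofReal ((splitFirst k z).1 ^ k) *
      ENNReal.ofReal |(coneDeriv (T (splitFirst k z).2) (T' (splitFirst k z).2)).det| =
      (∫⁻ s in Set.Ioo (0 : ℝ) 1, ENNReal.ofReal (s ^ k)) *
        ∫⁻ y in V, ENNReal.ofReal |(coneDeriv (T y) (T' y)).det| := by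
    have hemb : MeasurableEmbedding (splitFirst k) :=
      (splitFirst k).toHomeomorph.measurableEmbedding
    rw [hW, (measurePreserving_splitFirst k).setLIntegral_comp_preimage_emb hemb
      (fun q : ℝ × Eucl k ↦ ENNReal.ofReal (q.1 ^ k) *
        ENNReal.ofReal |(coneDeriv (T q.2) (T' q.2)).det|),
      Measure.volume_eq_prod, ← Measure.prod_restrict]
    exact lintegral_prod_mul (f := fun s : ℝ ↦ ENNReal.ofReal (s ^ k))
      (by fun_prop) hJ
  rw [Measure.toSphere_apply' _ (measurable_subtype_coe hTm), himg, hvol, hprod, hpow,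
    ← mul_assoc, finrank_euclideanSpace_fin, ← ENNReal.ofReal_natCast,
    ← ENNReal.ofReal_mul (by positivity)]
  have : ((k + 1 : ℕ) : ℝ) * (1 / (k + 1)) = 1 := by
    push_cast
    field_simp
  rw [this, ENNReal.ofReal_one, one_mul]

/-- Integration over a parametrized piece of the unit sphere. -/
theorem lintegral_toSphere_image {T : Eucl k → Eucl (k + 1)}
    {T' : Eucl k → Eucl k →L[ℝ] Eucl (k + 1)}
    {V : Set (Eucl k)} (hV : MeasurableSet V) (hT : ∀ y ∈ V, HasFDerivAt T (T' y) y)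
    (hT1 : ∀ y ∈ V, ‖T y‖ = 1) (hinj : Set.InjOn T V)
    (hJ : AEMeasurable (fun y ↦ ENNReal.ofReal |(coneDeriv (T y) (T' y)).det|)
      (volume.restrict V)) {h : Eucl (k + 1) → ℝ≥0∞} (hh : Measurable h) :
    ∫⁻ ξ in Subtype.val ⁻¹' (T '' V), h (ξ : Eucl (k + 1))
        ∂(volume : Measure (Eucl (k + 1))).toSphere =
      ∫⁻ y in V, ENNReal.ofReal |(coneDeriv (T y) (T' y)).det| * h (T y) := by
  have hTc : ContinuousOn T V := fun y hy ↦ (hT y hy).continuousAt.continuousWithinAt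
  have hTm : AEMeasurable T (volume.restrict V) := hTc.aemeasurable hV
  set μ := (volume.restrict V).withDensity
    fun y ↦ ENNReal.ofReal |(coneDeriv (T y) (T' y)).det| with hμ
  have hTm' : AEMeasurable T μ := hTm.mono_ac (withDensity_absolutelyContinuous _ _)
  have hTV : MeasurableSet (T '' V) := hV.image_of_continuousOn_injOn hTc hinj
  have hmap : (((volume : Measure (Eucl (k + 1))).toSphere.restrict
      (Subtype.val ⁻¹' (T '' V))).map Subtype.val) = μ.map T := by
    ext A hA
    obtain ⟨B, hB, hAB⟩ : ∃ B, MeasurableSet B ∧ B = V ∩ T ⁻¹' A := by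
      refine ⟨_, ?_, rfl⟩
      have := (continuousOn_iff_continuous_domRestrict.1 hTc).measurable hA
      have h2 := hV.subtype_image this
      rwa [Set.domRestrict_eq, Set.preimage_comp, Subtype.image_preimage_coe] at h2
    have hBV : B ⊆ V := hAB ▸ Set.inter_subset_left
    have himg : T '' B = A ∩ T '' V := by
      rw [hAB, Set.image_inter_preimage, Set.inter_comm]
    rw [Measure.map_apply measurable_subtype_coe hA, Measure.map_apply_of_aemeasurable hTm' hA,
      Measure.restrict_apply (measurable_subtype_coe hA), ← Set.preimage_inter, ← himg, hμ,
      withDensity_apply', Measure.restrict_restrict' hV, Set.inter_comm, ← hAB]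
    exact toSphere_image hB (fun y hy ↦ hT y (hBV hy)) (fun y hy ↦ hT1 y (hBV hy))
      (hinj.mono hBV) (hJ.mono_measure (Measure.restrict_mono hBV le_rfl))
  rw [← lintegral_map hh measurable_subtype_coe, hmap, lintegral_map' hh.aemeasurable hTm', hμ]
  exact lintegral_withDensity_eq_lintegral_mul₀ hJ (hh.comp_aemeasurable hTm)

end Cone

/-! ### Riemannian measures in coordinates -/

/-- The Gram determinant of a bilinear form pulled back by a linear map `L` is multiplied by
`(det L)²`. -/
theorem det_bilin_comp {n : ℕ} (c : Eucl n → Eucl n →L[ℝ] Eucl n →L[ℝ] ℝ) (x : Eucl n)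
    (L : Eucl n →L[ℝ] Eucl n) :
    (Matrix.of fun i j ↦ c x (L (EuclideanSpace.single i 1))
      (L (EuclideanSpace.single j 1))).det = (matrixOf c x).det * L.det ^ 2 := by
  set N : Matrix (Fin n) (Fin n) ℝ := Matrix.of fun a i ↦ L (EuclideanSpace.single i 1) a with hN
  have h1 : L.det = N.det := by
    rw [ContinuousLinearMap.det,
      ← LinearMap.det_toMatrix (EuclideanSpace.basisFun (Fin n) ℝ).toBasis]
    rfl
  have h2 : (Matrix.of fun i j ↦ c x (L (EuclideanSpace.single i 1))
      (L (EuclideanSpace.single j 1))) = N.transpose * matrixOf c x * N := by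
    ext i j
    simp only [Matrix.mul_apply, Matrix.of_apply, Matrix.transpose_apply]
    rw [clm_apply_eq_sum (c x (L (EuclideanSpace.single i 1)))]
    refine Finset.sum_congr rfl fun b _ ↦ ?_
    have h3 : c x (L (EuclideanSpace.single i 1)) (EuclideanSpace.single b 1) =
        ∑ a, L (EuclideanSpace.single i 1) a * matrixOf c x a b :=
      clm_apply_eq_sum ((c x).flip (EuclideanSpace.single b 1)) _
    rw [h3, mul_comm]
    rfl
  rw [h2, Matrix.det_mul, Matrix.det_mul, Matrix.det_transpose, h1]
  ring

theorem measurableSet_inter_preimage {α β : Type*} [TopologicalSpace α] [MeasurableSpace α]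
    [BorelSpace α] [TopologicalSpace β] [MeasurableSpace β] [BorelSpace β] {f : α → β} {s : Set α}
    (hf : ContinuousOn f s) (hs : MeasurableSet s) {A : Set β} (hA : MeasurableSet A) :
    MeasurableSet (s ∩ f ⁻¹' A) := by
  have h2 := hs.subtype_image ((continuousOn_iff_continuous_domRestrict.1 hf).measurable hA)
  rwa [Set.domRestrict_eq, Set.preimage_comp, Subtype.image_preimage_coe] at h2

section Density

variable {n : ℕ} {M : Type*} [EMetricSpace M] [ChartedSpace (Eucl n) M]
  [RiemannianBundle (fun x : M ↦ TangentSpace (𝓡 n) x)] [IsManifold (𝓡 n) ∞ M]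
  [IsContMDiffRiemannianBundle (𝓡 n) ∞ (EuclideanSpace ℝ (Fin n))
      (fun x : M ↦ TangentSpace (𝓡 n) x)]
  {F : Eucl n → M} {U₀ : Set (Eucl n)}

theorem contDiffOn_density {c : Eucl n → Eucl n →L[ℝ] Eucl n →L[ℝ] ℝ} {U : Set (Eucl n)}
    (hc : ContDiffOn ℝ ∞ c U) (hpos : ∀ y ∈ U, 0 < (matrixOf c y).det) :
    ContDiffOn ℝ ∞ (density c) U := by
  refine ContDiffOn.sqrt ?_ fun y hy ↦ (hpos y hy).ne'
  have hent : ∀ i j, ContDiffOn ℝ ∞ (fun y ↦ matrixOf c y i j) U := fun i j ↦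
    (hc.clm_apply contDiffOn_const).clm_apply contDiffOn_const
  simp only [Matrix.det_apply]
  refine ContDiffOn.sum fun σ _ ↦ ContDiffOn.const_smul _ ?_
  exact contDiffOn_prod fun i _ ↦ hent _ _

theorem IsRegularOn.contDiffOn_density (h : IsRegularOn F U₀) :
    ContDiffOn ℝ ∞ (density (pullMetric n F)) U₀ :=
  RiemGeom.contDiffOn_density (contDiffOn_pullMetric n h.isOpen h.contMDiffOn)
    fun _ hy ↦ h.det_pos hy

theorem IsRegularOn.mono (h : IsRegularOn F U₀) {V : Set (Eucl n)} (hV : IsOpen V)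
    (hVU : V ⊆ U₀) : IsRegularOn F V :=
  ⟨hV, h.contMDiffOn.mono hVU, fun y hy ↦ h.immersion y (hVU hy)⟩

end Density

section Param

variable {n : ℕ} {M : Type*} [EMetricSpace M] [ChartedSpace (Eucl n) M]
  [RiemannianBundle (fun x : M ↦ TangentSpace (𝓡 n) x)]
  [MeasurableSpace M] [BorelSpace M] {k : ℕ}

theorem IsLocalParam.paramMeasure_apply {S : Set M} {U : Set (Eucl k)} {G : Eucl k → M}
    (h : IsLocalParam n S U G) {A : Set M} (hA : MeasurableSet A) :
    paramMeasure n U G A =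
      ∫⁻ y in U ∩ G ⁻¹' A, ENNReal.ofReal (Real.sqrt (gram n G y).det) := by
  have hG : AEMeasurable G (((volume : Measure (Eucl k)).restrict U).withDensity
      fun y ↦ ENNReal.ofReal (Real.sqrt (gram n G y).det)) :=
    (h.contMDiffOn.continuousOn.aemeasurable h.isOpen.measurableSet).mono_ac
      (withDensity_absolutelyContinuous _ _)
  rw [paramMeasure, Measure.map_apply_of_aemeasurable hG hA, withDensity_apply',
    Measure.restrict_restrict' h.isOpen.measurableSet, Set.inter_comm]

theorem IsLocalParam.paramMeasure_le {S : Set M} {U : Set (Eucl k)} {G : Eucl k → M}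
    (h : IsLocalParam n S U G) : paramMeasure n U G ≤ submanifoldMeasure n k S :=
  le_iSup_of_le U (le_iSup_of_le G (le_iSup_of_le h le_rfl))

/-- To bound the Riemannian measure of `S` on a measurable set `O`, it is enough to bound on `O` the
measures given by the local parametrizations of `S`. -/
theorem submanifoldMeasure_restrict_le {S O : Set M} (hO : MeasurableSet O) {ν : Measure M}
    (h : ∀ (U : Set (Eucl k)) (G : Eucl k → M), IsLocalParam n S U G →
      (paramMeasure n U G).restrict O ≤ ν) :
    (submanifoldMeasure n k S).restrict O ≤ ν := by
  have h1 : submanifoldMeasure n k S ≤ ν + (submanifoldMeasure n k S).restrict Oᶜ := by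
    refine iSup_le fun U ↦ iSup_le fun G ↦ iSup_le fun hG ↦ ?_
    rw [← Measure.restrict_add_restrict_compl (μ := paramMeasure n U G) hO]
    exact add_le_add (h U G hG) (Measure.restrict_mono le_rfl hG.paramMeasure_le)
  refine (Measure.restrict_mono le_rfl h1).trans ?_
  rw [Measure.restrict_add, Measure.restrict_restrict hO, Set.inter_compl_self,
    Measure.restrict_empty, add_zero]
  exact Measure.restrict_le_self

variable [IsManifold (𝓡 n) ∞ M]
  [IsContMDiffRiemannianBundle (𝓡 n) ∞ (EuclideanSpace ℝ (Fin n))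
      (fun x : M ↦ TangentSpace (𝓡 n) x)]
  {F : Eucl n → M} {U₀ : Set (Eucl n)}

theorem IsRegularOn.pullMetric_comp (h : IsRegularOn F U₀) {T : Eucl k → Eucl n} {y : Eucl k}
    (hT : DifferentiableAt ℝ T y) (hy : T y ∈ U₀) {G : Eucl k → M}
    (hG : G =ᶠ[nhds y] F ∘ T) (v w : Eucl k) :
    pullMetric n G y v w = pullMetric n F (T y) (fderiv ℝ T y v) (fderiv ℝ T y w) := by
  have h1 := mfderiv_comp y (h.mdifferentiableAt hy) hT.mdifferentiableAt
  rw [mfderiv_eq_fderiv] at h1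
  have h2 : mfderiv (𝓡 k) (𝓡 n) G y = mfderiv (𝓡 k) (𝓡 n) (F ∘ T) y := hG.mfderiv_eq
  have h3 : ∀ v, mfderiv (𝓡 k) (𝓡 n) G y v = mfderiv (𝓡 n) (𝓡 n) F (T y) (fderiv ℝ T y v) :=
    fun v ↦ congrArg (fun L : Eucl k →L[ℝ] Eucl n ↦ L v) (h2.trans h1)
  refine (inner_congr (n := n) hG.self_of_nhds _ _).trans ?_
  exact congrArg₂ (fun a b : Eucl n ↦ @inner ℝ (TangentSpace (𝓡 n) (F (T y))) _ a b) (h3 v) (h3 w)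

/-- A local parametrization `G` of `M` is, near each point with `G y` in the image of `F`, of the
form `F ∘ T`. -/
theorem IsRegularOn.lift (h : IsRegularOn F U₀) (hi : Set.InjOn F U₀) {S : Set M}
    {U : Set (Eucl k)} {G : Eucl k → M} (hG : IsLocalParam n S U G) {y : Eucl k} (hy : y ∈ U)
    (hyF : G y ∈ F '' U₀) :
    Function.invFunOn F U₀ (G y) ∈ U₀ ∧ F (Function.invFunOn F U₀ (G y)) = G y ∧
      ContDiffAt ℝ 1 (Function.invFunOn F U₀ ∘ G) y ∧
      G =ᶠ[nhds y] F ∘ (Function.invFunOn F U₀ ∘ G) := by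
  have h1 : Function.invFunOn F U₀ (G y) ∈ U₀ := Function.invFunOn_mem hyF
  have h2 : F (Function.invFunOn F U₀ (G y)) = G y := Function.invFunOn_eq hyF
  have hGy : ContMDiffAt (𝓡 k) (𝓡 n) 1 G y :=
    hG.contMDiffOn.contMDiffAt (hG.isOpen.mem_nhds hy)
  refine ⟨h1, h2, ?_, ?_⟩
  · rw [← contMDiffAt_iff_contDiffAt]
    have h3 : ContMDiffAt (𝓡 n) (𝓡 n) 1 (Function.invFunOn F U₀) (G y) := by
      have := h.contMDiffAt_invFunOn hi h1
      rw [h2] at this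
      exact this.of_le (WithTop.coe_le_coe.2 le_top)
    exact h3.comp y hGy
  · filter_upwards [hGy.continuousAt.preimage_mem_nhds
      ((h.isOpen_image h.isOpen subset_rfl).mem_nhds hyF)] with z hz
    exact (Function.invFunOn_eq hz).symm

theorem IsRegularOn.isLocalParam (h : IsRegularOn F U₀) (hi : Set.InjOn F U₀) :
    IsLocalParam n Set.univ U₀ F where
  isOpen := h.isOpen
  contMDiffOn := h.contMDiffOn.of_le (WithTop.coe_le_coe.2 le_top)
  injOn := hi
  immersion := h.immersion
  mapsTo := Set.mapsTo_univ _ _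

/-- The Riemannian volume measure in the coordinates `F`. -/
theorem IsRegularOn.riemVol_restrict (h : IsRegularOn F U₀) (hi : Set.InjOn F U₀) :
    (riemVol n M).restrict (F '' U₀) = paramMeasure n U₀ F := by
  have hO : MeasurableSet (F '' U₀) := (h.isOpen_image h.isOpen subset_rfl).measurableSet
  have hF := h.isLocalParam hi
  refine le_antisymm (submanifoldMeasure_restrict_le hO fun U G hG ↦ ?_) ?_
  · refine Measure.le_iff.2 fun A hA ↦ ?_
    rw [Measure.restrict_apply hA, hG.paramMeasure_apply (hA.inter hO), hF.paramMeasure_apply hA]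
    -- any other parametrization `G` factors through `F` by an injective map `T`, and the change of
    -- variables formula applies to `T`
    set T := Function.invFunOn F U₀ ∘ G with hT
    set V := U ∩ G ⁻¹' (A ∩ F '' U₀) with hV
    have hVm : MeasurableSet V := measurableSet_inter_preimage hG.contMDiffOn.continuousOn
      hG.isOpen.measurableSet (hA.inter hO)
    have hlift := fun y (hy : y ∈ V) ↦ h.lift hi hG hy.1 hy.2.2
    have hTinj : Set.InjOn T V := by
      intro y hy z hz hyz
      refine hG.injOn hy.1 hz.1 ?_
      rw [← (hlift y hy).2.1, ← (hlift z hz).2.1]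
      exact congrArg F hyz
    have hTd : ∀ y ∈ V, DifferentiableAt ℝ T y := fun y hy ↦
      (hlift y hy).2.2.1.differentiableAt (by simp)
    calc ∫⁻ y in V, ENNReal.ofReal (Real.sqrt (gram n G y).det)
        = ∫⁻ y in V, ENNReal.ofReal |(fderiv ℝ T y).det| *
            ENNReal.ofReal (Real.sqrt (gram n F (T y)).det) := by
          refine setLIntegral_congr_fun hVm fun y hy ↦ ?_
          have h1 : (gram n G y).det = (matrixOf (pullMetric n F) (T y)).det *
              (fderiv ℝ T y).det ^ 2 := by
            rw [← det_bilin_comp]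
            congr 1
            ext i j
            exact h.pullMetric_comp (hTd y hy) (hlift y hy).1 (hlift y hy).2.2.2 _ _
          rw [h1, Real.sqrt_mul' _ (sq_nonneg _), Real.sqrt_sq_eq_abs, mul_comm,
            ENNReal.ofReal_mul (abs_nonneg _)]
          rfl
      _ = ∫⁻ z in T '' V, ENNReal.ofReal (Real.sqrt (gram n F z).det) :=
          (lintegral_image_eq_lintegral_abs_det_fderiv_mul volume hVm
            (fun y hy ↦ (hTd y hy).hasFDerivAt.hasFDerivWithinAt) hTinj
            fun z ↦ ENNReal.ofReal (Real.sqrt (gram n F z).det)).symm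
      _ ≤ _ := by
          refine lintegral_mono_set ?_
          rintro _ ⟨y, hy, rfl⟩
          exact ⟨(hlift y hy).1, by
            change F (Function.invFunOn F U₀ (G y)) ∈ A
            rw [(hlift y hy).2.1]; exact hy.2.1⟩
  · refine Measure.le_iff.2 fun A hA ↦ ?_
    rw [Measure.restrict_apply hA]
    refine le_trans (le_of_eq ?_) (Measure.le_iff.1 hF.paramMeasure_le _ (hA.inter hO))
    rw [hF.paramMeasure_apply hA, hF.paramMeasure_apply (hA.inter hO)]
    congr 2
    ext y
    simp only [Set.mem_inter_iff, Set.mem_preimage]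
    exact ⟨fun hy ↦ ⟨hy.1, hy.2, Set.mem_image_of_mem F hy.1⟩, fun hy ↦ ⟨hy.1, hy.2.1⟩⟩

/-- The measure `√(det F^* g) dy` on `M` is the image, under the restriction of `F` to `U₀`, of a
measure on the subtype `U₀`. This restriction is an embedding, so that integrals against image
measures need no measurability of the integrand. -/
theorem IsRegularOn.paramMeasure_eq (h : IsRegularOn F U₀) (hi : Set.InjOn F U₀) :
    ∃ κ : Measure U₀, MeasurableEmbedding (fun y : U₀ ↦ F y) ∧
      paramMeasure n U₀ F = κ.map (fun y : U₀ ↦ F y) ∧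
      κ.map Subtype.val = (volume.restrict U₀).withDensity
        fun y ↦ ENNReal.ofReal (density (pullMetric n F) y) := by
  have hcont : Continuous fun y : U₀ ↦ F y :=
    continuousOn_iff_continuous_domRestrict.1 h.contMDiffOn.continuousOn
  have hemb : Topology.IsOpenEmbedding (fun y : U₀ ↦ F y) := by
    refine .of_continuous_injective_isOpenMap hcont
      (Set.injOn_iff_injective.1 hi) fun W hW ↦ ?_
    have := h.isOpen_image (h.isOpen.isOpenMap_subtype_val W hW)
      (Subtype.coe_image_subset U₀ W)
    rwa [Set.image_image] at this
  set μ : Measure (Eucl n) := (volume : Measure (Eucl n)).withDensity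
    fun y ↦ ENNReal.ofReal (density (pullMetric n F) y) with hμ
  have h1 : (μ.comap Subtype.val : Measure U₀).map Subtype.val =
      (volume.restrict U₀).withDensity
        fun y ↦ ENNReal.ofReal (density (pullMetric n F) y) := by
    rw [map_comap_subtype_coe h.isOpen.measurableSet, hμ,
      restrict_withDensity h.isOpen.measurableSet]
  refine ⟨μ.comap Subtype.val, hemb.measurableEmbedding, ?_, h1⟩
  change Measure.map F ((volume.restrict U₀).withDensity
        fun y ↦ ENNReal.ofReal (density (pullMetric n F) y)) = _
  rw [← h1, AEMeasurable.map_map_of_aemeasurable _ measurable_subtype_coe.aemeasurable]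
  · rfl
  · rw [h1]
    exact (h.contMDiffOn.continuousOn.aemeasurable h.isOpen.measurableSet).mono_ac
      (withDensity_absolutelyContinuous _ _)

theorem IsRegularOn.aemeasurable_density (h : IsRegularOn F U₀) :
    AEMeasurable (fun y ↦ ENNReal.ofReal (density (pullMetric n F) y)) (volume.restrict U₀) :=
  (h.contDiffOn_density.continuousOn.aemeasurable h.isOpen.measurableSet).ennreal_ofReal

theorem IsRegularOn.integrableOn_riemVol_iff (h : IsRegularOn F U₀) (hi : Set.InjOn F U₀)
    {g : M → ℝ} : IntegrableOn g (F '' U₀) (riemVol n M) ↔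
      IntegrableOn (fun y ↦ density (pullMetric n F) y * g (F y)) U₀ := by
  obtain ⟨κ, h1, h2, h3⟩ := h.paramMeasure_eq hi
  rw [IntegrableOn, h.riemVol_restrict hi, h2, h1.integrable_map_iff]
  have h4 := (MeasurableEmbedding.subtype_coe h.isOpen.measurableSet).integrable_map_iff
    (μ := κ) (g := g ∘ F)
  rw [h3, integrable_withDensity_iff_integrable_smul₀' h.aemeasurable_density (by simp)] at h4
  refine h4.symm.trans (integrable_congr (.of_forall fun y ↦ ?_))
  simp [ENNReal.toReal_ofReal (Real.sqrt_nonneg _), density]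

theorem IsRegularOn.setIntegral_riemVol (h : IsRegularOn F U₀) (hi : Set.InjOn F U₀)
    (g : M → ℝ) : ∫ x in F '' U₀, g x ∂(riemVol n M) =
      ∫ y in U₀, density (pullMetric n F) y * g (F y) := by
  obtain ⟨κ, h1, h2, h3⟩ := h.paramMeasure_eq hi
  rw [h.riemVol_restrict hi, h2, h1.integral_map]
  have h4 := (MeasurableEmbedding.subtype_coe h.isOpen.measurableSet).integral_map
    (μ := κ) (g ∘ F)
  rw [h3, integral_withDensity_eq_integral_toReal_smul₀ h.aemeasurable_density (by simp)] at h4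
  refine h4.symm.trans (integral_congr_ae (.of_forall fun y ↦ ?_))
  simp [ENNReal.toReal_ofReal (Real.sqrt_nonneg _), density]

end Param

/-! ### The surface measure of a geodesic sphere -/

section Stereo

variable {k : ℕ}

/-- The inverse stereographic projection parametrizes the unit sphere without one point. -/
theorem exists_sphere_param (v : Metric.sphere (0 : Eucl (k + 1)) 1) :
    ∃ T : Eucl k → Eucl (k + 1), ContDiff ℝ ∞ T ∧ (∀ y, ‖T y‖ = 1) ∧ Function.Injective T ∧
      (∀ y, Function.Injective (fderiv ℝ T y)) ∧
      ∀ ξ : Metric.sphere (0 : Eucl (k + 1)) 1, ξ ≠ v → (ξ : Eucl (k + 1)) ∈ Set.range T := by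
  have hv : ‖(v : Eucl (k + 1))‖ = 1 := by simp
  have : Fact (Module.finrank ℝ (Eucl (k + 1)) = k + 1) := ⟨by simp⟩
  have hv0 : (v : Eucl (k + 1)) ≠ 0 := by
    intro h; rw [h, norm_zero] at hv; exact zero_ne_one hv
  let e := (OrthonormalBasis.fromOrthogonalSpanSingleton (𝕜 := ℝ) k hv0).repr.symm
  set T : Eucl k → Eucl (k + 1) := fun y ↦ stereoInvFun hv (e y) with hT
  have hTc : ContDiff ℝ ∞ T :=
    contDiff_stereoInvFunAux.comp ((Submodule.subtypeL _).contDiff.comp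
      e.toContinuousLinearEquiv.contDiff)
  have hinv : ∀ y, stereoToFun (v : Eucl (k + 1)) (T y) = e y := fun y ↦
    stereo_right_inv hv (e y)
  refine ⟨T, hTc, fun y ↦ norm_eq_of_mem_sphere _, fun y z hyz ↦ ?_, fun y ↦ ?_, fun ξ hξ ↦ ?_⟩
  · apply e.injective
    rw [← hinv, ← hinv, hyz]
  · have hne : T y ∈ {x : Eucl (k + 1) | innerSL ℝ (v : Eucl (k + 1)) x ≠ (1 : ℝ)} := by
      intro h
      have h1 : inner ℝ (v : Eucl (k + 1)) (T y) = 1 := h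
      rw [inner_eq_one_iff_of_norm_eq_one hv (norm_eq_of_mem_sphere _)] at h1
      exact stereoInvFun_ne_north_pole hv (e y) (Subtype.ext h1.symm)
    have hopen : IsOpen {x : Eucl (k + 1) | innerSL ℝ (v : Eucl (k + 1)) x ≠ (1 : ℝ)} :=
      isOpen_ne.preimage (innerSL ℝ (v : Eucl (k + 1))).continuous
    have h2 := (((contDiffOn_stereoToFun (n := 1)).contDiffAt (hopen.mem_nhds hne)).differentiableAt
      (by simp)).hasFDerivAt.comp y (hTc.differentiable (by simp) y).hasFDerivAt
    have h3 : stereoToFun (v : Eucl (k + 1)) ∘ T = e := funext hinv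
    rw [h3] at h2
    have h4 := h2.unique e.toContinuousLinearEquiv.hasFDerivAt
    intro a b hab
    apply e.injective
    have h5 : ∀ a, e a = _ := fun a ↦ (congrArg (fun L ↦ L a) h4).symm
    rw [h5, h5]
    exact congrArg (fderiv ℝ (stereoToFun (v : Eucl (k + 1))) (T y)) hab
  · refine ⟨e.symm (stereoToFun (v : Eucl (k + 1)) ξ), ?_⟩
    simp only [hT, LinearIsometryEquiv.apply_symm_apply]
    rw [stereo_left_inv hv fun h ↦ hξ (Subtype.ext h)]

end Stereo

section Sphere

variable {k : ℕ} {M : Type*} [EMetricSpace M] [ChartedSpace (Eucl (k + 1)) M]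
  [RiemannianBundle (fun x : M ↦ TangentSpace (𝓡 (k + 1)) x)]
  [IsManifold (𝓡 (k + 1)) ∞ M]
  [IsContMDiffRiemannianBundle (𝓡 (k + 1)) ∞ (EuclideanSpace ℝ (Fin (k + 1)))
      (fun x : M ↦ TangentSpace (𝓡 (k + 1)) x)]
  [IsRiemannianManifold (𝓡 (k + 1)) M] [MeasurableSpace M] [BorelSpace M]
  {p : M} {R t : ℝ} {F : Eucl (k + 1) → M}

/-- In normal coordinates, the Gram determinant of a parametrization `F (t • T y)` of the geodesic
sphere of radius `t`: by the Gauss lemma, the radial direction is orthogonal to the sphere. -/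
theorem IsNormalChart.det_gram_sphere (h : IsNormalChart p R F) (ht : 0 < t) {G : Eucl k → M}
    {T : Eucl k → Eucl (k + 1)} {y : Eucl k} (hT : DifferentiableAt ℝ T y)
    (hT1 : ∀ᶠ z in nhds y, ‖T z‖ = 1) (hy : t • T y ∈ Metric.ball (0 : Eucl (k + 1)) R)
    (hG : G =ᶠ[nhds y] F ∘ fun z ↦ t • T z) :
    (gram (k + 1) G y).det = (t ^ k) ^ 2 * ((matrixOf (pullMetric (k + 1) F) (t • T y)).det *
      (coneDeriv (T y) (fderiv ℝ T y)).det ^ 2) := by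
  set c := pullMetric (k + 1) F with hc
  set L := coneDeriv (T y) (fderiv ℝ T y) with hL
  have hL0 : L (EuclideanSpace.single 0 1) = T y := by
    rw [hL, coneDeriv_apply, splitFirst_single_zero]; simp
  have hLs : ∀ i : Fin k, L (EuclideanSpace.single i.succ 1) =
      fderiv ℝ T y (EuclideanSpace.single i 1) := fun i ↦ by
    rw [hL, coneDeriv_apply, splitFirst_single_succ]; simp
  have hgauss : ∀ v, c (t • T y) (T y) v = inner ℝ (T y) v := by
    intro v
    have := h.gauss _ hy v
    rw [map_smul, smul_apply, inner_smul_left, smul_eq_mul] at this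
    exact mul_left_cancel₀ ht.ne' this
  have horth : ∀ v, inner ℝ (T y) (fderiv ℝ T y v) = 0 := by
    intro v
    have h1 : (fun z ↦ ‖T z‖ ^ 2) =ᶠ[nhds y] fun _ ↦ (1 : ℝ) := by
      filter_upwards [hT1] with z hz
      rw [hz, one_pow]
    have h2 := h1.fderiv_eq (𝕜 := ℝ)
    rw [hT.hasFDerivAt.norm_sq.fderiv] at h2
    have h3 := congrArg (fun l : Eucl k →L[ℝ] ℝ ↦ l v) h2
    simpa using! h3
  have hdτ : ∀ v, fderiv ℝ (fun z ↦ t • T z) y v = t • fderiv ℝ T y v := fun v ↦ by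
    rw [fderiv_fun_const_smul hT]; rfl
  rw [← det_bilin_comp, Matrix.det_succ_row_zero, Fin.sum_univ_succ]
  have hz : ∀ j : Fin k, (Matrix.of fun i j ↦ c (t • T y) (L (EuclideanSpace.single i 1))
      (L (EuclideanSpace.single j 1))) 0 j.succ = 0 := by
    intro j
    rw [Matrix.of_apply, hL0, hLs, hgauss, horth]
  have h00 : (Matrix.of fun i j ↦ c (t • T y) (L (EuclideanSpace.single i 1))
      (L (EuclideanSpace.single j 1))) 0 0 = 1 := by
    rw [Matrix.of_apply, hL0, hgauss, real_inner_self_eq_norm_sq, hT1.self_of_nhds, one_pow]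
  simp only [hz, h00, mul_zero, zero_mul, Finset.sum_const_zero, add_zero, Fin.val_zero, pow_zero,
    one_mul]
  have hgram : gram (k + 1) G y = t ^ 2 • (Matrix.of fun i j ↦
      c (t • T y) (L (EuclideanSpace.single i 1)) (L (EuclideanSpace.single j 1))).submatrix
        Fin.succ (Fin.succAbove 0) := by
    ext i j
    have h1 : gram (k + 1) G y i j = c (t • T y) _ _ :=
      h.isRegularOn.pullMetric_comp (T := fun z ↦ t • T z) (hT.const_smul t) hy hG
        (EuclideanSpace.single i 1) (EuclideanSpace.single j 1)
    rw [h1, hdτ, hdτ]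
    simp only [Fin.succAbove_zero, Matrix.smul_apply, Matrix.submatrix_apply, Matrix.of_apply, hLs,
      map_smul, smul_apply, smul_eq_mul]
    ring
  rw [hgram, Matrix.det_smul, Fintype.card_fin, ← pow_mul, ← pow_mul, mul_comm 2 k]

/-- The measure `√(det c)(t ξ) tᵏ dξ` on the geodesic sphere of radius `t`, where `c` is the metric
in the normal coordinates `F` and `dξ` the surface measure of the Euclidean unit sphere. -/
def normalSphereMeasure (F : Eucl (k + 1) → M) (t : ℝ) : Measure M :=
  ((volume : Measure (Eucl (k + 1))).toSphere.withDensity fun ξ ↦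
    ENNReal.ofReal (t ^ k * density (pullMetric (k + 1) F) (t • (ξ : Eucl (k + 1))))).map
      fun ξ : Metric.sphere (0 : Eucl (k + 1)) 1 ↦ F (t • (ξ : Eucl (k + 1)))

theorem smul_sphere_mem_ball (ht : 0 < t) (htR : t < R) {ξ : Eucl (k + 1)} (hξ : ‖ξ‖ = 1) :
    t • ξ ∈ Metric.ball (0 : Eucl (k + 1)) R := by
  rw [mem_ball_zero_iff, norm_smul, hξ, mul_one, Real.norm_of_nonneg ht.le]
  exact htR

theorem IsNormalChart.continuous_sphere (h : IsNormalChart p R F) (ht : 0 < t) (htR : t < R) :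
    Continuous fun ξ : Metric.sphere (0 : Eucl (k + 1)) 1 ↦ F (t • (ξ : Eucl (k + 1))) :=
  h.contMDiffOn.continuousOn.comp_continuous (by fun_prop)
    fun ξ ↦ smul_sphere_mem_ball ht htR (by simp)

theorem IsNormalChart.continuous_density_sphere (h : IsNormalChart p R F) (ht : 0 < t)
    (htR : t < R) : Continuous fun ξ : Metric.sphere (0 : Eucl (k + 1)) 1 ↦
      density (pullMetric (k + 1) F) (t • (ξ : Eucl (k + 1))) :=
  h.isRegularOn.contDiffOn_density.continuousOn.comp_continuous (by fun_prop)
    fun ξ ↦ smul_sphere_mem_ball ht htR (by simp)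

theorem IsNormalChart.normalSphereMeasure_apply (h : IsNormalChart p R F) (ht : 0 < t)
    (htR : t < R) {A : Set M} (hA : MeasurableSet A) : normalSphereMeasure F t A =
      ∫⁻ ξ in {ξ : Metric.sphere (0 : Eucl (k + 1)) 1 | F (t • (ξ : Eucl (k + 1))) ∈ A},
        ENNReal.ofReal (t ^ k * density (pullMetric (k + 1) F) (t • (ξ : Eucl (k + 1))))
        ∂(volume : Measure (Eucl (k + 1))).toSphere := by
  rw [normalSphereMeasure, Measure.map_apply (h.continuous_sphere ht htR).measurable hA,
    withDensity_apply']
  rfl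

/-- The measure given by a local parametrization `G` of the geodesic sphere is the restriction of
`normalSphereMeasure` to the image of `G`. -/
theorem IsNormalChart.paramMeasure_sphere (h : IsNormalChart p R F) (ht : 0 < t) (htR : t < R)
    {U : Set (Eucl k)} {G : Eucl k → M} (hG : IsLocalParam (k + 1) (geodSphere p t) U G)
    {A : Set M} (hA : MeasurableSet A) :
    paramMeasure (k + 1) U G A =
      ∫⁻ ξ in {ξ : Metric.sphere (0 : Eucl (k + 1)) 1 | F (t • (ξ : Eucl (k + 1))) ∈ A ∩ G '' U},
        ENNReal.ofReal (t ^ k * density (pullMetric (k + 1) F) (t • (ξ : Eucl (k + 1))))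
        ∂(volume : Measure (Eucl (k + 1))).toSphere := by
  classical
  have hsub : Metric.sphere (0 : Eucl (k + 1)) t ⊆ Metric.ball 0 R := fun z hz ↦ by
    rw [mem_sphere_zero_iff_norm] at hz
    rw [mem_ball_zero_iff, hz]
    exact htR
  have hGF : ∀ y ∈ U, G y ∈ F '' Metric.sphere 0 t := fun y hy ↦ by
    rw [← h.geodSphere_eq ht htR]
    exact hG.mapsTo hy
  set τ := Function.invFunOn F (Metric.ball (0 : Eucl (k + 1)) R) ∘ G with hτ
  have hτn : ∀ y ∈ U, ‖τ y‖ = t := by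
    intro y hy
    obtain ⟨z, hz, hzG⟩ := hGF y hy
    have : τ y = z := by
      rw [hτ, Function.comp_apply, ← hzG]
      exact h.injOn.leftInvOn_invFunOn (hsub hz)
    rw [this]
    simpa using hz
  have hlift := fun y (hy : y ∈ U) ↦ h.isRegularOn.lift h.injOn hG hy
    (Set.image_mono hsub (hGF y hy))
  set T : Eucl k → Eucl (k + 1) := fun y ↦ t⁻¹ • τ y with hT
  have htT : ∀ y, t • T y = τ y := fun y ↦ by rw [hT]; exact smul_inv_smul₀ ht.ne' _
  have hTn : ∀ y ∈ U, ‖T y‖ = 1 := fun y hy ↦ by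
    rw [hT, norm_smul, hτn y hy, norm_inv, Real.norm_of_nonneg ht.le, inv_mul_cancel₀ ht.ne']
  have hTd : ∀ y ∈ U, ContDiffAt ℝ 1 T y := fun y hy ↦ contDiffAt_const.fun_smul (hlift y hy).2.2.1
  have hFT : ∀ y ∈ U, F (t • T y) = G y := fun y hy ↦ by rw [htT]; exact (hlift y hy).2.1
  have hTinj : Set.InjOn T U := by
    intro y hy z hz hyz
    refine hG.injOn hy hz ?_
    rw [← hFT y hy, ← hFT z hz, hyz]
  set V := U ∩ G ⁻¹' A with hV
  have hVU : V ⊆ U := Set.inter_subset_left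
  have hVm : MeasurableSet V := measurableSet_inter_preimage hG.contMDiffOn.continuousOn
      hG.isOpen.measurableSet hA
  have hTc : ContDiffOn ℝ 1 T U := fun y hy ↦ (hTd y hy).contDiffWithinAt
  have hJ : AEMeasurable (fun y ↦ ENNReal.ofReal |(coneDeriv (T y) (fderiv ℝ T y)).det|)
      (volume.restrict V) := by
    have h1 : ContinuousOn (fun y ↦ coneDeriv (T y) (fderiv ℝ T y)) U := by
      have h2 : ContinuousOn (fderiv ℝ T) U := hTc.continuousOn_fderiv_of_isOpen hG.isOpen le_rfl
      have h3 : ContinuousOn T U := hTc.continuousOn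
      unfold coneDeriv
      refine ContinuousOn.clm_comp (ContinuousOn.add ?_ (h2.clm_comp continuousOn_const))
        continuousOn_const
      exact (ContinuousLinearMap.smulRightL ℝ (ℝ × Eucl k) (Eucl (k + 1))
        (ContinuousLinearMap.fst ℝ ℝ (Eucl k))).continuous.comp_continuousOn h3
    exact ((ContinuousLinearMap.continuous_det.comp_continuousOn h1).abs.mono hVU).aemeasurable hVm
      |>.ennreal_ofReal
  -- cut off outside the unit sphere, to be measurable on all of `ℝᵏ⁺¹`
  set ρ : Eucl (k + 1) → ℝ≥0∞ := (Metric.sphere (0 : Eucl (k + 1)) 1).indicator fun ξ ↦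
    ENNReal.ofReal (t ^ k * density (pullMetric (k + 1) F) (t • ξ)) with hρ
  have hρm : Measurable ρ := by
    rw [hρ, ← Set.piecewise_eq_indicator]
    refine ContinuousOn.measurable_piecewise ?_ continuousOn_const
      Metric.isClosed_sphere.measurableSet
    refine ENNReal.continuous_ofReal.comp_continuousOn (continuousOn_const.mul ?_)
    refine h.isRegularOn.contDiffOn_density.continuousOn.comp (by fun_prop) fun ξ hξ ↦ ?_
    exact smul_sphere_mem_ball ht htR (by simpa using hξ)
  have hρ1 : ∀ ξ : Eucl (k + 1), ‖ξ‖ = 1 →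
      ρ ξ = ENNReal.ofReal (t ^ k * density (pullMetric (k + 1) F) (t • ξ)) := fun ξ hξ ↦
    Set.indicator_of_mem (by simpa using hξ) _
  have hset : {ξ : Metric.sphere (0 : Eucl (k + 1)) 1 | F (t • (ξ : Eucl (k + 1))) ∈ A ∩ G '' U} =
      Subtype.val ⁻¹' (T '' V) := by
    ext ξ
    have hξ : ‖(ξ : Eucl (k + 1))‖ = 1 := by simp
    constructor
    · rintro ⟨h1, y, hy, h2⟩
      refine ⟨y, ⟨hy, ?_⟩, ?_⟩
      · rw [Set.mem_preimage, h2]; exact h1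
      · have h3 := h.injOn (smul_sphere_mem_ball ht htR (hTn y hy))
          (smul_sphere_mem_ball ht htR hξ) ((hFT y hy).trans h2)
        exact smul_right_injective _ ht.ne' h3
    · rintro ⟨y, hy, h2⟩
      rw [Set.mem_ofPred_eq, ← h2, hFT y hy.1]
      exact ⟨hy.2, Set.mem_image_of_mem G hy.1⟩
  calc paramMeasure (k + 1) U G A
      = ∫⁻ y in V, ENNReal.ofReal |(coneDeriv (T y) (fderiv ℝ T y)).det| * ρ (T y) := by
        rw [hG.paramMeasure_apply hA]
        refine setLIntegral_congr_fun hVm fun y hy ↦ ?_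
        have hGF' : G =ᶠ[nhds y] F ∘ fun z ↦ t • T z := by
          filter_upwards [(hlift y hy.1).2.2.2] with z hz
          rw [Function.comp_apply, htT]
          exact hz
        have hdet := h.det_gram_sphere ht ((hTd y hy.1).differentiableAt (by simp))
          (Filter.eventually_of_mem (hG.isOpen.mem_nhds hy.1) hTn)
          (smul_sphere_mem_ball ht htR (hTn y hy.1)) hGF'
        rw [hdet, hρ1 _ (hTn y hy.1), ← ENNReal.ofReal_mul (abs_nonneg _),
          Real.sqrt_mul (sq_nonneg _), Real.sqrt_mul' _ (sq_nonneg _),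
          Real.sqrt_sq (pow_nonneg ht.le k), Real.sqrt_sq_eq_abs, density]
        congr 1
        ring
    _ = ∫⁻ ξ in Subtype.val ⁻¹' (T '' V), ρ (ξ : Eucl (k + 1))
          ∂(volume : Measure (Eucl (k + 1))).toSphere :=
        (lintegral_toSphere_image hVm
          (fun y hy ↦ ((hTd y hy.1).differentiableAt (by simp)).hasFDerivAt)
          (fun y hy ↦ hTn y hy.1) (hTinj.mono hVU) hJ hρm).symm
    _ = _ := by
        rw [hset]
        exact lintegral_congr fun ξ ↦ hρ1 _ (by simp)

theorem IsNormalChart.isLocalParam_sphere (h : IsNormalChart p R F) (ht : 0 < t) (htR : t < R)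
    {T : Eucl k → Eucl (k + 1)} (hT : ContDiff ℝ ∞ T) (hT1 : ∀ y, ‖T y‖ = 1)
    (hinj : Function.Injective T) (himm : ∀ y, Function.Injective (fderiv ℝ T y)) :
    IsLocalParam (k + 1) (geodSphere p t) Set.univ fun y ↦ F (t • T y) := by
  have hmem := fun y ↦ smul_sphere_mem_ball ht htR (hT1 y)
  have hd : ContDiff ℝ ∞ fun y ↦ t • T y := contDiff_const.fun_smul hT
  refine ⟨isOpen_univ, ?_, fun y _ z _ hyz ↦ ?_, fun y _ ↦ ?_, fun y _ ↦ ?_⟩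
  · exact (h.contMDiffOn.comp hd.contMDiff.contMDiffOn fun y _ ↦ hmem y).of_le
      (WithTop.coe_le_coe.2 le_top)
  · exact hinj (smul_right_injective _ ht.ne' (h.injOn (hmem y) (hmem z) hyz))
  · have h1 := mfderiv_comp (I := 𝓡 k) (I' := 𝓡 (k + 1)) (I'' := 𝓡 (k + 1)) (g := F)
      (f := fun y ↦ t • T y) y (h.isRegularOn.mdifferentiableAt (hmem y))
      (hd.differentiable (by simp) y).mdifferentiableAt
    rw [mfderiv_eq_fderiv] at h1
    have h2 : ∀ v, mfderiv (𝓡 k) (𝓡 (k + 1)) (fun y ↦ F (t • T y)) y v =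
        mfderiv (𝓡 (k + 1)) (𝓡 (k + 1)) F (t • T y) (t • fderiv ℝ T y v) := fun v ↦ by
      have h3 : fderiv ℝ (fun z ↦ t • T z) y v = t • fderiv ℝ T y v := by
        rw [fderiv_fun_const_smul (hT.differentiable (by simp) y)]; rfl
      exact (congrArg (fun L : Eucl k →L[ℝ] Eucl (k + 1) ↦ L v) h1).trans
        (congrArg (fun w : Eucl (k + 1) ↦
          (mfderiv (𝓡 (k + 1)) (𝓡 (k + 1)) F (t • T y) : Eucl (k + 1) →L[ℝ] Eucl (k + 1)) w) h3)
    intro v w hvw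
    exact himm y (smul_right_injective _ ht.ne'
      (h.immersion _ (hmem y) (((h2 v).symm.trans hvw).trans (h2 w))))
  · rw [h.geodSphere_eq ht htR]
    refine Set.mem_image_of_mem F ?_
    rw [mem_sphere_zero_iff_norm, norm_smul, hT1, mul_one, Real.norm_of_nonneg ht.le]

/-- The surface measure of a geodesic sphere in normal coordinates. -/
theorem IsNormalChart.sphereMeasure_eq (h : IsNormalChart p R F) (ht : 0 < t) (htR : t < R) :
    sphereMeasure (k + 1) p t = normalSphereMeasure F t := by
  change submanifoldMeasure (k + 1) k (geodSphere p t) = _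
  refine le_antisymm ?_ ?_
  · rw [← Measure.restrict_univ (μ := submanifoldMeasure (k + 1) k (geodSphere p t))]
    refine submanifoldMeasure_restrict_le MeasurableSet.univ fun U G hG ↦ ?_
    rw [Measure.restrict_univ]
    refine Measure.le_iff.2 fun A hA ↦ ?_
    rw [h.paramMeasure_sphere ht htR hG hA, h.normalSphereMeasure_apply ht htR hA]
    exact lintegral_mono_set fun ξ hξ ↦ hξ.1
  · -- a stereographic parametrization covers the sphere except for the point `F (t • v)`
    have key : ∀ (v : Metric.sphere (0 : Eucl (k + 1)) 1) (A : Set M), MeasurableSet A →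
        F (t • (v : Eucl (k + 1))) ∉ A → normalSphereMeasure F t A ≤
          submanifoldMeasure (k + 1) k (geodSphere p t) A := by
      intro v A hA hvA
      obtain ⟨T, hT, hT1, hinj, himm, hran⟩ := exists_sphere_param v
      have hG := h.isLocalParam_sphere ht htR hT hT1 hinj himm
      refine le_trans ?_ (Measure.le_iff.1 hG.paramMeasure_le A hA)
      rw [h.paramMeasure_sphere ht htR hG hA, h.normalSphereMeasure_apply ht htR hA]
      refine lintegral_mono_set fun ξ hξ ↦ ⟨hξ, ?_⟩
      obtain ⟨y, hy⟩ := hran ξ fun hv ↦ hvA (hv ▸ hξ)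
      exact ⟨y, Set.mem_univ _, by simp only [hy]⟩
    refine Measure.le_iff.2 fun A hA ↦ ?_
    let v : Metric.sphere (0 : Eucl (k + 1)) 1 := ⟨EuclideanSpace.single 0 1, by simp⟩
    have hne : F (t • ((-v : Metric.sphere (0 : Eucl (k + 1)) 1) : Eucl (k + 1))) ≠
        F (t • (v : Eucl (k + 1))) := by
      intro hF
      have h1 := smul_right_injective _ ht.ne' (h.injOn
        (smul_sphere_mem_ball ht htR (by simp)) (smul_sphere_mem_ball ht htR (by simp)) hF)
      exact ne_neg_of_mem_unit_sphere ℝ v (Subtype.ext h1.symm)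
    -- `A ∩ {F (t • v)}` misses `F (t • (-v))`, and the rest of `A` misses `F (t • v)`
    have hms : MeasurableSet {F (t • (v : Eucl (k + 1)))} := measurableSet_singleton _
    rw [← measure_inter_add_sdiff A hms,
      ← measure_inter_add_sdiff (μ := submanifoldMeasure (k + 1) k (geodSphere p t)) A hms]
    exact add_le_add (key (-v) _ (hA.inter hms) fun hm ↦ hne hm.2)
      (key v _ (hA.diff hms) fun hm ↦ hm.2 rfl)

/-- Integration over a geodesic sphere in normal coordinates. -/
theorem IsNormalChart.integral_sphereMeasure (h : IsNormalChart p R F) (ht : 0 < t) (htR : t < R)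
    {g : M → ℝ} {g' : Metric.sphere (0 : Eucl (k + 1)) 1 → ℝ} (hg' : Continuous g')
    (hgg' : ∀ ξ : Metric.sphere (0 : Eucl (k + 1)) 1, g (F (t • (ξ : Eucl (k + 1)))) = g' ξ) :
    Integrable g (sphereMeasure (k + 1) p t) ∧
    ∫ x, g x ∂(sphereMeasure (k + 1) p t) = t ^ k *
      ∫ ξ, density (pullMetric (k + 1) F) (t • (ξ : Eucl (k + 1))) * g' ξ
        ∂(volume : Measure (Eucl (k + 1))).toSphere := by
  have hc := h.continuous_sphere ht htR
  have hemb : MeasurableEmbedding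
      fun ξ : Metric.sphere (0 : Eucl (k + 1)) 1 ↦ F (t • (ξ : Eucl (k + 1))) := by
    refine (hc.isClosedEmbedding fun ξ η hξη ↦ ?_).measurableEmbedding
    exact Subtype.ext (smul_right_injective _ ht.ne' (h.injOn
        (smul_sphere_mem_ball ht htR (by simp)) (smul_sphere_mem_ball ht htR (by simp)) hξη))
  have hdc := (continuous_const (y := t ^ k)).mul (h.continuous_density_sphere ht htR)
  have hρ : AEMeasurable (fun ξ : Metric.sphere (0 : Eucl (k + 1)) 1 ↦ ENNReal.ofReal
      (t ^ k * density (pullMetric (k + 1) F) (t • (ξ : Eucl (k + 1)))))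
      (volume : Measure (Eucl (k + 1))).toSphere := hdc.measurable.ennreal_ofReal.aemeasurable
  have hpos : ∀ ξ : Metric.sphere (0 : Eucl (k + 1)) 1,
      0 ≤ t ^ k * density (pullMetric (k + 1) F) (t • (ξ : Eucl (k + 1))) := fun ξ ↦
    mul_nonneg (by positivity) (Real.sqrt_nonneg _)
  have hcomp : g ∘ (fun ξ : Metric.sphere (0 : Eucl (k + 1)) 1 ↦ F (t • (ξ : Eucl (k + 1)))) = g' :=
    funext hgg'
  rw [h.sphereMeasure_eq ht htR, normalSphereMeasure, hemb.integrable_map_iff, hemb.integral_map,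
    hcomp]
  simp only [hgg']
  rw [integrable_withDensity_iff_integrable_smul₀' hρ (by simp),
    integral_withDensity_eq_integral_toReal_smul₀ hρ (by simp)]
  simp only [ENNReal.toReal_ofReal (hpos _), smul_eq_mul]
  refine ⟨(hdc.mul hg').integrable_of_hasCompactSupport (.of_compactSpace _), ?_⟩
  simp only [mul_assoc]
  exact integral_const_mul _ _

end Sphere

/-! ### The distance function and vector fields in normal coordinates -/

section Field

variable {n : ℕ} {M : Type*} [EMetricSpace M] [ChartedSpace (Eucl n) M]
  [RiemannianBundle (fun x : M ↦ TangentSpace (𝓡 n) x)]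
  [IsManifold (𝓡 n) ∞ M]
  [IsContMDiffRiemannianBundle (𝓡 n) ∞ (EuclideanSpace ℝ (Fin n))
      (fun x : M ↦ TangentSpace (𝓡 n) x)]

variable {F : Eucl n → M} {U : Set (Eucl n)}

/-- A smooth vector field on `M` in the coordinates `F`. -/
theorem IsRegularOn.exists_pullback_field (h : IsRegularOn F U) {W : Set M} (hW : IsOpen W)
    {X : ∀ x : M, TangentSpace (𝓡 n) x}
    (hX : ContMDiffOn (𝓡 n) (𝓡 n).tangent ∞
        (fun x ↦ (⟨x, X x⟩ : TangentBundle (𝓡 n) M)) W) :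
    ∃ Z : Eucl n → Eucl n, ∀ y ∈ U, F y ∈ W → ContDiffAt ℝ ∞ Z y ∧
      mfderiv (𝓡 n) (𝓡 n) F y (Z y) = X (F y) := by
  -- the covector field dual to `X`, whose pullback requires no inverse of the differential of `F`
  set l : Eucl n → Eucl n →L[ℝ] ℝ := fun y ↦
    (innerSL ℝ (E := TangentSpace (𝓡 n) (F y)) (X (F y))).comp (mfderiv (𝓡 n) (𝓡 n) F y) with hl
  have hlw : ∀ y w, l y w = inner ℝ (X (F y)) (mfderiv (𝓡 n) (𝓡 n) F y w) := fun _ _ ↦ rfl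
  have hV : IsOpen (U ∩ F ⁻¹' W) := h.contMDiffOn.continuousOn.isOpen_inter_preimage h.isOpen hW
  refine ⟨fun y ↦ (pullMetric n F y).inverse (l y), fun y hy hyW ↦ ⟨?_, ?_⟩⟩
  · have hl' : ContDiffOn ℝ ∞ l (U ∩ F ⁻¹' W) := by
      refine contDiffOn_clm_apply.2 fun w ↦ ?_
      rw [← contMDiffOn_iff_contDiffOn]
      have h1 : ContMDiffOn (𝓡 n) (𝓡 n).tangent ∞
          (fun z ↦ (⟨F z, X (F z)⟩ : TangentBundle (𝓡 n) M)) (U ∩ F ⁻¹' W) :=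
        hX.comp (h.contMDiffOn.mono Set.inter_subset_left) fun z hz ↦ hz.2
      have h2 := h.contMDiffOn.contMDiffOn_tangentMapWithin (m := ∞) (by simp)
        h.isOpen.uniqueMDiffOn
      have h3 : ContMDiff (𝓡 n) (𝓡 n).tangent ∞
          (fun z : Eucl n ↦ (⟨z, w⟩ : TangentBundle (𝓡 n) (Eucl n))) :=
        contMDiff_vectorSpace_iff_contDiff.2 contDiff_const
      have h4 : ContMDiffOn (𝓡 n) (𝓡 n).tangent ∞
          (fun z ↦ (⟨F z, mfderiv (𝓡 n) (𝓡 n) F z w⟩ : TangentBundle (𝓡 n) M))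
          (U ∩ F ⁻¹' W) := by
        refine ((h2.comp (h3.contMDiffOn (s := U)) (fun z hz ↦ hz)).mono
          Set.inter_subset_left).congr fun z hz ↦ ?_
        simp [tangentMapWithin, mfderivWithin_of_isOpen h.isOpen hz.1]
      exact h1.inner_bundle h4
    obtain ⟨e, he⟩ := h.isInvertible_metric hy
    have h5 : ContDiffAt ℝ ∞ ContinuousLinearMap.inverse (pullMetric n F y) := by
      rw [← he]; exact contDiffAt_map_inverse e
    exact (h5.comp y (h.contDiffAt_metric hy)).clm_apply (hl'.contDiffAt (hV.mem_nhds ⟨hy, hyW⟩))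
  · obtain ⟨v, hv⟩ := mfderiv_surjective h hy (X (F y))
    have h6 : l y = pullMetric n F y v := by
      ext w
      rw [hlw, ← hv]
      rfl
    have h7 : (pullMetric n F y).inverse (l y) = v := by
      rw [h6]
      exact (h.isInvertible_metric hy).inverse_apply_self v
    exact (congrArg (fun w : Eucl n ↦
      (mfderiv (𝓡 n) (𝓡 n) F y : Eucl n →L[ℝ] Eucl n) w) h7).trans hv

theorem fderiv_norm_apply {y : Eucl n} (hy : y ≠ 0) (w : Eucl n) :
    fderiv ℝ (fun z : Eucl n ↦ ‖z‖) y w = ‖y‖⁻¹ * inner ℝ y w := by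
  have h1 : HasFDerivAt (fun z : Eucl n ↦ ‖z‖) (fderiv ℝ (fun z : Eucl n ↦ ‖z‖) y) y :=
    ((contDiffAt_norm ℝ hy (n := 1)).differentiableAt (by simp)).hasFDerivAt
  have h2 := h1.pow 2
  have h3 := h2.unique (hasStrictFDerivAt_norm_sq y).hasFDerivAt
  have h4 := congrArg (fun L : Eucl n →L[ℝ] ℝ ↦ L w) h3
  have h5 : 2 * (‖y‖ * fderiv ℝ (fun z : Eucl n ↦ ‖z‖) y w) = 2 * inner ℝ y w := by
    simpa [mul_assoc, two_smul, two_mul, add_mul] using h4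
  have h6 : ‖y‖ ≠ 0 := norm_ne_zero_iff.2 hy
  field_simp
  linarith

theorem continuousAt_covDeriv {b : Eucl n → Eucl n →L[ℝ] Eucl n →L[ℝ] ℝ} {X : Eucl n → Eucl n}
    {y : Eucl n} (hb : ContDiffAt ℝ 1 b y) (hi : (b y).IsInvertible) (hX : ContDiffAt ℝ 1 X y) :
    ContinuousAt (covDeriv b X) y := by
  have hb' : ContinuousAt (fderiv ℝ b) y :=
    (hb.fderiv_right (m := 0) (by simp)).continuousAt
  have hX' : ContinuousAt (fderiv ℝ X) y :=
    (hX.fderiv_right (m := 0) (by simp)).continuousAt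
  have hinv : ContinuousAt (fun z ↦ (b z).inverse) y := by
    obtain ⟨e, he⟩ := hi
    have h2 : ContDiffAt ℝ 1 ContinuousLinearMap.inverse (b y) := by
      rw [← he]; exact contDiffAt_map_inverse e
    exact (h2.comp y hb).continuousAt
  have hXc : ContinuousAt X y := hX.continuousAt
  have h1 : ContinuousAt (fun z ↦ (fderiv ℝ b z).flip (X z)) y :=
    ((ContinuousLinearMap.flipₗᵢ ℝ (Eucl n) (Eucl n) (Eucl n →L[ℝ] ℝ)).continuous.continuousAt.comp
      hb').clm_apply hXc
  have h2 : ContinuousAt (fun z ↦ ((fderiv ℝ b z).flip (X z)).flip) y :=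
    (ContinuousLinearMap.flipₗᵢ ℝ (Eucl n) (Eucl n) ℝ).continuous.continuousAt.comp h1
  have h3 : ContinuousAt (fun z ↦ chrisL b z (X z)) y :=
    ((h1.add (hb'.clm_apply hXc)).sub h2).const_smul (1 / 2 : ℝ)
  exact hX'.add (hinv.clm_comp h3)

variable [IsRiemannianManifold (𝓡 n) M] {p : M} {R : ℝ}

theorem IsNormalChart.distFrom_comp_eventuallyEq (h : IsNormalChart p R F) {y : Eucl n}
    (hy : y ∈ Metric.ball (0 : Eucl n) R) :
    distFrom p ∘ F =ᶠ[nhds y] fun z ↦ ‖z‖ := by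
  filter_upwards [Metric.isOpen_ball.mem_nhds hy] with z hz using h.distFrom_eq hz

theorem IsNormalChart.contMDiffAt_distFrom (h : IsNormalChart p R F) {y : Eucl n}
    (hy : y ∈ Metric.ball (0 : Eucl n) R) (hy0 : y ≠ 0) :
    ContMDiffAt (𝓡 n) 𝓘(ℝ) ∞ (distFrom p) (F y) := by
  have hinv : Function.invFunOn F (Metric.ball 0 R) (F y) = y := h.injOn.leftInvOn_invFunOn hy
  have h1 : ContMDiffAt (𝓡 n) 𝓘(ℝ) ∞
      ((fun z : Eucl n ↦ ‖z‖) ∘ Function.invFunOn F (Metric.ball 0 R)) (F y) := by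
    refine ContMDiffAt.comp (I' := 𝓡 n) (F y) ?_ (h.isRegularOn.contMDiffAt_invFunOn h.injOn hy)
    rw [hinv]
    exact (contDiffAt_norm ℝ hy0).contMDiffAt
  refine h1.congr_of_eventuallyEq ?_
  filter_upwards [h.isRegularOn.image_mem_nhds hy (Metric.isOpen_ball.mem_nhds hy)]
  rintro _ ⟨z, hz, rfl⟩
  rw [h.distFrom_eq hz, Function.comp_apply, h.injOn.leftInvOn_invFunOn hz]

theorem IsNormalChart.gradOf_norm (h : IsNormalChart p R F) {y : Eucl n}
    (hy : y ∈ Metric.ball (0 : Eucl n) R) (hy0 : y ≠ 0) :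
    gradOf (pullMetric n F) (fun z ↦ ‖z‖) y = ‖y‖⁻¹ • y := by
  have h1 := (h.distFrom_comp_eventuallyEq hy)
  rw [← (gradOf_congr (pullMetric n F) h1).self_of_nhds]
  refine (grad_eq_of_radial h hy ((h.contMDiffAt_distFrom hy hy0).mdifferentiableAt (by simp))
    fun w ↦ ?_).1
  rw [h1.fderiv_eq, fderiv_norm_apply hy0]

theorem IsNormalChart.grad_distFrom (h : IsNormalChart p R F) {y : Eucl n}
    (hy : y ∈ Metric.ball (0 : Eucl n) R) (hy0 : y ≠ 0) :
    grad n (distFrom p) (F y) = mfderiv (𝓡 n) (𝓡 n) F y (‖y‖⁻¹ • y) ∧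
      ‖grad n (distFrom p) (F y)‖ = 1 := by
  have hd := (h.contMDiffAt_distFrom hy hy0).mdifferentiableAt (by simp)
  have h1 := h.distFrom_comp_eventuallyEq hy
  obtain ⟨h2, h3⟩ := grad_eq_of_radial h hy hd (κ := ‖y‖⁻¹) fun w ↦ by
    rw [h1.fderiv_eq, fderiv_norm_apply hy0]
  refine ⟨(grad_eq h.isRegularOn hy hd).trans ?_, ?_⟩
  · exact congrArg (fun w : Eucl n ↦ (mfderiv (𝓡 n) (𝓡 n) F y : Eucl n →L[ℝ] Eucl n) w) h2
  · rw [h3, abs_of_nonneg (by positivity), inv_mul_cancel₀ (norm_ne_zero_iff.2 hy0)]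

end Field

/-! ### The Pohozaev vector field in normal coordinates -/

section Radial

variable {n : ℕ}

/-- If `φ(r)⁻¹ ∂ᵣ` is a differentiable vector field, then `φ` is differentiable. -/
theorem differentiableAt_of_radial_field {φ : ℝ → ℝ} (hφ : ∀ s, 0 < s → 0 < φ s) {t : ℝ}
    {Z : Eucl n → Eucl n} (hZ : ∀ y ∈ Metric.ball (0 : Eucl n) t, DifferentiableAt ℝ Z y)
    (hZr : ∀ y ∈ Metric.ball (0 : Eucl n) t, y ≠ 0 → Z y = (φ ‖y‖)⁻¹ • (‖y‖⁻¹ • y))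
    {y : Eucl n} (hy : y ∈ Metric.ball (0 : Eucl n) t) (hy0 : y ≠ 0) :
    DifferentiableAt ℝ φ ‖y‖ := by
  have hny : 0 < ‖y‖ := norm_pos_iff.2 hy0
  set ξ := ‖y‖⁻¹ • y with hξ
  have hξ1 : ‖ξ‖ = 1 := by rw [hξ, norm_smul, norm_inv, norm_norm, inv_mul_cancel₀ hny.ne']
  have hmem : ∀ s ∈ Set.Ioo 0 t, s • ξ ∈ Metric.ball (0 : Eucl n) t := fun s hs ↦ by
    rw [mem_ball_zero_iff, norm_smul, hξ1, mul_one, Real.norm_of_nonneg hs.1.le]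
    exact hs.2
  -- `φ(s)⁻¹` is the radial component of `Z` along the ray through `y`
  have hval : ∀ s ∈ Set.Ioo 0 t, inner ℝ (Z (s • ξ)) ξ = (φ s)⁻¹ := fun s hs ↦ by
    have h1 : s • ξ ≠ 0 := smul_ne_zero hs.1.ne' (norm_ne_zero_iff.1 (hξ1 ▸ one_ne_zero))
    rw [hZr _ (hmem s hs) h1, norm_smul, hξ1, mul_one, Real.norm_of_nonneg hs.1.le,
      inv_smul_smul₀ hs.1.ne', inner_smul_left, real_inner_self_eq_norm_sq, hξ1]
    simp
  have hyI : ‖y‖ ∈ Set.Ioo 0 t := ⟨hny, by simpa using hy⟩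
  have hd : DifferentiableAt ℝ (fun s : ℝ ↦ inner ℝ (Z (s • ξ)) ξ) ‖y‖ := by
    refine DifferentiableAt.inner ℝ ?_ (differentiableAt_const _)
    exact (hZ _ (hmem _ hyI)).comp ‖y‖ (differentiableAt_id.smul_const ξ)
  refine (hd.inv (by rw [hval _ hyI]; exact (inv_pos.2 (hφ _ hny)).ne')).congr_of_eventuallyEq ?_
  filter_upwards [isOpen_Ioo.mem_nhds hyI] with s hs
  rw [Pi.inv_apply, hval s hs, inv_inv]

end Radial

section Pohozaev

variable {n : ℕ} {M : Type*} [EMetricSpace M] [ChartedSpace (Eucl n) M]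
  [RiemannianBundle (fun x : M ↦ TangentSpace (𝓡 n) x)]
  [IsManifold (𝓡 n) ∞ M]
  [IsContMDiffRiemannianBundle (𝓡 n) ∞ (EuclideanSpace ℝ (Fin n))
      (fun x : M ↦ TangentSpace (𝓡 n) x)]
  [IsRiemannianManifold (𝓡 n) M] {p : M} {R t : ℝ} {F : Eucl n → M}

/-- The divergence and the covariant derivative of the radial field `Z = φ(r)⁻¹ ∇r`. -/
theorem IsNormalChart.covDeriv_radial (h : IsNormalChart p R F) (htR : t < R) {φ : ℝ → ℝ}
    (hφ : ∀ s, 0 < s → 0 < φ s) {Z : Eucl n → Eucl n}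
    (hZ : ∀ y ∈ Metric.ball (0 : Eucl n) t, DifferentiableAt ℝ Z y)
    (hZr : ∀ y ∈ Metric.ball (0 : Eucl n) t, y ≠ 0 → Z y = (φ ‖y‖)⁻¹ • (‖y‖⁻¹ • y))
    {y : Eucl n} (hy : y ∈ Metric.ball (0 : Eucl n) t) (hy0 : y ≠ 0) :
    divOf (pullMetric n F) Z y = (φ ‖y‖ * laplacian n (distFrom p) (F y) - deriv φ ‖y‖) /
        φ ‖y‖ ^ 2 ∧
    ∀ v, pullMetric n F y (covDeriv (pullMetric n F) Z y v) v =
      (hessian n (distFrom p) (F y) (mfderiv (𝓡 n) (𝓡 n) F y v) (mfderiv (𝓡 n) (𝓡 n) F y v)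
        * φ ‖y‖ - deriv φ ‖y‖ * (‖y‖⁻¹ * inner ℝ y v) ^ 2) / φ ‖y‖ ^ 2 := by
  have hyR : y ∈ Metric.ball (0 : Eucl n) R := Metric.ball_subset_ball htR.le hy
  have hny : 0 < ‖y‖ := norm_pos_iff.2 hy0
  have hφy : φ ‖y‖ ≠ 0 := (hφ _ hny).ne'
  set c := pullMetric n F with hc
  have hcd : ContDiffAt ℝ ∞ c y := h.isRegularOn.contDiffAt_metric hyR
  have hs : ∀ᶠ z in nhds y, ∀ v w, c z v w = c z w v := .of_forall fun z ↦ pullMetric_symm n F z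
  have hi : ∀ᶠ z in nhds y, (c z).IsInvertible :=
    Filter.eventually_of_mem (Metric.isOpen_ball.mem_nhds hyR) fun z hz ↦
      h.isRegularOn.isInvertible_metric hz
  set r : Eucl n → ℝ := fun z ↦ ‖z‖ with hr
  have hrd : ContDiffAt ℝ ∞ r y := contDiffAt_norm ℝ hy0
  have hrF := h.distFrom_comp_eventuallyEq hyR
  have hd2 : ContMDiffAt (𝓡 n) 𝓘(ℝ) 2 (distFrom p) (F y) :=
    (h.contMDiffAt_distFrom hyR hy0).of_le (WithTop.coe_le_coe.2 le_top)
  set N := gradOf c r with hN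
  have hNy : N y = ‖y‖⁻¹ • y := h.gradOf_norm hyR hy0
  have hNd : DifferentiableAt ℝ N y :=
    (gradOf_contDiffAt (m := 1) (hcd.of_le (WithTop.coe_le_coe.2 le_top)) hi.self_of_nhds
      (hrd.of_le (by exact WithTop.coe_le_coe.2 le_top))).differentiableAt (by simp)
  set a : Eucl n → ℝ := fun z ↦ (φ ‖z‖)⁻¹ with ha
  have hZN : Z =ᶠ[nhds y] fun z ↦ a z • N z := by
    filter_upwards [Metric.isOpen_ball.mem_nhds hy, isOpen_ne.mem_nhds hy0] with z hz hz0
    rw [hZr z hz hz0, hN, h.gradOf_norm (Metric.ball_subset_ball htR.le hz) hz0]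
  have had : HasFDerivAt a ((-deriv φ ‖y‖ / φ ‖y‖ ^ 2) • fderiv ℝ r y) y := by
    have h1 : HasDerivAt (fun s ↦ (φ s)⁻¹) (-deriv φ ‖y‖ / φ ‖y‖ ^ 2) ‖y‖ :=
      (differentiableAt_of_radial_field hφ hZ hZr hy hy0).hasDerivAt.fun_inv hφy
    exact h1.comp_hasFDerivAt y (hrd.differentiableAt (by simp)).hasFDerivAt
  have har : ∀ v, fderiv ℝ a y v = (-deriv φ ‖y‖ / φ ‖y‖ ^ 2) * (‖y‖⁻¹ * inner ℝ y v) := by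
    intro v
    rw [had.fderiv, smul_apply, fderiv_norm_apply hy0, smul_eq_mul]
  have hN1 : ‖y‖⁻¹ * inner ℝ y (N y) = 1 := by
    rw [hNy, inner_smul_right, real_inner_self_eq_norm_sq]
    field_simp
  have hlap : laplacian n (distFrom p) (F y) = divOf c N y :=
    (laplacian_eq h.isRegularOn hyR hd2).trans (divOf_congr c (gradOf_congr c hrF))
  refine ⟨?_, fun v ↦ ?_⟩
  · rw [divOf_congr c hZN, divOf_smul had.differentiableAt hNd, har, hN1, hlap, ha]
    field_simp
    ring
  · have hhess : hessian n (distFrom p) (F y) (mfderiv (𝓡 n) (𝓡 n) F y v)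
        (mfderiv (𝓡 n) (𝓡 n) F y v) = c y (covDeriv c N y v) v := by
      rw [hN, bilin_covDeriv_gradOf (hcd.differentiableAt (by simp)) hs hi
        (hrd.of_le (by exact WithTop.coe_le_coe.2 le_top)) hNd]
      exact (hessian_eq h.isRegularOn hyR hd2 v v).trans (hessOf_congr c hrF v v)
    have hcov : covDeriv c Z y v = a y • covDeriv c N y v + fderiv ℝ a y v • N y := by
      rw [← covDeriv_smul had.differentiableAt hNd, covDeriv, covDeriv, hZN.fderiv_eq,
        hZN.self_of_nhds]
    have hcN : c y (N y) v = ‖y‖⁻¹ * inner ℝ y v := by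
      rw [hNy, map_smul, smul_apply, h.gauss y hyR, smul_eq_mul]
    rw [hhess, hcov, map_add, add_apply, map_smul, map_smul, smul_apply, smul_apply, hcN, har,
      smul_eq_mul, smul_eq_mul, ha]
    field_simp
    ring

/-- The gradient of `u` and its radial part in normal coordinates. -/
theorem IsNormalChart.grad_and_radialDeriv (h : IsNormalChart p R F) {u : M → ℝ} {y : Eucl n}
    (hy : y ∈ Metric.ball (0 : Eucl n) R) (hu : ContMDiffAt (𝓡 n) 𝓘(ℝ) 1 u (F y)) :
    grad n u (F y) =
      mfderiv (𝓡 n) (𝓡 n) F y (gradOf (E := Eucl n) (pullMetric n F) (u ∘ F) y) ∧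
    ‖grad n u (F y)‖ ^ 2 = pullMetric n F y (gradOf (pullMetric n F) (u ∘ F) y)
      (gradOf (pullMetric n F) (u ∘ F) y) ∧
    (y ≠ 0 → radialDeriv n p u (F y) =
      ‖y‖⁻¹ * inner ℝ y (gradOf (pullMetric n F) (u ∘ F) y)) := by
  have h1 : grad n u (F y) =
      mfderiv (𝓡 n) (𝓡 n) F y (gradOf (E := Eucl n) (pullMetric n F) (u ∘ F) y) :=
    grad_eq h.isRegularOn hy (hu.mdifferentiableAt (by simp))
  refine ⟨h1, ?_, fun hy0 ↦ ?_⟩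
  · rw [h1, ← real_inner_self_eq_norm_sq]
    rfl
  · rw [radialDeriv, h1, (h.grad_distFrom hy hy0).1]
    have h2 : pullMetric n F y (gradOf (pullMetric n F) (u ∘ F) y) (‖y‖⁻¹ • y) =
        ‖y‖⁻¹ * inner ℝ y (gradOf (pullMetric n F) (u ∘ F) y) := by
      rw [pullMetric_symm, map_smul, smul_apply, h.gauss y hy, smul_eq_mul]
    exact h2

/-- The integrand on the sphere: as `|∇r| = 1`, one has `|∇_S u|² = |∇u|² - u_r²` and
`u_n = u_r`. -/
theorem norm_tangentialGrad_sq_sub (h : IsNormalChart p R F) (u : M → ℝ) {y : Eucl n}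
    (hy : y ∈ Metric.ball (0 : Eucl n) R) (hy0 : y ≠ 0) :
    ‖tangentialGrad n p u (F y)‖ ^ 2 - normalDeriv n p u (F y) ^ 2 =
      ‖grad n u (F y)‖ ^ 2 - 2 * radialDeriv n p u (F y) ^ 2 := by
  have h1 := (h.grad_distFrom hy hy0).2
  have h2 : unitNormal n p (F y) = grad n (distFrom p) (F y) := by
    rw [unitNormal, h1, inv_one, one_smul]
  have h3 : normalDeriv n p u (F y) = radialDeriv n p u (F y) := by
    rw [normalDeriv, h2, radialDeriv]
  rw [tangentialGrad, h3, h2, norm_sub_sq_real, norm_smul, h1, inner_smul_right, ← radialDeriv,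
    mul_one, Real.norm_eq_abs, sq_abs]
  ring

end Pohozaev

/-! ### The integrated Pohozaev identity -/

section Integral

variable {n : ℕ} {M : Type*} [EMetricSpace M] [ChartedSpace (Eucl n) M]
  [RiemannianBundle (fun x : M ↦ TangentSpace (𝓡 n) x)]
  [IsManifold (𝓡 n) ∞ M]
  [IsContMDiffRiemannianBundle (𝓡 n) ∞ (EuclideanSpace ℝ (Fin n))
      (fun x : M ↦ TangentSpace (𝓡 n) x)]
  {F : Eucl n → M} {U : Set (Eucl n)} {t lam : ℝ} {f : Eucl n → ℝ} {Z : Eucl n → Eucl n}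

/-- The integrated Rellich-Pohozaev identity on a ball in coordinates, for a solution of
`Δf + lam f = 0` and a smooth vector field `Z`. -/
theorem IsRegularOn.integral_pohozaev (h : IsRegularOn F U)
    (hU : Metric.closedBall (0 : Eucl n) t ⊆ U) (hn : n ≠ 0) (ht : 0 < t)
    (hf1 : ∀ y ∈ Metric.closedBall (0 : Eucl n) t, ContDiffAt ℝ 1 f y)
    (hf2 : ∀ y ∈ Metric.ball (0 : Eucl n) t, ContDiffAt ℝ 2 f y)
    (hZ : ∀ y ∈ Metric.closedBall (0 : Eucl n) t, ContDiffAt ℝ ∞ Z y)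
    (hlap : ∀ y ∈ Metric.ball (0 : Eucl n) t,
      divOf (pullMetric n F) (gradOf (pullMetric n F) f) y + lam * f y = 0) :
    letI c := pullMetric n F
    letI P := gradOf c f
    letI J₁ := fun y ↦ density c y * (c y (P y) (P y) * divOf c Z y)
    letI J₂ := fun y ↦ density c y *
      (c y (covDeriv c Z y (P y)) (P y) - lam * c y (P y) (Z y) * f y)
    IntegrableOn J₁ (Metric.ball 0 t) ∧ IntegrableOn J₂ (Metric.ball 0 t) ∧
    ContinuousOn P (Metric.closedBall 0 t) ∧
    (∫ y in Metric.ball 0 t, J₁ y) - 2 * ∫ y in Metric.ball 0 t, J₂ y =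
      t ^ (n - 1) * ∫ ξ : Metric.sphere (0 : Eucl n) 1, inner ℝ (ξ : Eucl n)
        (density c (t • (ξ : Eucl n)) •
          (c (t • (ξ : Eucl n)) (P (t • (ξ : Eucl n))) (P (t • (ξ : Eucl n))) • Z (t • (ξ : Eucl n))
            - (2 * c (t • (ξ : Eucl n)) (P (t • (ξ : Eucl n))) (Z (t • (ξ : Eucl n)))) •
              P (t • (ξ : Eucl n)))) ∂(volume : Measure (Eucl n)).toSphere := by
  set c := pullMetric n F with hc
  set P := gradOf c f with hP
  have hsub : Metric.ball (0 : Eucl n) t ⊆ Metric.closedBall 0 t := Metric.ball_subset_closedBall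
  have hcd : ∀ y ∈ Metric.closedBall (0 : Eucl n) t, ContDiffAt ℝ ∞ c y := fun y hy ↦
    h.contDiffAt_metric (hU hy)
  have hci : ∀ y ∈ Metric.closedBall (0 : Eucl n) t, (c y).IsInvertible := fun y hy ↦
    h.isInvertible_metric (hU hy)
  have hle : ∀ m : ℕ∞, (m : WithTop ℕ∞) ≤ (∞ : WithTop ℕ∞) := fun m ↦ WithTop.coe_le_coe.2 le_top
  have hP0 : ContinuousOn P (Metric.closedBall 0 t) := fun y hy ↦
    (gradOf_contDiffAt (m := 0) ((hcd y hy).of_le (hle 0)) (hci y hy)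
      (by simpa using! hf1 y hy)).continuousAt.continuousWithinAt
  have hP1 : ∀ y ∈ Metric.ball (0 : Eucl n) t, ContDiffAt ℝ 1 P y := fun y hy ↦
    gradOf_contDiffAt ((hcd y (hsub hy)).of_le (hle 1)) (hci y (hsub hy))
      (by simpa using! hf2 y hy)
  have hc0 : ContinuousOn c (Metric.closedBall 0 t) := fun y hy ↦
    (hcd y hy).continuousAt.continuousWithinAt
  have hZ0 : ContinuousOn Z (Metric.closedBall 0 t) := fun y hy ↦
    (hZ y hy).continuousAt.continuousWithinAt
  have hf0 : ContinuousOn f (Metric.closedBall 0 t) := fun y hy ↦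
    (hf1 y hy).continuousAt.continuousWithinAt
  have hd0 : ContinuousOn (density c) (Metric.closedBall 0 t) :=
    h.contDiffOn_density.continuousOn.mono hU
  have hcov : ContinuousOn (covDeriv c Z) (Metric.closedBall 0 t) := fun y hy ↦
    (continuousAt_covDeriv ((hcd y hy).of_le (hle 1)) (hci y hy)
      ((hZ y hy).of_le (hle 1))).continuousWithinAt
  have hdiv : ContinuousOn (divOf c Z) (Metric.closedBall 0 t) := by
    have h1 : Continuous fun L : Eucl n →L[ℝ] Eucl n ↦ LinearMap.trace ℝ (Eucl n) L.toLinearMap :=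
      (LinearMap.trace ℝ (Eucl n) ∘ₗ
        ContinuousLinearMap.coeLM ℝ (M := Eucl n) (N₃ := Eucl n)).continuous_of_finiteDimensional
    exact h1.comp_continuousOn hcov
  have hcPP := (hc0.clm_apply hP0).clm_apply hP0
  have hcPZ := (hc0.clm_apply hP0).clm_apply hZ0
  have hint : ∀ {g : Eucl n → ℝ}, ContinuousOn g (Metric.closedBall 0 t) →
      IntegrableOn g (Metric.ball 0 t) := fun hg ↦
    (hg.integrableOn_compact (isCompact_closedBall _ _)).mono_set hsub
  have hJ₁ : IntegrableOn (fun y ↦ density c y * (c y (P y) (P y) * divOf c Z y))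
      (Metric.ball 0 t) := hint (hd0.mul (hcPP.mul hdiv))
  have hJ₂ : IntegrableOn (fun y ↦ density c y *
      (c y (covDeriv c Z y (P y)) (P y) - lam * c y (P y) (Z y) * f y))
      (Metric.ball 0 t) := hint (hd0.mul (((hc0.clm_apply (hcov.clm_apply hP0)).clm_apply hP0).sub
    ((continuousOn_const (c := lam)).mul hcPZ |>.mul hf0)))
  refine ⟨hJ₁, hJ₂, hP0, ?_⟩
  set W : Eucl n → Eucl n := fun y ↦ c y (P y) (P y) • Z y - (2 * c y (P y) (Z y)) • P y with hW
  have hW0 : ContinuousOn W (Metric.closedBall 0 t) :=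
    (hcPP.smul hZ0).sub ((continuousOn_const.mul hcPZ).smul hP0)
  have hW1 : ∀ y ∈ Metric.ball (0 : Eucl n) t, ContDiffAt ℝ 1 W y := fun y hy ↦ by
    have h1 := (hcd y (hsub hy)).of_le (hle 1)
    have h2 := (hZ y (hsub hy)).of_le (hle 1)
    have h3 := hP1 y hy
    exact (((h1.clm_apply h3).clm_apply h3).fun_smul h2).sub
      ((contDiffAt_const.mul ((h1.clm_apply h3).clm_apply h2)).fun_smul h3)
  have htr : ∀ y ∈ Metric.ball (0 : Eucl n) t,
      LinearMap.trace ℝ (Eucl n) (fderiv ℝ (fun z ↦ density c z • W z) y).toLinearMap =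
        density c y * (c y (P y) (P y) * divOf c Z y) - 2 * (density c y *
          (c y (covDeriv c Z y (P y)) (P y) - lam * c y (P y) (Z y) * f y)) := by
    intro y hy
    have hi : ∀ᶠ z in nhds y, (c z).IsInvertible :=
      Filter.eventually_of_mem (Metric.isOpen_ball.mem_nhds hy) fun z hz ↦ hci z (hsub hz)
    have hs : ∀ᶠ z in nhds y, ∀ v w, c z v w = c z w v :=
      .of_forall fun z ↦ pullMetric_symm n F z
    rw [trace_fderiv_density_smul ((hcd y (hsub hy)).differentiableAt (by simp)) hs
      hi.self_of_nhds (h.det_pos (hU (hsub hy))) ((hW1 y hy).differentiableAt (by simp)), hW,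
      divOf_pohozaev ((hcd y (hsub hy)).of_le (hle 1)) hs hi (hf2 y hy)
        ((hZ y (hsub hy)).differentiableAt (by simp)), eq_neg_of_add_eq_zero_left (hlap y hy)]
    ring
  have hball := measurableSet_ball (x := (0 : Eucl n)) (ε := t)
  have hdivthm := integral_divergence_ball hn ht (Y := fun z ↦ density c z • W z)
    (hd0.smul hW0)
    (fun y hy ↦ (((h.contDiffOn_density.contDiffAt (h.isOpen.mem_nhds (hU (hsub hy)))).of_le
      (hle 1)).fun_smul (hW1 y hy)).contDiffWithinAt)
    (((hJ₁.sub (hJ₂.const_mul 2)).congr_fun (fun y hy ↦ (htr y hy).symm) hball))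
  rw [← hdivthm, setIntegral_congr_fun hball htr, integral_sub hJ₁ (hJ₂.const_mul 2),
    integral_const_mul]

end Integral

end

end RiemGeom

theorem mainTheorem6 {n : ℕ} {M : Type*} [EMetricSpace M]
    [ChartedSpace (EuclideanSpace ℝ (Fin n)) M] [IsManifold (𝓡 n) ∞ M]
    [RiemannianBundle (fun x : M ↦ TangentSpace (𝓡 n) x)]
    [IsContMDiffRiemannianBundle (𝓡 n) ∞ (EuclideanSpace ℝ (Fin n))
      (fun x : M ↦ TangentSpace (𝓡 n) x)]
    [IsRiemannianManifold (𝓡 n) M] [MeasurableSpace M] [BorelSpace M]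
    (p : M) (t : ℝ) (ht : 0 < t) (htinj : ENNReal.ofReal t < injRadius n p)
    (lam : ℝ) (u : M → ℝ)
    (hu2 : ContMDiffOn (𝓡 n) 𝓘(ℝ) 2 u (geodBall p t))
    (hu1 : ∀ x : M, edist x p ≤ ENNReal.ofReal t → ContMDiffAt (𝓡 n) 𝓘(ℝ) 1 u x)
    (hu : ∀ x ∈ geodBall p t, laplacian n u x + lam * u x = 0)
    (φ : ℝ → ℝ) (hφ : ∀ s, 0 < s → 0 < φ s)
    (hX : ∃ (U : Set M) (X : ∀ x : M, TangentSpace (𝓡 n) x), IsOpen U ∧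
      {x : M | edist x p ≤ ENNReal.ofReal t} ⊆ U ∧
      ContMDiffOn (𝓡 n) (𝓡 n).tangent ∞
        (fun x ↦ (⟨x, X x⟩ : TangentBundle (𝓡 n) M)) U ∧
      ∀ x ∈ U, x ≠ p → X x = (φ (distFrom p x))⁻¹ • grad n (distFrom p) x) :
    Integrable (fun x ↦ ‖tangentialGrad n p u x‖ ^ 2 - normalDeriv n p u x ^ 2)
      (sphereMeasure n p t) ∧
    IntegrableOn (fun x ↦ ‖grad n u x‖ ^ 2 *
        ((φ (distFrom p x) * laplacian n (distFrom p) x - deriv φ (distFrom p x))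
          / φ (distFrom p x) ^ 2)) (geodBall p t) (riemVol n M) ∧
    IntegrableOn (fun x ↦
        ((hessian n (distFrom p) x (grad n u x) (grad n u x)
            - lam * radialDeriv n p u x * u x) * φ (distFrom p x)
          - deriv φ (distFrom p x) * radialDeriv n p u x ^ 2)
          / φ (distFrom p x) ^ 2) (geodBall p t) (riemVol n M) ∧
    ∫ x, (‖tangentialGrad n p u x‖ ^ 2 - normalDeriv n p u x ^ 2) ∂(sphereMeasure n p t)
      = φ t * ∫ x in geodBall p t, ‖grad n u x‖ ^ 2 *
          ((φ (distFrom p x) * laplacian n (distFrom p) x - deriv φ (distFrom p x))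
            / φ (distFrom p x) ^ 2) ∂(riemVol n M)
        - 2 * φ t * ∫ x in geodBall p t,
          ((hessian n (distFrom p) x (grad n u x) (grad n u x)
              - lam * radialDeriv n p u x * u x) * φ (distFrom p x)
            - deriv φ (distFrom p x) * radialDeriv n p u x ^ 2)
            / φ (distFrom p x) ^ 2 ∂(riemVol n M) := by
  obtain rfl | ⟨k, rfl⟩ : n = 0 ∨ ∃ k, n = k + 1 := by
    cases n
    · exact .inl rfl
    · exact .inr ⟨_, rfl⟩
  · -- in dimension zero all tangent vectors, hence all integrands, vanish
    have hg : ∀ x, grad 0 u x = 0 := fun x ↦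
      @Subsingleton.elim _ (inferInstanceAs (Subsingleton (Eucl 0))) _ _
    simp [tangentialGrad, normalDeriv, radialDeriv, hessian, hg]
  obtain ⟨U, X, hU, hUt, hXs, hXr⟩ := hX
  obtain ⟨R, htR, F, h⟩ := exists_isNormalChart ht htinj
  have hsub : Metric.closedBall (0 : Eucl (k + 1)) t ⊆ Metric.ball 0 R :=
    Metric.closedBall_subset_ball htR
  have hsub' : Metric.ball (0 : Eucl (k + 1)) t ⊆ Metric.closedBall 0 t :=
    Metric.ball_subset_closedBall
  have hreg : IsRegularOn F (Metric.ball 0 t) :=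
    h.isRegularOn.mono Metric.isOpen_ball (hsub'.trans hsub)
  have hinj : Set.InjOn F (Metric.ball 0 t) := h.injOn.mono (hsub'.trans hsub)
  have hball := measurableSet_ball (x := (0 : Eucl (k + 1))) (ε := t)
  have hgb := h.geodBall_eq ht htR
  have hcb : ∀ y ∈ Metric.closedBall (0 : Eucl (k + 1)) t, edist (F y) p ≤ ENNReal.ofReal t :=
    fun y hy ↦ (h.closedBall_eq ht htR).symm.subset (Set.mem_image_of_mem F hy)
  have hu1' : ∀ y ∈ Metric.closedBall (0 : Eucl (k + 1)) t,
      ContMDiffAt (𝓡 (k + 1)) 𝓘(ℝ) 1 u (F y) :=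
    fun y hy ↦ hu1 _ (hcb y hy)
  have hgopen : IsOpen (geodBall p t) := by
    rw [hgb]
    exact h.isRegularOn.isOpen_image Metric.isOpen_ball (hsub'.trans hsub)
  have hu2' : ∀ y ∈ Metric.ball (0 : Eucl (k + 1)) t, ContMDiffAt (𝓡 (k + 1)) 𝓘(ℝ) 2 u (F y) :=
    fun y hy ↦ hu2.contMDiffAt (hgopen.mem_nhds (hgb ▸ Set.mem_image_of_mem F hy))
  have hFy := fun y (hy : y ∈ Metric.closedBall (0 : Eucl (k + 1)) t) ↦
    h.isRegularOn.contMDiffAt (hsub hy)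
  -- the vector field `φ(r)⁻¹ ∇r` in normal coordinates
  obtain ⟨Z, hZ⟩ := h.isRegularOn.exists_pullback_field hU hXs
  have hZs : ∀ y ∈ Metric.closedBall (0 : Eucl (k + 1)) t, ContDiffAt ℝ ∞ Z y := fun y hy ↦
    (hZ y (hsub hy) (hUt (hcb y hy))).1
  have hZr : ∀ y ∈ Metric.closedBall (0 : Eucl (k + 1)) t, y ≠ 0 →
      Z y = (φ ‖y‖)⁻¹ • (‖y‖⁻¹ • y) := by
    intro y hy hy0
    have hne : F y ≠ p := fun hp ↦ hy0 (h.injOn (hsub hy)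
      (Metric.mem_ball_self (ht.trans htR)) (hp.trans h.map_zero.symm))
    refine h.immersion y (hsub hy) ((hZ y (hsub hy) (hUt (hcb y hy))).2.trans ?_)
    rw [hXr _ (hUt (hcb y hy)) hne, h.distFrom_eq (hsub hy), (h.grad_distFrom (hsub hy) hy0).1]
    exact (map_smul (mfderiv (𝓡 (k + 1)) (𝓡 (k + 1)) F y :
      Eucl (k + 1) →L[ℝ] Eucl (k + 1)) _ _).symm
  set c := pullMetric (k + 1) F with hc
  set P := gradOf c (u ∘ F) with hP
  -- the integrands in normal coordinates, away from the origin
  have hI : ∀ y ∈ Metric.ball (0 : Eucl (k + 1)) t, y ≠ 0 →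
      ‖grad (k + 1) u (F y)‖ ^ 2 * ((φ (distFrom p (F y)) * laplacian (k + 1) (distFrom p) (F y)
        - deriv φ (distFrom p (F y))) / φ (distFrom p (F y)) ^ 2) =
        c y (P y) (P y) * divOf c Z y ∧
      ((hessian (k + 1) (distFrom p) (F y) (grad (k + 1) u (F y)) (grad (k + 1) u (F y))
            - lam * radialDeriv (k + 1) p u (F y) * u (F y)) * φ (distFrom p (F y))
          - deriv φ (distFrom p (F y)) * radialDeriv (k + 1) p u (F y) ^ 2)
          / φ (distFrom p (F y)) ^ 2 =
        c y (covDeriv c Z y (P y)) (P y) - lam * c y (P y) (Z y) * (u ∘ F) y := by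
    intro y hy hy0
    have hyR := hsub (hsub' hy)
    obtain ⟨h1, h2⟩ := h.covDeriv_radial htR hφ
      (fun z hz ↦ (hZs z (hsub' hz)).differentiableAt (by simp))
      (fun z hz ↦ hZr z (hsub' hz)) hy hy0
    obtain ⟨h3, h4, h5⟩ := h.grad_and_radialDeriv hyR (hu1' y (hsub' hy))
    have hφy : φ ‖y‖ ≠ 0 := (hφ _ (norm_pos_iff.2 hy0)).ne'
    rw [h.distFrom_eq hyR, h4, h1]
    refine ⟨rfl, ?_⟩
    have h6 : c y (P y) (Z y) = (φ ‖y‖)⁻¹ * radialDeriv (k + 1) p u (F y) := by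
      rw [hZr y (hsub' hy) hy0, h5 hy0, hc, pullMetric_symm, map_smul, map_smul, smul_apply,
        smul_apply, h.gauss y hyR, smul_eq_mul, smul_eq_mul]
    have h7 := h2 (P y)
    rw [h7, h6, h5 hy0, h3, Function.comp_apply]
    field_simp
    ring
  have hae : ∀ᵐ y ∂(volume.restrict (Metric.ball (0 : Eucl (k + 1)) t)),
      y ∈ Metric.ball (0 : Eucl (k + 1)) t ∧ y ≠ 0 :=
    (ae_restrict_mem hball).and
      (ae_restrict_of_ae (compl_mem_ae_iff.2 (measure_singleton (0 : Eucl (k + 1)))))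
  have hlap : ∀ y ∈ Metric.ball (0 : Eucl (k + 1)) t, divOf c P y + lam * (u ∘ F) y = 0 := by
    intro y hy
    have h1 := hu (F y) (hgb ▸ Set.mem_image_of_mem F hy)
    rwa [laplacian_eq h.isRegularOn (hsub (hsub' hy)) (hu2' y hy)] at h1
  obtain ⟨hJ₁, hJ₂, hPc, hJ⟩ := h.isRegularOn.integral_pohozaev hsub k.succ_ne_zero ht
    (fun y hy ↦ ((hu1' y hy).comp y ((hFy y hy).of_le (WithTop.coe_le_coe.2 le_top))).contDiffAt)
    (fun y hy ↦ ((hu2' y hy).comp y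
      ((hFy y (hsub' hy)).of_le (WithTop.coe_le_coe.2 le_top))).contDiffAt) hZs hlap
  have hc0 : ContinuousOn c (Metric.closedBall 0 t) := fun y hy ↦
    (h.isRegularOn.contDiffAt_metric (hsub hy)).continuousAt.continuousWithinAt
  have hmem : ∀ ξ : Metric.sphere (0 : Eucl (k + 1)) 1,
      t • (ξ : Eucl (k + 1)) ∈ Metric.closedBall (0 : Eucl (k + 1)) t := fun ξ ↦ by
    rw [mem_closedBall_zero_iff, norm_smul, norm_eq_of_mem_sphere, mul_one,
      Real.norm_of_nonneg ht.le]
  have hnorm : ∀ ξ : Metric.sphere (0 : Eucl (k + 1)) 1, ‖t • (ξ : Eucl (k + 1))‖ = t := fun ξ ↦ by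
    rw [norm_smul, norm_eq_of_mem_sphere, mul_one, Real.norm_of_nonneg ht.le]
  have hne : ∀ ξ : Metric.sphere (0 : Eucl (k + 1)) 1, t • (ξ : Eucl (k + 1)) ≠ 0 := fun ξ ↦
    norm_ne_zero_iff.1 ((hnorm ξ).symm ▸ ht.ne')
  have hPs : Continuous fun ξ : Metric.sphere (0 : Eucl (k + 1)) 1 ↦ P (t • (ξ : Eucl (k + 1))) :=
    hPc.comp_continuous (by fun_prop) hmem
  have hcs : Continuous fun ξ : Metric.sphere (0 : Eucl (k + 1)) 1 ↦ c (t • (ξ : Eucl (k + 1))) :=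
    hc0.comp_continuous (by fun_prop) hmem
  obtain ⟨hS, hS'⟩ := h.integral_sphereMeasure ht htR
    (g := fun x ↦ ‖tangentialGrad (k + 1) p u x‖ ^ 2 - normalDeriv (k + 1) p u x ^ 2)
    (g' := fun ξ ↦ c (t • (ξ : Eucl (k + 1))) (P (t • (ξ : Eucl (k + 1))))
      (P (t • (ξ : Eucl (k + 1)))) -
        2 * inner ℝ (ξ : Eucl (k + 1)) (P (t • (ξ : Eucl (k + 1)))) ^ 2)
    (((hcs.clm_apply hPs).clm_apply hPs).sub
      (continuous_const.mul ((continuous_subtype_val.inner hPs).pow 2))) (fun ξ ↦ by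
        obtain ⟨-, h4, h5⟩ := h.grad_and_radialDeriv (hsub (hmem ξ)) (hu1' _ (hmem ξ))
        rw [norm_tangentialGrad_sq_sub h u (hsub (hmem ξ)) (hne ξ), h4, h5 (hne ξ), hnorm,
          inner_smul_left, conj_trivial, inv_mul_cancel_left₀ ht.ne'])
  have hI₁ := hJ₁.congr_fun_ae (hae.mono fun y hy ↦
    congrArg (density c y * ·) (hI y hy.1 hy.2).1.symm)
  have hI₂ := hJ₂.congr_fun_ae (hae.mono fun y hy ↦
    congrArg (density c y * ·) (hI y hy.1 hy.2).2.symm)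
  refine ⟨hS, ?_, ?_, ?_⟩
  · rw [hgb, hreg.integrableOn_riemVol_iff hinj]
    exact hI₁
  · rw [hgb, hreg.integrableOn_riemVol_iff hinj]
    exact hI₂
  rw [hS', hgb, hreg.setIntegral_riemVol hinj, hreg.setIntegral_riemVol hinj,
    ← integral_congr_ae (hae.mono fun y hy ↦
      congrArg (density c y * ·) (hI y hy.1 hy.2).1.symm),
    ← integral_congr_ae (hae.mono fun y hy ↦
      congrArg (density c y * ·) (hI y hy.1 hy.2).2.symm)]
  have hφt : φ t ≠ 0 := (hφ t ht).ne'
  -- by the Gauss lemma, the flux of the Pohozaev field through the sphere is `φ(t)⁻¹` times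
  -- the integrand on the sphere
  have hflux : ∀ ξ : Metric.sphere (0 : Eucl (k + 1)) 1, inner ℝ (ξ : Eucl (k + 1))
      (density c (t • (ξ : Eucl (k + 1))) •
        (c (t • (ξ : Eucl (k + 1))) (P (t • (ξ : Eucl (k + 1)))) (P (t • (ξ : Eucl (k + 1)))) •
          Z (t • (ξ : Eucl (k + 1)))
          - (2 * c (t • (ξ : Eucl (k + 1))) (P (t • (ξ : Eucl (k + 1))))
            (Z (t • (ξ : Eucl (k + 1))))) • P (t • (ξ : Eucl (k + 1))))) =
      (φ t)⁻¹ * (density c (t • (ξ : Eucl (k + 1))) *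
        (c (t • (ξ : Eucl (k + 1))) (P (t • (ξ : Eucl (k + 1))))
          (P (t • (ξ : Eucl (k + 1)))) -
        2 * inner ℝ (ξ : Eucl (k + 1)) (P (t • (ξ : Eucl (k + 1)))) ^ 2)) := by
    intro ξ
    have h1 : Z (t • (ξ : Eucl (k + 1))) = (φ t)⁻¹ • (ξ : Eucl (k + 1)) := by
      rw [hZr _ (hmem ξ) (hne ξ), hnorm, inv_smul_smul₀ ht.ne']
    have h2 : c (t • (ξ : Eucl (k + 1))) (P (t • (ξ : Eucl (k + 1)))) (ξ : Eucl (k + 1)) =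
        inner ℝ (ξ : Eucl (k + 1)) (P (t • (ξ : Eucl (k + 1)))) := by
      have h3 := h.gauss _ (hsub (hmem ξ)) (P (t • (ξ : Eucl (k + 1))))
      rw [map_smul, smul_apply, inner_smul_left, smul_eq_mul] at h3
      rw [hc, pullMetric_symm]
      exact mul_left_cancel₀ ht.ne' h3
    rw [h1, map_smul, h2, inner_smul_right, inner_sub_right, inner_smul_right, inner_smul_right,
      inner_smul_right, real_inner_self_eq_norm_sq, norm_eq_of_mem_sphere, smul_eq_mul]
    ring
  have hJ' := congrArg (φ t * ·) (hJ.trans (congrArg (t ^ k * ·)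
    ((integral_congr_ae (.of_forall hflux)).trans (integral_const_mul _ _))))
  simp only [mul_sub] at hJ'
  rw [mul_left_comm (φ t) (t ^ k), mul_inv_cancel_left₀ hφt] at hJ'
  simp only [mul_assoc, mul_sub] at hJ' ⊢
  refine hJ'.symm.trans ?_
  ring
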